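/- **Setting.** Let $\Phi:\mathbb Z\to\mathbb R$ and $\omega_0>0$ be such that $|\Phi(x)|\le Ce^{-\delta'|x|}$ for some $C,\delta'>0$ and all $x$, $\Phi(-x)=\Phi(x)$, and $\widehat\Phi(k):=\sum_{x\in\mathbb Z}\Phi(x)e^{-i2\pi kx}\ge\omega_0^2$ for all $k\in\mathbb T=\mathbb R/\mathbb Z$. Put $\omega(k)=\sqrt{\widehat\Phi(k)}$. Let $\gamma>0$ satisfy $\gamma^2>4\max_k\widehat\Phi(k)$, put $u(k)=\sqrt{(\gamma/2)^2-\omega(k)^2}$, $\mu_{\pm}(k)=\frac\gamma2\pm u(k)$ and $$\widehat A_t(k)=\frac{1}{2u(k)}\Bigl(\mu_+(k)e^{-t\mu_+(k)}-\mu_-(k)e^{-t\mu_-(k)}\Bigr),\qquad t\ge0,$$ and assume that for every $\varepsilon>0$ there is $C_\varepsilon>0$ such that $$\int_0^\infty\!dt\int_{\mathbb T}\!dk\,\Bigl(\widehat A_t\bigl(k+\tfrac{k_0}2\bigr)-\widehat A_t\bigl(k-\tfrac{k_0}2\bigr)\Bigr)^2\ge C_\varepsilon\quad\text{whenever }\varepsilon\le|k_0|\le\tfrac12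 .$$ For $L\ge1$ let $\Lambda_L=\{n\in\mathbb Z: -L<2n\le L\}$, $\Lambda_L^*=\Lambda_L/L$, $\int_{\Lambda_L^*}dk\,f(k)=\frac1L\sum_{k\in\Lambda_L^*}f(k)$, and for $t\ge0$, $x\in\Lambda_L$, $$p_{t,x}=2\gamma\Bigl(\int_{\Lambda_L^*}\!dk\,e^{-i2\pi kx}\widehat A_t(k)\Bigr)^2,\qquad \widehat p(\lambda,k)=\int_0^\infty\!ds\sum_{y\in\Lambda_L}p_{s,y}e^{-s\lambda}e^{-i2\pi ky},$$ $$G(t,x)=p_{t,x}+\int_{\Lambda_L^*}\!dk\,e^{i2\pi kx}\int_{\eta-i\infty}^{\eta+i\infty}\frac{d\lambda}{2\pi i}\,e^{\lambda t}\frac{\widehat p(\lambda,k)^2}{1-\widehat p(\lambda,k)}$$ with any $\eta>0$ (the value does not depend on $\eta$); $G$ is the Green's function of the renewal equation with kernel $p$. Set $\delta_0=\omega_0^2/\gamma$ and $$\widehat D(k;L)=\gamma\sum_{y\in\Lambda_L}\bigl(1-\cos(2\pi ky)\bigr)\int_0^\infty\!ds\,p_{s,y},\qquad k\in\Lambda_L^*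 .$$ **Statement.** There are constants $c_0',c_1',c_2',c_3',c_4',\kappa',\delta,\varepsilon_0,\beta>0$ with $\beta\le\delta_0/2$, and $L_0\ge1$, all independent of $L$, such that for every $L\ge L_0$ the following holds. For each $k\in\Lambda_L^*$ with $|k|\le\varepsilon_0$ there is a unique $R(k)\in[0,\beta]$ with $$1=\int_0^\infty\!ds\,e^{sR(k)}\sum_{y\in\Lambda_L}p_{s,y}\cos(2\pi ky);$$ define then $a(k)$ by $$\frac1{a(k)}=\int_0^\infty\!ds\,s\,e^{sR(k)}\sum_{y\in\Lambda_L}p_{s,y}\cos(2\pi ky),$$ and for $k\in\Lambda_L^*$ with $|k|>\varepsilon_0$ put $a(k)=0$, $R(k)=\beta$. Then for all $x\in\Lambda_L$ and $t\ge0$ $$G(t,x)=\int_{\Lambda_L^*}\!dk\,e^{i2\pi kx}a(k)e^{-tR(k)}+\Delta(t,x),\qquad|\Delta(t,x)|\le c_0'e^{-\delta t}.$$ Moreover, for all $k\in\Lambda_L^*$ with $|k|\le\varepsilon_0$, 1. $0<a(k)\le c_0'$; 2. $\int_0^\infty ds\sum_{y\in\Lambda_L}y^2p_{s,y}\ge\kappa'$;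 3. $c_1'k^2\le R(k)\le c_2'k^2$ and $|\widehat D(k;L)-R(k)|\le c_4'k^4$; and $\widehat D(k';L)\ge c_3'\min(|k'|,\varepsilon_0)^2$ for all $k'\in\Lambda_L^*$. -/

import Mathlib

noncomputable section

namespace VelocityFlip

/-- The periodic lattice `Λ_L`: `{-(L-1)/2, …, (L-1)/2}` for odd `L` and
`{-L/2+1, …, L/2}` for even `L`. -/
def lattice (L : ℕ) : Finset ℤ :=
  Finset.Icc (-(((L : ℤ) - 1) / 2)) ((L : ℤ) / 2)

theorem mem_lattice {L : ℕ} {n : ℤ} : n ∈ lattice L ↔ -(L : ℤ) < 2 * n ∧ 2 * n ≤ L := by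
  simp only [lattice, Finset.mem_Icc]
  omega

theorem card_lattice (L : ℕ) : (lattice L).card = L := by
  simp only [lattice, Int.card_Icc]
  omega

/-- The dual lattice `Λ_L^* = Λ_L / L`, a subset of `(-1/2, 1/2]`. -/
def dualLattice (L : ℕ) : Set ℝ :=
  {k | ∃ n ∈ lattice L, k = (n : ℝ) / L}

/-- The normalized sum over the dual lattice,
`∫_{Λ_L^*} dk f(k) = |Λ_L|⁻¹ ∑_{k ∈ Λ_L^*} f(k)`. -/
def dualInt (L : ℕ) (f : ℝ → ℂ) : ℂ :=
  (1 / (L : ℂ)) * ∑ n ∈ lattice L, f ((n : ℝ) / L)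

/-- The plane wave `e^{i 2π k x}`. -/
def wave (k : ℝ) (x : ℤ) : ℂ :=
  Complex.exp (Complex.I * (2 * (Real.pi : ℂ) * (k : ℂ) * (x : ℂ)))

/-- The Fourier transform `∑_{x ∈ ℤ} Φ(x) e^{-i 2π k x}` of the coupling `Φ`.  It is real valued
for symmetric `Φ`, which is why only the real part is recorded. -/
def phiHat (Φ : ℤ → ℝ) (k : ℝ) : ℝ :=
  (∑' x : ℤ, (Φ x : ℂ) * wave (-k) x).re

/-- The standing assumptions on the coupling: exponential decay, symmetry, and pinning with
constant `ω₀`. -/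
structure CouplingAssumption (Φ : ℤ → ℝ) (ω₀ : ℝ) : Prop where
  decay : ∃ C δ : ℝ, 0 < C ∧ 0 < δ ∧ ∀ x : ℤ, |Φ x| ≤ C * Real.exp (-δ * |(x : ℝ)|)
  symm : ∀ x : ℤ, Φ (-x) = Φ x
  omega_pos : 0 < ω₀
  pinning : ∀ k : ℝ, ω₀ ^ 2 ≤ phiHat Φ k

/-- The dispersion relation `ω(k)`. -/
def omega (Φ : ℤ → ℝ) (k : ℝ) : ℝ := Real.sqrt (phiHat Φ k)

/-- `u(k) = √((γ/2)² - ω(k)²)`. -/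
def uFun (Φ : ℤ → ℝ) (γ k : ℝ) : ℝ := Real.sqrt ((γ / 2) ^ 2 - omega Φ k ^ 2)

/-- `μ_σ(k) = γ/2 + σ u(k)`, used for `σ = 1` and `σ = -1`. -/
def muFun (Φ : ℤ → ℝ) (γ σ k : ℝ) : ℝ := γ / 2 + σ * uFun Φ γ k

/-- `Â²_t(k) = (2 u(k))⁻¹ ∑_{σ = ±1} σ μ_σ(k) e^{-t μ_σ(k)}`: the lower right entry of
`exp (-t M(k))`, where `M(k)` is the matrix with rows `(0, ω(k)²)` and `(-1, γ)`. -/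
def A2hat (Φ : ℤ → ℝ) (γ t k : ℝ) : ℝ :=
  1 / (2 * uFun Φ γ k) *
    (muFun Φ γ 1 k * Real.exp (-t * muFun Φ γ 1 k)
      - muFun Φ γ (-1) k * Real.exp (-t * muFun Φ γ (-1) k))

/-- The assumptions on the flipping rate `γ`: the noise dominates (`γ² > 4 max_k Φ̂(k)`; the
maximum is attained), and the harmonic forces are nondegenerate. -/
structure NoiseAssumption (Φ : ℤ → ℝ) (γ : ℝ) : Prop where
  gamma_pos : 0 < γ
  dominates : ∀ k : ℝ, 4 * phiHat Φ k < γ ^ 2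
  nondegenerate : ∀ ε : ℝ, 0 < ε → ∃ C : ℝ, 0 < C ∧
    ∀ k₀ : ℝ, ε ≤ |k₀| → |k₀| ≤ 1 / 2 →
      C ≤ ∫ t in Set.Ioi (0 : ℝ), ∫ k in (-(1 / 2) : ℝ)..(1 / 2),
        (A2hat Φ γ t (k + k₀ / 2) - A2hat Φ γ t (k - k₀ / 2)) ^ 2

/-- The memory kernel `p_{t,x} = 2γ (∫_{Λ_L^*} dk e^{-i 2π k x} Â²_t(k))²`.  The number being
squared is real because `Â²_t` is even and `1`-periodic. -/
def memKernel (Φ : ℤ → ℝ) (γ : ℝ) (L : ℕ) (t : ℝ) (x : ℤ) : ℝ :=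
  2 * γ * ((dualInt L fun k => wave (-k) x * (A2hat Φ γ t k : ℂ)).re) ^ 2

/-- The Laplace-Fourier transform
`p̂(z,k) = ∫_0^∞ ds ∑_{y ∈ Λ_L} p_{s,y} e^{-s z} e^{-i 2π k y}`. -/
def pHat (Φ : ℤ → ℝ) (γ : ℝ) (L : ℕ) (z : ℂ) (k : ℝ) : ℂ :=
  ∫ s in Set.Ioi (0 : ℝ), ∑ y ∈ lattice L,
    (memKernel Φ γ L s y : ℂ) * Complex.exp (-(s : ℂ) * z) * wave (-k) y

/-- The contour integral `∫_{η - i∞}^{η + i∞} dz / (2πi) f(z)` along a vertical line. -/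
def vertInt (η : ℝ) (f : ℂ → ℂ) : ℂ :=
  1 / (2 * (Real.pi : ℂ)) * ∫ α : ℝ, f ((η : ℂ) + Complex.I * (α : ℂ))

/-- The Green's function of the renewal equation with memory kernel `p`,
`G(t,x) = p_{t,x} + ∫_{Λ_L^*} dk e^{i 2π k x}
    ∫_{η - i∞}^{η + i∞} dz / (2πi) e^{z t} p̂(z,k)² / (1 - p̂(z,k))`,
computed with the contour through `η > 0`, on which it does not depend. -/
def green (Φ : ℤ → ℝ) (γ : ℝ) (L : ℕ) (η t : ℝ) (x : ℤ) : ℂ :=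
  (memKernel Φ γ L t x : ℂ) + dualInt L fun k => wave k x *
    vertInt η fun z =>
      Complex.exp (z * (t : ℂ)) * (pHat Φ γ L z k ^ 2 / (1 - pHat Φ γ L z k))

/-- `∑_{y ∈ Λ_L} p_{s,y} cos(2π k y)`. -/
def cosSum (Φ : ℤ → ℝ) (γ : ℝ) (L : ℕ) (k s : ℝ) : ℝ :=
  ∑ y ∈ lattice L, memKernel Φ γ L s y * Real.cos (2 * Real.pi * k * (y : ℝ))

/-- `r` solves the dispersion equation `1 = ∫_0^∞ ds e^{s r} ∑_y p_{s,y} cos(2π k y)`. -/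
def SolvesDispersion (Φ : ℤ → ℝ) (γ : ℝ) (L : ℕ) (k r : ℝ) : Prop :=
  1 = ∫ s in Set.Ioi (0 : ℝ), Real.exp (s * r) * cosSum Φ γ L k s

/-- `D̂(k;L) = γ ∑_{y ∈ Λ_L} (1 - cos(2π k y)) ∫_0^∞ ds p_{s,y}`. -/
def Dhat (Φ : ℤ → ℝ) (γ : ℝ) (L : ℕ) (k : ℝ) : ℝ :=
  γ * ∑ y ∈ lattice L, (1 - Real.cos (2 * Real.pi * k * (y : ℝ))) *
    ∫ s in Set.Ioi (0 : ℝ), memKernel Φ γ L s y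

end VelocityFlip

end

/-! ### Fourier analysis on the periodic lattice: orthogonality, Parseval, fourth moments. -/

noncomputable section
namespace VelocityFlip
open Finset

/-! By Parseval, the spatial Fourier transform of `p_{s,·}` at `k = m/L` is `2γ` times the average
over `n` of `A_s(n/L) A_s((n+m)/L)`. Since `A_s` is a combination of `e^{-sμ_+}` and `e^{-sμ_-}`
with `μ_± ≥ d := ω₀²/γ`, this is a finite exponential sum in `s` with rates at least `2d` and total
coefficient mass bounded independently of `L`. Hence `p̂(·,k)` is a rational function (`kerLap`),
holomorphic for `Re z > -2d`, and on `Re z ≥ -d` it is bounded, Lipschitz and `O(1/|Im z|)`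
uniformly in `L` and `k`. The integrand `e^{zt} p̂²/(1-p̂)` therefore decays quadratically along
vertical lines, and the contour can be moved from `η > 0` to `-δ`. What is left there is
`O(e^{-δt})`; the only contribution picked up is that of the zeros of `1 - p̂`.

These zeros are located in three regions. For `Re z > 0` there are none: as `p ≥ 0`, `|p̂(z,k)| ≤
p̂(Re z,0) < 1` (`kerLap_ne_one_of_re_pos`). On the imaginary axis `Re(1 - p̂(iα,k))` has an
explicit lower bound, positive for `α ≠ 0`. It comes from the closed form of `p̂(z,0)` together with
`|cos θ| ≤ 3/4 + cos(2θ)/4` (`le_re_one_sub_kerLap`), and it persists in a thin strip to the left.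
Near the origin, `1 - p̂(0,k) = D̂(k)/γ` decides. For `|k| > ε₀` the nondegeneracy assumption, whose
integrand is approximated by a Riemann sum over the dual lattice, bounds `D̂` from below
(`exists_le_Dhat`), so there is no zero and the whole integral goes into `Δ`. For `|k| ≤ ε₀`, `-p̂'`
stays close to its value `1/γ` at `z = 0`, `k = 0`; so there is exactly one zero, simple and real,
at `-R(k)`, and its residue is `a(k)e^{-tR(k)}` (`exists_dispersion_root`,
`norm_vertInt_sub_le_of_root`).

The size of `R` follows from that of `D̂`. Taylor expansion gives `|D̂ - R| ≤ γ(O(k²)R + O(1)R²)`.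
The fourth spatial moment of `p` is controlled through second differences of `A` in `k`, and the
second moment is bounded below because `D̂` is bounded below at some `k` between `1/8` and `1/4`.
Together they give `D̂ ≍ k²` for small `k`, hence `R ≍ k²` and `|D̂ - R| = O(k⁴)`. -/

theorem sum_window_eq {M : Type*} [AddCommGroup M] {g : ℤ → M} {L : ℕ}
    (hg : ∀ n, g (n + L) = g n) (a : ℤ) :
    ∑ i ∈ range L, g (a + i) = ∑ i ∈ range L, g i := by
  -- Moving the window by one site trades `g b` for `g (b + L)`, which is the same value.
  have step : ∀ b : ℤ, ∑ i ∈ range L, g (b + 1 + i) = ∑ i ∈ range L, g (b + i) := by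
    intro b
    have h1 := Finset.sum_range_succ (fun i : ℕ => g (b + i)) L
    have h2 := Finset.sum_range_succ' (fun i : ℕ => g (b + i)) L
    rw [h1] at h2
    simp only [hg, Nat.cast_zero, add_zero] at h2
    rw [add_right_cancel h2]
    refine Finset.sum_congr rfl fun i _ => ?_
    push_cast
    congr 1
    ring
  induction a using Int.induction_on with
  | zero => simp
  | succ i ih => rw [step, ih]
  | pred i ih =>
    rw [← step, ← ih]
    refine Finset.sum_congr rfl fun j _ => ?_
    congr 1
    ring

theorem sum_lattice_eq_sum_range {M : Type*} [AddCommGroup M] {g : ℤ → M} {L : ℕ}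
    (hg : ∀ n, g (n + L) = g n) : ∑ n ∈ lattice L, g n = ∑ i ∈ range L, g i := by
  rw [← sum_window_eq hg (-(((L : ℤ) - 1) / 2))]
  symm
  refine Finset.sum_bij (fun i _ => -(((L : ℤ) - 1) / 2) + (i : ℤ)) ?_ ?_ ?_ (fun _ _ => rfl)
  · intro i hi
    rw [Finset.mem_range] at hi
    rw [mem_lattice]
    omega
  · intro i _ j _ h
    simpa using h
  · intro n hn
    rw [mem_lattice] at hn
    refine ⟨(n + ((L : ℤ) - 1) / 2).toNat, ?_, ?_⟩
    · rw [Finset.mem_range]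
      omega
    · omega

theorem sum_lattice_add {M : Type*} [AddCommGroup M] {g : ℤ → M} {L : ℕ}
    (hg : ∀ n, g (n + L) = g n) (m : ℤ) :
    ∑ n ∈ lattice L, g (n + m) = ∑ n ∈ lattice L, g n := by
  have h : ∀ n, (fun n => g (n + m)) (n + L) = (fun n => g (n + m)) n := by
    intro n
    have := hg (n + m)
    simp only
    rw [← this]
    congr 1
    ring
  rw [sum_lattice_eq_sum_range h, sum_lattice_eq_sum_range hg, ← sum_window_eq hg m]
  refine Finset.sum_congr rfl fun i _ => ?_
  rw [add_comm]

/-- For even `L` the lattice contains `L/2` but not `-L/2`, so reflection does not preserve it;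
periodicity of `g` repairs this. -/
theorem sum_lattice_neg {M : Type*} [AddCommGroup M] {g : ℤ → M} {L : ℕ}
    (hg : ∀ n, g (n + L) = g n) : ∑ n ∈ lattice L, g (-n) = ∑ n ∈ lattice L, g n := by
  have h : ∀ n, (fun n => g (-n)) (n + L) = (fun n => g (-n)) n := by
    intro n
    have := hg (-(n + L))
    simp only
    rw [← this]
    congr 1
    ring
  rw [sum_lattice_eq_sum_range h, sum_lattice_eq_sum_range hg,
    ← sum_window_eq hg (-((L : ℤ) - 1)), ← Finset.sum_range_reflect]
  refine Finset.sum_congr rfl fun i hi => ?_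
  rw [Finset.mem_range] at hi
  congr 1
  omega

theorem wave_add (k l : ℝ) (y : ℤ) : wave (k + l) y = wave k y * wave l y := by
  simp only [wave, ← Complex.exp_add]
  congr 1
  push_cast
  ring

theorem wave_int (m y : ℤ) : wave m y = 1 := by
  rw [wave, Complex.exp_eq_one_iff]
  refine ⟨m * y, ?_⟩
  push_cast
  ring

theorem norm_wave (k : ℝ) (y : ℤ) : ‖wave k y‖ = 1 := by
  rw [wave, show Complex.I * (2 * (Real.pi : ℂ) * (k : ℂ) * (y : ℂ))
    = ((2 * Real.pi * k * y : ℝ) : ℂ) * Complex.I by push_cast; ring]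
  exact Complex.norm_exp_ofReal_mul_I _

theorem wave_re (k : ℝ) (y : ℤ) : (wave k y).re = Real.cos (2 * Real.pi * k * y) := by
  rw [wave, show Complex.I * (2 * (Real.pi : ℂ) * (k : ℂ) * (y : ℂ))
    = ((2 * Real.pi * k * y : ℝ) : ℂ) * Complex.I by push_cast; ring]
  exact Complex.exp_ofReal_mul_I_re _

theorem conj_wave (k : ℝ) (y : ℤ) : (starRingEnd ℂ) (wave k y) = wave (-k) y := by
  rw [wave, wave, ← Complex.exp_conj]
  congr 1
  simp [map_ofNat]

theorem wave_div_add (L : ℕ) (hL : 1 ≤ L) (n y : ℤ) :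
    wave (((n + L : ℤ) : ℝ) / L) y = wave ((n : ℝ) / L) y := by
  have hL' : (L : ℝ) ≠ 0 := by positivity
  have : ((n + L : ℤ) : ℝ) / L = (n : ℝ) / L + ((1 : ℤ) : ℝ) := by
    push_cast
    field_simp
  rw [this, wave_add, wave_int, mul_one]

theorem wave_eq_zpow (k : ℝ) (y : ℤ) : wave k y = wave k 1 ^ y := by
  rw [wave, wave, ← Complex.exp_int_mul]
  congr 1
  push_cast
  ring

/-- Orthogonality of characters: a geometric sum of an `L`-th root of unity different from `1`
vanishes. -/
theorem sum_wave (L : ℕ) (hL : 1 ≤ L) (m : ℤ) :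
    ∑ y ∈ lattice L, wave ((m : ℝ) / L) y = if (L : ℤ) ∣ m then (L : ℂ) else 0 := by
  have hL' : (L : ℝ) ≠ 0 := by positivity
  have hLc : (L : ℂ) ≠ 0 := by exact_mod_cast hL'
  split_ifs with h
  · obtain ⟨j, rfl⟩ := h
    have : (((L : ℤ) * j : ℤ) : ℝ) / L = (j : ℝ) := by
      push_cast
      field_simp
    simp only [this, wave_int, Finset.sum_const, card_lattice]
    simp
  · set ζ := wave ((m : ℝ) / L) 1 with hζ
    have hpow : ζ ^ L = 1 := by
      have : ζ ^ (L : ℤ) = 1 := by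
        rw [hζ, ← wave_eq_zpow]
        rw [wave, Complex.exp_eq_one_iff]
        refine ⟨m, ?_⟩
        push_cast
        field_simp
      exact_mod_cast this
    have hne : ζ ≠ 1 := by
      intro h1
      apply h
      rw [hζ, wave, Complex.exp_eq_one_iff] at h1
      obtain ⟨j, hj⟩ := h1
      refine ⟨j, ?_⟩
      have h2 : (m : ℂ) / L = j := by
        have h3 : (Complex.I * (2 * (Real.pi : ℂ))) ≠ 0 := by
          simp [Real.pi_ne_zero]
        apply mul_left_cancel₀ h3
        push_cast at hj
        linear_combination hj
      rw [div_eq_iff hLc] at h2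
      have h4 : (m : ℂ) = ((L : ℤ) * j : ℤ) := by
        rw [h2]; push_cast; ring
      exact_mod_cast h4
    rw [sum_lattice_eq_sum_range]
    · have h1 : ∀ i ∈ range L, wave ((m : ℝ) / L) (i : ℤ) = ζ ^ i := by
        intro i _
        rw [wave_eq_zpow]
        simp [hζ]
      rw [Finset.sum_congr rfl h1]
      have := geom_sum_mul ζ L
      rw [hpow, sub_self] at this
      exact (mul_eq_zero.1 this).resolve_right (sub_ne_zero.2 hne)
    · intro n
      have hζ0 : ζ ≠ 0 := Complex.exp_ne_zero _
      rw [wave_eq_zpow, wave_eq_zpow _ n, ← hζ, zpow_add₀ hζ0]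
      simp [hpow]

theorem periodic_div_add {M : Type*} {A : ℝ → M} (hA : ∀ k, A (k + 1) = A k) {L : ℕ} (hL : 1 ≤ L) (n : ℤ) :
    A (((n + L : ℤ) : ℝ) / L) = A ((n : ℝ) / L) := by
  have hL' : (L : ℝ) ≠ 0 := by positivity
  rw [← hA ((n : ℝ) / L)]
  congr 1
  push_cast
  field_simp

/-- Conjugation reverses the phase, which the substitution `k ↦ -k` undoes for even `A`. This
removes the real part from the definition of the kernel. -/
theorem dualInt_wave_re {A : ℝ → ℝ} (hA : ∀ k, A (k + 1) = A k) (heven : ∀ k, A (-k) = A k)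
    {L : ℕ} (hL : 1 ≤ L) (y : ℤ) :
    (((dualInt L fun k => wave (-k) y * (A k : ℂ)).re : ℝ) : ℂ)
      = dualInt L fun k => wave (-k) y * (A k : ℂ) := by
  rw [← Complex.conj_eq_iff_re]
  simp only [dualInt, map_mul, map_sum, conj_wave, Complex.conj_ofReal, map_div₀, map_one,
    Complex.conj_natCast, neg_neg]
  congr 1
  rw [← sum_lattice_neg (g := fun n : ℤ => wave ((n : ℝ) / L) y * (A ((n : ℝ) / L) : ℂ))]
  · refine Finset.sum_congr rfl fun n _ => ?_
    have : (((-n : ℤ)) : ℝ) / L = -((n : ℝ) / L) := by push_cast; ring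
    rw [this, heven]
  · intro n
    rw [wave_div_add L hL, periodic_div_add hA hL]

theorem sum_delta {L : ℕ} (hL : 1 ≤ L) {B : ℤ → ℂ} (hB : ∀ n, B (n + L) = B n) (m : ℤ) :
    ∑ n ∈ lattice L, B n * (if (L : ℤ) ∣ n + m then (L : ℂ) else 0) = L * B (-m) := by
  have h : ∀ n, (fun n => B (n - m) * (if (L : ℤ) ∣ n then (L : ℂ) else 0)) (n + L)
      = (fun n => B (n - m) * (if (L : ℤ) ∣ n then (L : ℂ) else 0)) n := by
    intro n
    have hd : (L : ℤ) ∣ n + L ↔ (L : ℤ) ∣ n := by simp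
    simp only [hd]
    rw [show n + (L : ℤ) - m = n - m + L by ring, hB]
  have h2 := sum_lattice_add (g := fun n => B (n - m) * (if (L : ℤ) ∣ n then (L : ℂ) else 0)) h m
  simp only [add_sub_cancel_right] at h2
  rw [h2, Finset.sum_eq_single 0]
  · simp [mul_comm]
  -- Zero is the only multiple of `L` in the lattice.
  · intro n hn h0
    rw [mem_lattice] at hn
    rw [if_neg, mul_zero]
    rintro ⟨j, rfl⟩
    have hj : j ≠ 0 := by rintro rfl; simp at h0
    rcases lt_or_gt_of_ne hj with h1 | h1
    · have : j ≤ -1 := by omega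
      nlinarith
    · have : 1 ≤ j := by omega
      nlinarith
  · intro h0
    exfalso
    apply h0
    rw [mem_lattice]
    omega

/-- Parseval's identity on the periodic lattice, with a phase. -/
theorem sum_sq_dualInt_wave {A : ℝ → ℝ} (hA : ∀ k, A (k + 1) = A k) (heven : ∀ k, A (-k) = A k)
    {L : ℕ} (hL : 1 ≤ L) (m : ℤ) :
    ∑ y ∈ lattice L, ((((dualInt L fun k => wave (-k) y * (A k : ℂ)).re ^ 2 : ℝ)) : ℂ)
        * wave (-((m : ℝ) / L)) y
      = (((1 / (L : ℝ)) * ∑ n ∈ lattice L, A ((n : ℝ) / L) * A (((n + m : ℤ) : ℝ) / L) : ℝ) : ℂ) := by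
  have hL' : (L : ℂ) ≠ 0 := by exact_mod_cast (by positivity : (L : ℝ) ≠ 0)
  have h1 : ∀ y ∈ lattice L, ((((dualInt L fun k => wave (-k) y * (A k : ℂ)).re ^ 2 : ℝ)) : ℂ)
        * wave (-((m : ℝ) / L)) y
      = (1 / (L : ℂ)) ^ 2 * ∑ n ∈ lattice L, ∑ n' ∈ lattice L,
        (A ((n : ℝ) / L) : ℂ) * (A ((n' : ℝ) / L) : ℂ) * wave (((-(n' + (n + m)) : ℤ) : ℝ) / L) y := by
    intro y _
    push_cast
    rw [dualInt_wave_re hA heven hL, dualInt, mul_pow, mul_assoc]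
    congr 1
    rw [sq, Finset.sum_mul_sum, Finset.sum_mul]
    refine Finset.sum_congr rfl fun n _ => ?_
    rw [Finset.sum_mul]
    refine Finset.sum_congr rfl fun n' _ => ?_
    have : (-((n' : ℝ) + ((n : ℝ) + (m : ℝ)))) / (L : ℝ)
      = -((n : ℝ) / L) + (-((n' : ℝ) / L) + -((m : ℝ) / L)) := by ring
    rw [this, wave_add, wave_add]
    ring
  rw [Finset.sum_congr rfl h1, ← Finset.mul_sum, Finset.sum_comm]
  have h2 : ∀ n ∈ lattice L, ∑ y ∈ lattice L, ∑ n' ∈ lattice L,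
        (A ((n : ℝ) / L) : ℂ) * (A ((n' : ℝ) / L) : ℂ) * wave (((-(n' + (n + m)) : ℤ) : ℝ) / L) y
      = L * ((A ((n : ℝ) / L) : ℂ) * (A (((n + m : ℤ) : ℝ) / L) : ℂ)) := by
    intro n _
    rw [Finset.sum_comm]
    simp_rw [← Finset.mul_sum, sum_wave L hL, dvd_neg, mul_assoc, ← Finset.mul_sum]
    rw [sum_delta hL (B := fun n' => ((A ((n' : ℝ) / L) : ℝ) : ℂ))]
    · have : (((-(n + m) : ℤ)) : ℝ) / L = -(((n + m : ℤ) : ℝ) / L) := by push_cast; ring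
      rw [this, heven]
      ring
    · intro n
      rw [periodic_div_add hA hL]
  rw [Finset.sum_congr rfl h2, ← Finset.mul_sum]
  push_cast
  field_simp

theorem sum_sq_dualInt_cos {A : ℝ → ℝ} (hA : ∀ k, A (k + 1) = A k) (heven : ∀ k, A (-k) = A k)
    {L : ℕ} (hL : 1 ≤ L) (m : ℤ) :
    ∑ y ∈ lattice L, (dualInt L fun k => wave (-k) y * (A k : ℂ)).re ^ 2
        * Real.cos (2 * Real.pi * ((m : ℝ) / L) * y)
      = (1 / (L : ℝ)) * ∑ n ∈ lattice L, A ((n : ℝ) / L) * A (((n + m : ℤ) : ℝ) / L) := by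
  have h := congrArg Complex.re (sum_sq_dualInt_wave hA heven hL m)
  rw [Complex.ofReal_re, Complex.re_sum] at h
  rw [← h]
  refine Finset.sum_congr rfl fun y _ => ?_
  rw [Complex.re_ofReal_mul, wave_re]
  congr 1
  rw [← Real.cos_neg]
  congr 1
  ring

/-- Fourth moments on the lattice are controlled by second differences on the dual lattice. -/
theorem sum_pow_four_mul_sq_le {A : ℝ → ℝ} (hA : ∀ k, A (k + 1) = A k)
    (heven : ∀ k, A (-k) = A k) {K : ℝ}
    (hK : ∀ k h, |A (k + 2 * h) - 2 * A (k + h) + A k| ≤ K * h ^ 2)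
    {L : ℕ} (hL : 1 ≤ L) :
    ∑ y ∈ lattice L, (y : ℝ) ^ 4 * (dualInt L fun k => wave (-k) y * (A k : ℂ)).re ^ 2
      ≤ K ^ 2 := by
  have hL0 : (0 : ℝ) < L := by exact_mod_cast hL
  set f : ℤ → ℝ := fun y => (dualInt L fun k => wave (-k) y * (A k : ℂ)).re ^ 2 with hf
  -- With `θ = 2πy/L`, the symbol of the second difference of step `1/L` has squared modulus `4(1 -
  -- cos θ)² = 6 - 8 cos θ + 2 cos 2θ`; Parseval is applied at the shifts `0, 1, 2`.
  have key : ∑ y ∈ lattice L, f y * (1 - Real.cos (2 * Real.pi * y / L)) ^ 2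
      = (1 / 4) * ((1 / (L : ℝ)) * ∑ n ∈ lattice L,
        (A ((n : ℝ) / L + 2 * (1 / L)) - 2 * A ((n : ℝ) / L + 1 / L) + A ((n : ℝ) / L)) ^ 2) := by
    have e0 := sum_sq_dualInt_cos hA heven hL 0
    have e1 := sum_sq_dualInt_cos hA heven hL 1
    have e2 := sum_sq_dualInt_cos hA heven hL 2
    have hper : ∀ a b : ℤ, ∀ n : ℤ,
        (fun n : ℤ => A (((n + a : ℤ) : ℝ) / L) * A (((n + b : ℤ) : ℝ) / L)) (n + L)
        = (fun n : ℤ => A (((n + a : ℤ) : ℝ) / L) * A (((n + b : ℤ) : ℝ) / L)) n := by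
      intro a b n
      simp only
      rw [show n + (L : ℤ) + a = n + a + L by ring, show n + (L : ℤ) + b = n + b + L by ring,
        periodic_div_add hA hL, periodic_div_add hA hL]
    have s1 := sum_lattice_add (g := fun n : ℤ =>
      A (((n + 0 : ℤ) : ℝ) / L) * A (((n + 0 : ℤ) : ℝ) / L)) (hper 0 0) 1
    have s2 := sum_lattice_add (g := fun n : ℤ =>
      A (((n + 0 : ℤ) : ℝ) / L) * A (((n + 0 : ℤ) : ℝ) / L)) (hper 0 0) 2
    have s3 := sum_lattice_add (g := fun n : ℤ =>
      A (((n + 0 : ℤ) : ℝ) / L) * A (((n + 1 : ℤ) : ℝ) / L)) (hper 0 1) 1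
    have l1 : ∑ y ∈ lattice L, f y * (1 - Real.cos (2 * Real.pi * y / L)) ^ 2
      = 3 / 2 * ∑ y ∈ lattice L, f y * Real.cos (2 * Real.pi * (((0 : ℤ) : ℝ) / L) * y)
        - 2 * ∑ y ∈ lattice L, f y * Real.cos (2 * Real.pi * (((1 : ℤ) : ℝ) / L) * y)
        + 1 / 2 * ∑ y ∈ lattice L, f y * Real.cos (2 * Real.pi * (((2 : ℤ) : ℝ) / L) * y) := by
      rw [Finset.mul_sum, Finset.mul_sum, Finset.mul_sum, ← Finset.sum_sub_distrib,
        ← Finset.sum_add_distrib]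
      refine Finset.sum_congr rfl fun y _ => ?_
      have h0 : 2 * Real.pi * (((0 : ℤ) : ℝ) / L) * y = 0 := by simp
      have h1 : 2 * Real.pi * (((1 : ℤ) : ℝ) / L) * y = 2 * Real.pi * y / L := by
        push_cast; ring
      have h2 : 2 * Real.pi * (((2 : ℤ) : ℝ) / L) * y = 2 * (2 * Real.pi * y / L) := by
        push_cast; ring
      rw [h0, h1, h2, Real.cos_zero, Real.cos_two_mul]
      ring
    rw [l1]
    simp only [hf]
    rw [e0, e1, e2]
    simp only [add_assoc, add_zero] at s1 s2 s3 ⊢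
    have l2 : ∑ n ∈ lattice L,
        (A ((n : ℝ) / L + 2 * (1 / L)) - 2 * A ((n : ℝ) / L + 1 / L) + A ((n : ℝ) / L)) ^ 2
      = ∑ n ∈ lattice L, A (((n + 2 : ℤ) : ℝ) / L) * A (((n + 2 : ℤ) : ℝ) / L)
        + 4 * ∑ n ∈ lattice L, A (((n + 1 : ℤ) : ℝ) / L) * A (((n + 1 : ℤ) : ℝ) / L)
        + ∑ n ∈ lattice L, A ((n : ℝ) / L) * A ((n : ℝ) / L)
        - 4 * ∑ n ∈ lattice L, A (((n + 1 : ℤ) : ℝ) / L) * A (((n + 2 : ℤ) : ℝ) / L)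
        - 4 * ∑ n ∈ lattice L, A ((n : ℝ) / L) * A (((n + 1 : ℤ) : ℝ) / L)
        + 2 * ∑ n ∈ lattice L, A ((n : ℝ) / L) * A (((n + 2 : ℤ) : ℝ) / L) := by
      rw [Finset.mul_sum, Finset.mul_sum, Finset.mul_sum, Finset.mul_sum,
        ← Finset.sum_add_distrib, ← Finset.sum_add_distrib, ← Finset.sum_sub_distrib,
        ← Finset.sum_sub_distrib, ← Finset.sum_add_distrib]
      refine Finset.sum_congr rfl fun n _ => ?_
      have h1 : (n : ℝ) / L + 2 * (1 / L) = ((n + 2 : ℤ) : ℝ) / L := by push_cast; ring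
      have h2 : (n : ℝ) / L + 1 / L = ((n + 1 : ℤ) : ℝ) / L := by push_cast; ring
      rw [h1, h2]
      ring
    have r3 : (1 : ℤ) + 1 = 2 := rfl
    simp only [r3] at s3
    rw [l2, s1, s2, s3]
    ring
  have hsd : (1 / (L : ℝ)) * ∑ n ∈ lattice L,
        (A ((n : ℝ) / L + 2 * (1 / L)) - 2 * A ((n : ℝ) / L + 1 / L) + A ((n : ℝ) / L)) ^ 2
      ≤ K ^ 2 / L ^ 4 := by
    have : ∑ n ∈ lattice L,
        (A ((n : ℝ) / L + 2 * (1 / L)) - 2 * A ((n : ℝ) / L + 1 / L) + A ((n : ℝ) / L)) ^ 2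
      ≤ ∑ n ∈ lattice L, K ^ 2 / (L : ℝ) ^ 4 := by
      refine Finset.sum_le_sum fun n _ => ?_
      have h := hK ((n : ℝ) / L) (1 / L)
      have h' := pow_le_pow_left₀ (abs_nonneg _) h 2
      rw [sq_abs] at h'
      refine h'.trans (le_of_eq ?_)
      field_simp
    rw [Finset.sum_const, card_lattice, nsmul_eq_mul] at this
    calc _ ≤ (1 / (L : ℝ)) * (L * (K ^ 2 / (L : ℝ) ^ 4)) := by gcongr
      _ = _ := by field_simp
  have hlow : ∀ y ∈ lattice L, (y : ℝ) ^ 4 * f y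
      ≤ (L : ℝ) ^ 4 / 64 * (f y * (1 - Real.cos (2 * Real.pi * y / L)) ^ 2) := by
    intro y hy
    rw [mem_lattice] at hy
    have hy1 : -(L : ℝ) ≤ 2 * y := by exact_mod_cast hy.1.le
    have hy2 : 2 * (y : ℝ) ≤ L := by exact_mod_cast hy.2
    have hpi := Real.pi_pos
    -- Membership in the lattice is what keeps the angle in `[-π, π]`, where `1 - cos θ ≥ 2θ²/π²`.
    -- The powers of `L` then cancel.
    have habs : |2 * Real.pi * y / L| ≤ Real.pi := by
      rw [abs_le]
      constructor
      · rw [le_div_iff₀ hL0]; nlinarith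
      · rw [div_le_iff₀ hL0]; nlinarith
    have hc := Real.cos_le_one_sub_mul_cos_sq habs
    have hc' : 8 * (y : ℝ) ^ 2 / L ^ 2 ≤ 1 - Real.cos (2 * Real.pi * y / L) := by
      have : 2 / Real.pi ^ 2 * (2 * Real.pi * y / L) ^ 2 = 8 * (y : ℝ) ^ 2 / L ^ 2 := by
        field_simp
        ring
      linarith
    have hsq : (8 * (y : ℝ) ^ 2 / L ^ 2) ^ 2 ≤ (1 - Real.cos (2 * Real.pi * y / L)) ^ 2 := by
      gcongr
    have hfy : 0 ≤ f y := sq_nonneg _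
    calc (y : ℝ) ^ 4 * f y = (L : ℝ) ^ 4 / 64 * (f y * (8 * (y : ℝ) ^ 2 / L ^ 2) ^ 2) := by
          field_simp
          ring
      _ ≤ _ := by gcongr
  calc _ ≤ ∑ y ∈ lattice L,
        (L : ℝ) ^ 4 / 64 * (f y * (1 - Real.cos (2 * Real.pi * y / L)) ^ 2) :=
        Finset.sum_le_sum hlow
    _ = (L : ℝ) ^ 4 / 64 * ((1 / 4) * ((1 / (L : ℝ)) * ∑ n ∈ lattice L,
        (A ((n : ℝ) / L + 2 * (1 / L)) - 2 * A ((n : ℝ) / L + 1 / L) + A ((n : ℝ) / L)) ^ 2)) := by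
        rw [← Finset.mul_sum, key]
    _ ≤ (L : ℝ) ^ 4 / 64 * ((1 / 4) * (K ^ 2 / L ^ 4)) := by gcongr
    _ = K ^ 2 / 256 := by field_simp; ring
    _ ≤ K ^ 2 := by nlinarith [sq_nonneg K]

end VelocityFlip
end

/-! ### Finite exponential sums and their Laplace transforms. -/

noncomputable section
namespace VelocityFlip
open Finset

/-- The finite exponential sum `∑_j c_j e^{-s m_j}`. -/
def expSum {ι : Type*} (J : Finset ι) (c m : ι → ℝ) (s : ℝ) : ℝ :=
  ∑ j ∈ J, c j * Real.exp (-s * m j)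

/-- The Laplace transform of `expSum J c m`. -/
def lap {ι : Type*} (J : Finset ι) (c m : ι → ℝ) (z : ℂ) : ℂ :=
  ∑ j ∈ J, (c j : ℂ) / (z + m j)

/-- Minus the derivative of `lap J c m`. -/
def lapD {ι : Type*} (J : Finset ι) (c m : ι → ℝ) (z : ℂ) : ℂ :=
  ∑ j ∈ J, (c j : ℂ) / (z + m j) ^ 2

/-- The rates leave a pole-free half-plane `Re z > -2d`. Working only in `Re z ≥ -d` keeps every
pole at distance `d`, which makes all bounds below depend on `d` and the coefficient mass alone. -/
theorem le_norm_add {d m : ℝ} {z : ℂ} (hm : 2 * d ≤ m) (hz : -d ≤ z.re) : d ≤ ‖z + m‖ := by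
  have h := Complex.re_le_norm (z + m)
  rw [Complex.add_re, Complex.ofReal_re] at h
  linarith

theorem sq_add_sq_le_norm_add {d m : ℝ} {z : ℂ} (hd : 0 < d) (hm : 2 * d ≤ m) (hz : -d ≤ z.re) :
    d ^ 2 + z.im ^ 2 ≤ ‖z + m‖ ^ 2 := by
  rw [Complex.sq_norm, Complex.normSq_apply]
  simp only [Complex.add_re, Complex.ofReal_re, Complex.add_im, Complex.ofReal_im, add_zero]
  nlinarith

theorem integral_mul_exp_neg_mul_Ioi {a : ℝ} (ha : 0 < a) :
    MeasureTheory.IntegrableOn (fun s : ℝ => s * Real.exp (-a * s)) (Set.Ioi 0) ∧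
    ∫ s in Set.Ioi (0 : ℝ), s * Real.exp (-a * s) = 1 / a ^ 2 := by
  constructor
  · have := integrableOn_rpow_mul_exp_neg_mul_rpow (p := 1) (s := 1) (by norm_num) one_pos ha
    simpa only [Real.rpow_one] using this
  · calc _ = ∫ t in Set.Ioi (0 : ℝ), t ^ ((2 : ℝ) - 1) * Real.exp (-(a * t)) := by
          congr 1
          funext s
          rw [show (2 : ℝ) - 1 = 1 by norm_num, Real.rpow_one, neg_mul]
      _ = _ := by
          rw [Real.integral_rpow_mul_exp_neg_mul_Ioi two_pos ha, Real.Gamma_two, mul_one,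
            Real.rpow_two, div_pow, one_pow]

section
variable {ι : Type*} {J : Finset ι} {c m : ι → ℝ} {d C : ℝ}

theorem norm_sum_ofReal_mul_le (hC : ∑ j ∈ J, |c j| ≤ C) {g : ι → ℂ} {B : ℝ} (hB0 : 0 ≤ B)
    (hB : ∀ j ∈ J, ‖g j‖ ≤ B) : ‖∑ j ∈ J, (c j : ℂ) * g j‖ ≤ C * B := by
  calc _ ≤ ∑ j ∈ J, |c j| * B := by
        refine norm_sum_le_of_le J fun j hj => ?_
        rw [norm_mul, Complex.norm_real, Real.norm_eq_abs]
        gcongr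
        exact hB j hj
    _ ≤ C * B := by
        rw [← Finset.sum_mul]
        gcongr

/-- The transform enters the renewal integrand squared, and this decay in `Im z` is what makes the
vertical integrals converge absolutely. -/
theorem norm_lap_sq_le (hd : 0 < d) (hm : ∀ j ∈ J, 2 * d ≤ m j) (hC : ∑ j ∈ J, |c j| ≤ C)
    {z : ℂ} (hz : -d ≤ z.re) : ‖lap J c m z‖ ^ 2 ≤ C ^ 2 / (d ^ 2 + z.im ^ 2) := by
  have hpos : 0 < d ^ 2 + z.im ^ 2 := by positivity
  have h : ‖lap J c m z‖ ≤ C * (1 / Real.sqrt (d ^ 2 + z.im ^ 2)) := by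
    simp only [lap, div_eq_mul_inv]
    refine norm_sum_ofReal_mul_le hC (by positivity) fun j hj => ?_
    rw [norm_inv, one_mul]
    apply inv_anti₀ (Real.sqrt_pos.2 hpos)
    apply Real.sqrt_le_iff.2 ⟨norm_nonneg _, sq_add_sq_le_norm_add hd (hm j hj) hz⟩
  calc _ ≤ (C * (1 / Real.sqrt (d ^ 2 + z.im ^ 2))) ^ 2 := by gcongr
    _ = _ := by rw [mul_pow, div_pow, Real.sq_sqrt hpos.le]; ring

theorem norm_lap_sub_le (hd : 0 < d) (hm : ∀ j ∈ J, 2 * d ≤ m j) (hC : ∑ j ∈ J, |c j| ≤ C)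
    {z w : ℂ} (hz : -d ≤ z.re) (hw : -d ≤ w.re) :
    ‖lap J c m z - lap J c m w‖ ≤ C / d ^ 2 * ‖z - w‖ := by
  have h : lap J c m z - lap J c m w
      = ∑ j ∈ J, (c j : ℂ) * ((w - z) * ((z + m j)⁻¹ * (w + m j)⁻¹)) := by
    rw [lap, lap, ← Finset.sum_sub_distrib]
    refine Finset.sum_congr rfl fun j hj => ?_
    have h1 : z + m j ≠ 0 := norm_pos_iff.1 (hd.trans_le (le_norm_add (hm j hj) hz))
    have h2 : w + m j ≠ 0 := norm_pos_iff.1 (hd.trans_le (le_norm_add (hm j hj) hw))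
    field_simp
    ring
  rw [h]
  refine (norm_sum_ofReal_mul_le hC (B := ‖z - w‖ * (d⁻¹ * d⁻¹)) (by positivity)
    fun j hj => ?_).trans (le_of_eq (by field_simp))
  rw [norm_mul, norm_mul, norm_inv, norm_inv, norm_sub_rev w z]
  have h1 := le_norm_add (hm j hj) hz
  have h2 := le_norm_add (hm j hj) hw
  gcongr

/-- Termwise the remainder is exact: `1/(z+m) - 1/(w+m) + (z-w)/(w+m)² = (z-w)²/((z+m)(w+m)²)`. -/
theorem norm_lap_taylor_le (hd : 0 < d) (hm : ∀ j ∈ J, 2 * d ≤ m j) (hC : ∑ j ∈ J, |c j| ≤ C)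
    {z w : ℂ} (hz : -d ≤ z.re) (hw : -d ≤ w.re) :
    ‖lap J c m z - lap J c m w + lapD J c m w * (z - w)‖ ≤ C / d ^ 3 * ‖z - w‖ ^ 2 := by
  have h : lap J c m z - lap J c m w + lapD J c m w * (z - w)
      = ∑ j ∈ J, (c j : ℂ) * ((z - w) ^ 2 * ((z + m j)⁻¹ * ((w + m j)⁻¹ * (w + m j)⁻¹))) := by
    rw [lap, lap, lapD, Finset.sum_mul, ← Finset.sum_sub_distrib, ← Finset.sum_add_distrib]
    refine Finset.sum_congr rfl fun j hj => ?_
    have h1 : z + m j ≠ 0 := norm_pos_iff.1 (hd.trans_le (le_norm_add (hm j hj) hz))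
    have h2 : w + m j ≠ 0 := norm_pos_iff.1 (hd.trans_le (le_norm_add (hm j hj) hw))
    field_simp
    ring
  rw [h]
  refine (norm_sum_ofReal_mul_le hC (B := ‖z - w‖ ^ 2 * (d⁻¹ * (d⁻¹ * d⁻¹))) (by positivity)
    fun j hj => ?_).trans (le_of_eq (by field_simp))
  rw [norm_mul, norm_mul, norm_mul, norm_inv, norm_inv, norm_pow]
  have h1 := le_norm_add (hm j hj) hz
  have h2 := le_norm_add (hm j hj) hw
  gcongr

theorem norm_lapD_sub_le (hd : 0 < d) (hm : ∀ j ∈ J, 2 * d ≤ m j) (hC : ∑ j ∈ J, |c j| ≤ C)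
    {z w : ℂ} (hz : -d ≤ z.re) (hw : -d ≤ w.re) :
    ‖lapD J c m z - lapD J c m w‖ ≤ 2 * C / d ^ 3 * ‖z - w‖ := by
  have h : lapD J c m z - lapD J c m w
      = ∑ j ∈ J, (c j : ℂ) * ((w - z) * ((z + m j)⁻¹ * ((w + m j)⁻¹ * (w + m j)⁻¹)
        + (z + m j)⁻¹ * ((z + m j)⁻¹ * (w + m j)⁻¹))) := by
    rw [lapD, lapD, ← Finset.sum_sub_distrib]
    refine Finset.sum_congr rfl fun j hj => ?_
    have h1 : z + m j ≠ 0 := norm_pos_iff.1 (hd.trans_le (le_norm_add (hm j hj) hz))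
    have h2 : w + m j ≠ 0 := norm_pos_iff.1 (hd.trans_le (le_norm_add (hm j hj) hw))
    field_simp
    ring
  rw [h]
  refine (norm_sum_ofReal_mul_le hC (B := ‖z - w‖ * (d⁻¹ * (d⁻¹ * d⁻¹) + d⁻¹ * (d⁻¹ * d⁻¹)))
    (by positivity) fun j hj => ?_).trans (le_of_eq (by field_simp; ring))
  have h1 := le_norm_add (hm j hj) hz
  have h2 := le_norm_add (hm j hj) hw
  rw [norm_mul, norm_sub_rev w z]
  gcongr
  refine (norm_add_le _ _).trans ?_
  rw [norm_mul, norm_mul, norm_mul, norm_mul, norm_inv, norm_inv]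
  gcongr

theorem hasDerivAt_lap (hm : ∀ j ∈ J, 2 * d ≤ m j) {z : ℂ} (hz : -(2 * d) < z.re) :
    HasDerivAt (lap J c m) (-lapD J c m z) z := by
  unfold lap lapD
  rw [← Finset.sum_neg_distrib]
  apply HasDerivAt.fun_sum
  intro j hj
  have h1 : z + m j ≠ 0 := by
    intro h
    have h2 := congrArg Complex.re h
    simp only [Complex.add_re, Complex.ofReal_re, Complex.zero_re] at h2
    linarith [hm j hj]
  simp only [div_eq_mul_inv]
  have h : HasDerivAt (fun w : ℂ => (w + m j)⁻¹) (-1 / (z + m j) ^ 2) z :=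
    ((hasDerivAt_id z).add_const (m j : ℂ)).fun_inv h1
  refine (h.const_mul (c j : ℂ)).congr_deriv ?_
  ring

theorem integrableOn_expSum_mul_cexp (hm : ∀ j ∈ J, 2 * d ≤ m j) {z : ℂ}
    (hz : -(2 * d) < z.re) :
    MeasureTheory.IntegrableOn (fun s : ℝ => (expSum J c m s : ℂ) * Complex.exp (-(s : ℂ) * z))
      (Set.Ioi 0) ∧
    ∫ s in Set.Ioi (0 : ℝ), (expSum J c m s : ℂ) * Complex.exp (-(s : ℂ) * z) = lap J c m z := by
  have hre : ∀ j ∈ J, (-(z + m j)).re < 0 := by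
    intro j hj
    simp only [Complex.neg_re, Complex.add_re, Complex.ofReal_re]
    linarith [hm j hj]
  have he : (fun s : ℝ => (expSum J c m s : ℂ) * Complex.exp (-(s : ℂ) * z))
      = fun s : ℝ => ∑ j ∈ J, (c j : ℂ) * Complex.exp (-(z + m j) * s) := by
    funext s
    rw [expSum]
    push_cast
    rw [Finset.sum_mul]
    refine Finset.sum_congr rfl fun j _ => ?_
    rw [mul_assoc, ← Complex.exp_add]
    congr 2
    ring
  have hint : ∀ j ∈ J, MeasureTheory.IntegrableOn
      (fun s : ℝ => (c j : ℂ) * Complex.exp (-(z + m j) * s)) (Set.Ioi 0) := fun j hj =>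
    (integrableOn_exp_mul_complex_Ioi (hre j hj) 0).const_mul _
  rw [he]
  refine ⟨MeasureTheory.integrable_finsetSum J hint, ?_⟩
  rw [MeasureTheory.integral_finsetSum J hint, lap]
  refine Finset.sum_congr rfl fun j hj => ?_
  rw [MeasureTheory.integral_const_mul, integral_exp_mul_complex_Ioi (hre j hj)]
  simp only [Complex.ofReal_zero, mul_zero, Complex.exp_zero]
  rw [neg_div_neg_eq, mul_one_div]

theorem integrableOn_exp_mul_expSum (hm : ∀ j ∈ J, 2 * d ≤ m j) {r : ℝ} (hr : r < 2 * d) :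
    MeasureTheory.IntegrableOn (fun s : ℝ => Real.exp (s * r) * expSum J c m s) (Set.Ioi 0) ∧
    ((∫ s in Set.Ioi (0 : ℝ), Real.exp (s * r) * expSum J c m s : ℝ) : ℂ)
      = lap J c m (-(r : ℂ)) := by
  have h := integrableOn_expSum_mul_cexp (c := c) hm (z := -(r : ℂ)) (by simpa using hr)
  have he : (fun s : ℝ => (expSum J c m s : ℂ) * Complex.exp (-(s : ℂ) * -(r : ℂ)))
      = fun s : ℝ => ((Real.exp (s * r) * expSum J c m s : ℝ) : ℂ) := by
    funext s
    push_cast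
    rw [neg_mul_neg, mul_comm]
  rw [he] at h
  constructor
  · have := h.1.re
    simp only [RCLike.re_to_complex, Complex.ofReal_re] at this
    exact this
  · rw [← h.2, integral_complex_ofReal]

theorem integrableOn_mul_exp_mul_expSum (hm : ∀ j ∈ J, 2 * d ≤ m j) {r : ℝ} (hr : r < 2 * d) :
    MeasureTheory.IntegrableOn (fun s : ℝ => s * Real.exp (s * r) * expSum J c m s)
      (Set.Ioi 0) ∧
    ((∫ s in Set.Ioi (0 : ℝ), s * Real.exp (s * r) * expSum J c m s : ℝ) : ℂ)
      = lapD J c m (-(r : ℂ)) := by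
  have hpos : ∀ j ∈ J, 0 < m j - r := fun j hj => by linarith [hm j hj]
  have he : (fun s : ℝ => s * Real.exp (s * r) * expSum J c m s)
      = fun s : ℝ => ∑ j ∈ J, c j * (s * Real.exp (-(m j - r) * s)) := by
    funext s
    rw [expSum, Finset.mul_sum]
    refine Finset.sum_congr rfl fun j _ => ?_
    rw [show -(m j - r) * s = s * r + -s * m j by ring, Real.exp_add]
    ring
  have hint : ∀ j ∈ J, MeasureTheory.IntegrableOn
      (fun s : ℝ => c j * (s * Real.exp (-(m j - r) * s))) (Set.Ioi 0) := fun j hj =>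
    (integral_mul_exp_neg_mul_Ioi (hpos j hj)).1.const_mul _
  rw [he]
  refine ⟨MeasureTheory.integrable_finsetSum J hint, ?_⟩
  rw [MeasureTheory.integral_finsetSum J hint, lapD]
  push_cast
  refine Finset.sum_congr rfl fun j hj => ?_
  rw [MeasureTheory.integral_const_mul, (integral_mul_exp_neg_mul_Ioi (hpos j hj)).2]
  push_cast
  rw [mul_one_div]
  congr 1
  ring

end
end VelocityFlip
end

/-! ### Moving a vertical contour across a simple pole. -/

noncomputable section
namespace VelocityFlip
open Filter Topology

/-- The integrand decays only like `1/|y|`, so symmetric truncation is essential: the odd imaginary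
part cancels and the real part integrates to an arctangent. -/
theorem tendsto_integral_inv_add_mul_I {c : ℝ} (hc : c ≠ 0) :
    Tendsto (fun T : ℝ => ∫ y in (-T)..T, ((c : ℂ) + y * Complex.I)⁻¹) atTop
      (𝓝 ((SignType.sign c : ℝ) * Real.pi : ℝ)) := by
  have hval : ∀ T : ℝ, ∫ y in (-T)..T, ((c : ℂ) + y * Complex.I)⁻¹
      = ((2 * Real.arctan (T / c) : ℝ) : ℂ) := by
    intro T
    have hne : ∀ y : ℝ, (c : ℂ) + y * Complex.I ≠ 0 := by
      intro y h
      have := congrArg Complex.re h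
      simp at this
      exact hc this
    have hcont : Continuous fun y : ℝ => ((c : ℂ) + y * Complex.I)⁻¹ :=
      Continuous.inv₀ (by fun_prop) hne
    have h1 : ∫ y in (-T)..T, ((c : ℂ) + y * Complex.I)⁻¹
        = ∫ y in (-T)..T, ((c : ℂ) + ((-y : ℝ) : ℂ) * Complex.I)⁻¹ := by
      rw [intervalIntegral.integral_comp_neg (fun y : ℝ => ((c : ℂ) + y * Complex.I)⁻¹), neg_neg]
    -- Adding the reflected integrand leaves the real function `2c/(c² + y²)`.
    have h2 : (∫ y in (-T)..T, ((c : ℂ) + y * Complex.I)⁻¹)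
        + ∫ y in (-T)..T, ((c : ℂ) + ((-y : ℝ) : ℂ) * Complex.I)⁻¹
        = ((4 * Real.arctan (T / c) : ℝ) : ℂ) := by
      have hcont' : Continuous fun y : ℝ => ((c : ℂ) + ((-y : ℝ) : ℂ) * Complex.I)⁻¹ :=
        hcont.comp continuous_neg
      rw [← intervalIntegral.integral_add (hcont.intervalIntegrable _ _)
        (hcont'.intervalIntegrable _ _)]
      have h3 : ∀ y : ℝ, ((c : ℂ) + y * Complex.I)⁻¹ + ((c : ℂ) + ((-y : ℝ) : ℂ) * Complex.I)⁻¹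
          = (((2 * c) * (c ^ 2 + y ^ 2)⁻¹ : ℝ) : ℂ) := by
        intro y
        have n1 := hne y
        have n2 := hne (-y)
        have n3 : (c : ℂ) ^ 2 + (y : ℂ) ^ 2 ≠ 0 := by
          have : (c : ℝ) ^ 2 + y ^ 2 ≠ 0 := by positivity
          exact_mod_cast this
        push_cast at n2 ⊢
        rw [← div_eq_mul_inv, eq_div_iff n3]
        have n4 : (c : ℂ) ^ 2 + (y : ℂ) ^ 2
            = ((c : ℂ) + y * Complex.I) * ((c : ℂ) + -y * Complex.I) := by
          linear_combination (y : ℂ) ^ 2 * Complex.I_sq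
        have key : ∀ A B : ℂ, A ≠ 0 → B ≠ 0 → (A⁻¹ + B⁻¹) * (A * B) = A + B := by
          intro A B hA hB
          field_simp
          ring
        rw [n4, key _ _ n1 n2]
        ring
      simp_rw [h3]
      rw [intervalIntegral.integral_ofReal, intervalIntegral.integral_const_mul,
        integral_inv_sq_add_sq hc, neg_div, Real.arctan_neg]
      congr 1
      field_simp
      ring
    rw [← h1, ← two_mul] at h2
    have h5 : (2 : ℂ) ≠ 0 := two_ne_zero
    apply mul_left_cancel₀ h5
    rw [h2]
    push_cast
    ring
  simp_rw [hval]
  refine (Complex.continuous_ofReal.tendsto _).comp ?_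
  rcases lt_or_gt_of_ne hc with h | h
  · have h1 : Tendsto (fun T : ℝ => Real.arctan (T / c)) atTop (𝓝 (-(Real.pi / 2))) :=
      (tendsto_nhds_of_tendsto_nhdsWithin Real.tendsto_arctan_atBot).comp
        (tendsto_id.atTop_div_const_of_neg h)
    have h2 := h1.const_mul 2
    rw [sign_neg h]
    convert h2 using 2
    simp
    ring
  · have h1 : Tendsto (fun T : ℝ => Real.arctan (T / c)) atTop (𝓝 (Real.pi / 2)) :=
      (tendsto_nhds_of_tendsto_nhdsWithin Real.tendsto_arctan_atTop).comp
        (tendsto_id.atTop_div_const h)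
    have h2 := h1.const_mul 2
    rw [sign_pos h]
    convert h2 using 2
    simp
    ring

/-- Shifting a vertical contour to the left across at most one simple pole. -/
theorem vertInt_eq_add_of_simple_pole {a b p K T₀ : ℝ} {r : ℂ} {f g : ℂ → ℂ} (hap : a < p)
    (hpb : p < b) (hg : ∀ z : ℂ, a ≤ z.re → z.re ≤ b → DifferentiableAt ℂ g z)
    (hfg : ∀ z : ℂ, a ≤ z.re → z.re ≤ b → z ≠ p → f z = g z + r / (z - p))
    (hK : ∀ z : ℂ, a ≤ z.re → z.re ≤ b → T₀ ≤ |z.im| → ‖f z‖ ≤ K / |z.im|)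
    (hfa : MeasureTheory.Integrable fun α : ℝ => f ((a : ℂ) + Complex.I * (α : ℂ)))
    (hfb : MeasureTheory.Integrable fun α : ℝ => f ((b : ℂ) + Complex.I * (α : ℂ))) :
    vertInt b f = vertInt a f + r := by
  have hab : a ≤ b := (hap.trans hpb).le
  -- Cauchy's theorem is applied to the holomorphic part `g` only. The pole part is integrated
  -- explicitly on each vertical side and contributes `±πr`; the jump of `2πr` between the two sides
  -- is the residue.
  have vert : ∀ x : ℝ, a ≤ x → x ≤ b → x ≠ p →
      MeasureTheory.Integrable (fun α : ℝ => f ((x : ℂ) + Complex.I * (α : ℂ))) →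
      Tendsto (fun T : ℝ => ∫ y in (-T)..T, g ((x : ℂ) + y * Complex.I)) atTop
        (𝓝 ((∫ α : ℝ, f ((x : ℂ) + Complex.I * (α : ℂ)))
          - r * (((SignType.sign (x - p) : ℝ) * Real.pi : ℝ) : ℂ))) := by
    intro x hax hxb hxp hint
    have h1 := MeasureTheory.intervalIntegral_tendsto_integral hint tendsto_neg_atTop_atBot
      tendsto_id
    have h2 := (tendsto_integral_inv_add_mul_I (sub_ne_zero.2 hxp)).const_mul r
    refine (h1.sub h2).congr fun T => ?_
    have hne : ∀ y : ℝ, ((x - p : ℝ) : ℂ) + y * Complex.I ≠ 0 := by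
      intro y h
      have := congrArg Complex.re h
      simp at this
      exact sub_ne_zero.2 hxp this
    have hcont : Continuous fun y : ℝ => (((x - p : ℝ) : ℂ) + y * Complex.I)⁻¹ :=
      Continuous.inv₀ (by fun_prop) hne
    simp only [id]
    rw [← intervalIntegral.integral_const_mul, ← intervalIntegral.integral_sub
      hint.intervalIntegrable ((hcont.intervalIntegrable _ _).const_mul r)]
    refine intervalIntegral.integral_congr fun y _ => ?_
    rw [hfg _ (by simpa using hax) (by simpa using hxb)]
    · have e1 : (x : ℂ) + Complex.I * y = x + y * Complex.I := by ring
      have e2 : ((x - p : ℝ) : ℂ) + y * Complex.I = x + y * Complex.I - p := by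
        push_cast; ring
      rw [e1, e2, div_eq_mul_inv]
      ring
    · intro h
      have := congrArg Complex.re h
      simp at this
      exact hxp this
  -- On the horizontal sides both `f` and `r/(z - p)` are `O(1/T)`, while the width `b - a` is
  -- fixed.
  have horiz : ∀ ε : ℝ, |ε| = 1 → Tendsto (fun T : ℝ =>
      ∫ x in a..b, g ((x : ℂ) + ((ε * T : ℝ) : ℂ) * Complex.I)) atTop (𝓝 0) := by
    intro ε hε
    have hlim : Tendsto (fun T : ℝ => (K + ‖r‖) / T * |b - a|) atTop (𝓝 0) := by
      have := (tendsto_const_nhds (x := K + ‖r‖)).div_atTop (tendsto_id (α := ℝ))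
      simpa using this.mul_const |b - a|
    refine squeeze_zero_norm' ?_ hlim
    filter_upwards [eventually_ge_atTop 1, eventually_ge_atTop T₀] with T hT hT₀
    have hT0 : 0 < T := by linarith
    refine intervalIntegral.norm_integral_le_of_norm_le_const fun x hx => ?_
    rw [Set.uIoc_of_le hab] at hx
    set z : ℂ := (x : ℂ) + ((ε * T : ℝ) : ℂ) * Complex.I with hz
    have hre : z.re = x := by simp [hz]
    have him : z.im = ε * T := by simp [hz]
    have habs : |z.im| = T := by rw [him, abs_mul, hε, one_mul, abs_of_pos hT0]
    have hzp : z ≠ p := by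
      intro h
      have := congrArg Complex.im h
      rw [him, Complex.ofReal_im] at this
      rw [him, this, abs_zero] at habs
      linarith
    have h1 := hfg z (by rw [hre]; exact hx.1.le) (by rw [hre]; exact hx.2) hzp
    have h2 := hK z (by rw [hre]; exact hx.1.le) (by rw [hre]; exact hx.2) (by rw [habs]; exact hT₀)
    rw [habs] at h2
    have h3 : T ≤ ‖z - p‖ := by
      have := Complex.abs_im_le_norm (z - p)
      rw [Complex.sub_im, Complex.ofReal_im, sub_zero, habs] at this
      exact this
    have h4 : g z = f z - r / (z - p) := by rw [h1]; ring
    rw [h4, add_div]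
    refine (norm_sub_le _ _).trans (add_le_add h2 ?_)
    rw [norm_div]
    gcongr
  have hrect : ∀ T : ℝ, (((∫ x : ℝ in a..b, g (x + ((-1 * T : ℝ) : ℂ) * Complex.I))
      - ∫ x : ℝ in a..b, g (x + ((1 * T : ℝ) : ℂ) * Complex.I))
      + Complex.I * ∫ y : ℝ in (-T)..T, g (b + y * Complex.I))
      - Complex.I * ∫ y : ℝ in (-T)..T, g (a + y * Complex.I) = 0 := by
    intro T
    have := Complex.integral_boundary_rect_eq_zero_of_differentiableOn g
      (⟨a, -T⟩ : ℂ) (⟨b, T⟩ : ℂ) (by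
        intro z hz
        rw [Complex.mem_reProdIm] at hz
        have h1 := hz.1
        simp only at h1
        rw [Set.uIcc_of_le hab] at h1
        exact (hg z h1.1 h1.2).differentiableWithinAt)
    simpa only [smul_eq_mul, neg_one_mul, one_mul] using this
  have hlim := (((horiz (-1) (by simp)).sub (horiz 1 (by simp))).add
    ((vert b hab le_rfl hpb.ne' hfb).const_mul Complex.I)).sub
    ((vert a le_rfl hab hap.ne hfa).const_mul Complex.I)
  have hzero := tendsto_nhds_unique (hlim.congr hrect) tendsto_const_nhds
  rw [sign_pos (sub_pos.2 hpb), sign_neg (sub_neg.2 hap)] at hzero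
  have hI : Complex.I ≠ 0 := Complex.I_ne_zero
  have hfin : (∫ α : ℝ, f ((b : ℂ) + Complex.I * (α : ℂ)))
      = (∫ α : ℝ, f ((a : ℂ) + Complex.I * (α : ℂ))) + 2 * Real.pi * r := by
    apply mul_left_cancel₀ hI
    simp only [SignType.coe_one, SignType.coe_neg_one] at hzero
    push_cast at hzero
    linear_combination hzero
  have hpi : (Real.pi : ℂ) ≠ 0 := by exact_mod_cast Real.pi_ne_zero
  rw [vertInt, vertInt, hfin]
  field_simp

end VelocityFlip
end

/-! ### Smoothness in the wave number and decay in time of `Â_t`. -/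

noncomputable section
namespace VelocityFlip

theorem contDiff_two_of_hasDerivAt {f f₁ f₂ : ℝ → ℝ} (h₁ : ∀ k, HasDerivAt f (f₁ k) k)
    (h₂ : ∀ k, HasDerivAt f₁ (f₂ k) k) (h₃ : Continuous f₂) : ContDiff ℝ 2 f := by
  have e1 : deriv f = f₁ := funext fun k => (h₁ k).deriv
  have e2 : deriv f₁ = f₂ := funext fun k => (h₂ k).deriv
  have c1 : ContDiff ℝ 1 f₁ :=
    contDiff_one_iff_deriv.2 ⟨fun k => (h₂ k).differentiableAt, by rwa [e2]⟩
  have : ContDiff ℝ (1 + 1) f := by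
    refine contDiff_succ_iff_deriv.2 ⟨fun k => (h₁ k).differentiableAt, by simp, ?_⟩
    rwa [e1]
  simpa [one_add_one_eq_two] using this

namespace CouplingAssumption
variable {Φ : ℤ → ℝ} {ω₀ : ℝ}

theorem summable (h : CouplingAssumption Φ ω₀) (n : ℕ) :
    Summable fun x : ℤ => |Φ x| * |(x : ℝ)| ^ n := by
  obtain ⟨C, δ, hC, hδ, hb⟩ := h.decay
  have hs : Summable fun x : ℤ => C * (|(x : ℝ)| ^ n * Real.exp (-δ * |(x : ℝ)|)) := by
    apply Summable.mul_left
    have hn := Real.summable_pow_mul_exp_neg_nat_mul n hδ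
    apply Summable.of_nat_of_neg
    · simpa using hn
    · simpa using hn
  refine hs.of_nonneg_of_le (fun x => by positivity) fun x => ?_
  calc |Φ x| * |(x : ℝ)| ^ n ≤ (C * Real.exp (-δ * |(x : ℝ)|)) * |(x : ℝ)| ^ n := by
        gcongr
        exact hb x
    _ = _ := by ring

theorem phiHat_eq (h : CouplingAssumption Φ ω₀) (k : ℝ) :
    phiHat Φ k = ∑' x : ℤ, Φ x * Real.cos (2 * Real.pi * x * k) := by
  have hs : Summable fun x : ℤ => (Φ x : ℂ) * wave (-k) x := by
    apply Summable.of_norm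
    simpa [norm_wave] using h.summable 0
  rw [phiHat, Complex.re_tsum hs]
  refine tsum_congr fun x => ?_
  rw [Complex.re_ofReal_mul, wave_re, ← Real.cos_neg]
  congr 2
  ring

/-- The series may be differentiated termwise because the decay of `Φ` makes its moments summable.
Two derivatives suffice, since the fourth moment estimate uses only second differences. -/
theorem phiHat_contDiff (h : CouplingAssumption Φ ω₀) : ContDiff ℝ 2 (phiHat Φ) := by
  have e : phiHat Φ = fun k => ∑' x : ℤ, Φ x * Real.cos (2 * Real.pi * x * k) :=
    funext h.phiHat_eq
  have s0 := h.summable 0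
  have s1 := (h.summable 1).mul_left (2 * Real.pi)
  have s2 := (h.summable 2).mul_left ((2 * Real.pi) ^ 2)
  have hpi := Real.pi_pos
  have hlin : ∀ (x : ℤ) (k : ℝ), HasDerivAt (fun k : ℝ => 2 * Real.pi * x * k)
      (2 * Real.pi * x) k := fun x k => by
    simpa using (hasDerivAt_id k).const_mul (2 * Real.pi * (x : ℝ))
  have b1 : ∀ (x : ℤ) (k : ℝ), ‖Φ x * (-Real.sin (2 * Real.pi * x * k) * (2 * Real.pi * x))‖
      ≤ 2 * Real.pi * (|Φ x| * |(x : ℝ)| ^ 1) := by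
    intro x k
    rw [Real.norm_eq_abs, abs_mul, abs_mul, abs_neg, abs_mul, abs_of_pos (by positivity :
      (0 : ℝ) < 2 * Real.pi), pow_one]
    have := Real.abs_sin_le_one (2 * Real.pi * x * k)
    calc _ ≤ |Φ x| * (1 * (2 * Real.pi * |(x : ℝ)|)) := by gcongr
      _ = _ := by ring
  have b2 : ∀ (x : ℤ) (k : ℝ), ‖Φ x * (-(Real.cos (2 * Real.pi * x * k) * (2 * Real.pi * x))
      * (2 * Real.pi * x))‖ ≤ (2 * Real.pi) ^ 2 * (|Φ x| * |(x : ℝ)| ^ 2) := by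
    intro x k
    rw [Real.norm_eq_abs, abs_mul, abs_mul, abs_neg, abs_mul, abs_mul (2 * Real.pi),
      abs_of_pos (by positivity : (0 : ℝ) < 2 * Real.pi)]
    have := Real.abs_cos_le_one (2 * Real.pi * x * k)
    calc _ ≤ |Φ x| * (1 * (2 * Real.pi * |(x : ℝ)|) * (2 * Real.pi * |(x : ℝ)|)) := by gcongr
      _ = _ := by ring
  refine contDiff_two_of_hasDerivAt
    (f₁ := fun k => ∑' x : ℤ, Φ x * (-Real.sin (2 * Real.pi * x * k) * (2 * Real.pi * x)))
    (f₂ := fun k => ∑' x : ℤ, Φ x * (-(Real.cos (2 * Real.pi * x * k) * (2 * Real.pi * x))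
      * (2 * Real.pi * x))) ?_ ?_ ?_
  · intro k
    rw [e]
    refine hasDerivAt_tsum (y₀ := 0) s1 (fun x k => ((hlin x k).cos).const_mul _) b1 ?_ k
    simp only [mul_zero, Real.cos_zero, mul_one]
    exact (by simpa using s0 : Summable fun x => |Φ x|).of_abs
  · intro k
    refine hasDerivAt_tsum (y₀ := 0) s2 (fun x k => (((hlin x k).sin.neg).mul_const _).const_mul _)
      b2 ?_ k
    simp
  · refine continuous_tsum (fun x => by fun_prop) s2 b2

theorem phiHat_periodic (h : CouplingAssumption Φ ω₀) (k : ℝ) : phiHat Φ (k + 1) = phiHat Φ k := by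
  rw [h.phiHat_eq, h.phiHat_eq]
  refine tsum_congr fun x => ?_
  rw [← Real.cos_add_int_mul_two_pi (2 * Real.pi * x * k) x]
  congr 2
  ring

theorem phiHat_even (h : CouplingAssumption Φ ω₀) (k : ℝ) : phiHat Φ (-k) = phiHat Φ k := by
  rw [h.phiHat_eq, h.phiHat_eq]
  refine tsum_congr fun x => ?_
  rw [← Real.cos_neg]
  congr 2
  ring

end CouplingAssumption

theorem exists_bound_of_periodic {f : ℝ → ℝ} (hp : ∀ k, f (k + 1) = f k) (hf : Continuous f) :
    ∃ B : ℝ, ∀ k, |f k| ≤ B := by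
  have h := Function.Periodic.isBounded_of_continuous (f := f) (c := 1) hp one_ne_zero hf
  obtain ⟨B, hB⟩ := h.exists_norm_le
  exact ⟨B, fun k => hB _ ⟨k, rfl⟩⟩

theorem deriv_periodic {f : ℝ → ℝ} (hp : ∀ k, f (k + 1) = f k) (k : ℝ) :
    deriv f (k + 1) = deriv f k := by
  rw [← deriv_comp_add_const]
  congr 1
  exact funext hp

/-- Bounds on a decaying function of time which is smooth and periodic in the parameter. -/
structure SmoothDecay (A : ℝ → ℝ → ℝ) (d K : ℝ) : Prop where
  bound : ∀ s k, 0 ≤ s → |A s k| ≤ K * Real.exp (-d * s)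
  lipschitz : ∀ s k l, 0 ≤ s → |A s k - A s l| ≤ K * Real.exp (-d * s) * |k - l|
  second : ∀ s k h, 0 ≤ s →
    |A s (k + 2 * h) - 2 * A s (k + h) + A s k| ≤ K * Real.exp (-d * s) * h ^ 2

theorem SmoothDecay.add {A B : ℝ → ℝ → ℝ} {d K K' : ℝ} (hA : SmoothDecay A d K)
    (hB : SmoothDecay B d K') : SmoothDecay (fun s k => A s k + B s k) d (K + K') := by
  refine ⟨fun s k hs => ?_, fun s k l hs => ?_, fun s k h hs => ?_⟩
  · rw [add_mul]
    exact (abs_add_le _ _).trans (add_le_add (hA.bound s k hs) (hB.bound s k hs))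
  · rw [add_mul, add_mul]
    refine le_trans (le_of_eq ?_) ((abs_add_le _ _).trans
      (add_le_add (hA.lipschitz s k l hs) (hB.lipschitz s k l hs)))
    congr 1
    ring
  · rw [add_mul, add_mul]
    refine le_trans (le_of_eq ?_) ((abs_add_le _ _).trans
      (add_le_add (hA.second s k h hs) (hB.second s k h hs)))
    congr 1
    ring

theorem abs_sub_le_of_hasDerivAt {f f' : ℝ → ℝ} {C : ℝ} (hf : ∀ k, HasDerivAt f (f' k) k)
    (hC : ∀ k, |f' k| ≤ C) (k l : ℝ) : |f k - f l| ≤ C * |k - l| := by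
  exact Convex.norm_image_sub_le_of_norm_hasDerivWithin_le (s := Set.univ)
    (fun x _ => (hf x).hasDerivWithinAt) (fun x _ => hC x) convex_univ (Set.mem_univ l)
    (Set.mem_univ k)

/-- Each derivative of `e^{-sμ(k)}` in `k` costs a factor `s`. Half of the decay rate is spent on
absorbing these powers; periodicity makes the remaining coefficients bounded. -/
theorem SmoothDecay.of_exp {q μ : ℝ → ℝ} {d : ℝ} (hd : 0 < d) (hq : ContDiff ℝ 2 q)
    (hμ : ContDiff ℝ 2 μ) (hqp : ∀ k, q (k + 1) = q k) (hμp : ∀ k, μ (k + 1) = μ k)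
    (hμd : ∀ k, d ≤ μ k) :
    ∃ K, SmoothDecay (fun s k => q k * Real.exp (-s * μ k)) (d / 2) K := by
  have hq1 : ContDiff ℝ 1 (deriv q) := by
    have h : ContDiff ℝ (1 + 1) q := by rwa [one_add_one_eq_two]
    exact (contDiff_succ_iff_deriv.1 h).2.2
  have hμ1 : ContDiff ℝ 1 (deriv μ) := by
    have h : ContDiff ℝ (1 + 1) μ := by rwa [one_add_one_eq_two]
    exact (contDiff_succ_iff_deriv.1 h).2.2
  obtain ⟨B₁, h₁⟩ := exists_bound_of_periodic hqp hq.continuous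
  obtain ⟨B₂, h₂⟩ := exists_bound_of_periodic (deriv_periodic hqp) hq1.continuous
  obtain ⟨B₃, h₃⟩ := exists_bound_of_periodic (deriv_periodic (deriv_periodic hqp))
    (contDiff_one_iff_deriv.1 hq1).2
  obtain ⟨B₄, h₄⟩ := exists_bound_of_periodic (deriv_periodic hμp) hμ1.continuous
  obtain ⟨B₅, h₅⟩ := exists_bound_of_periodic (deriv_periodic (deriv_periodic hμp))
    (contDiff_one_iff_deriv.1 hμ1).2
  have dq : ∀ k, HasDerivAt q (deriv q k) k := fun k =>
    (hq.differentiable (by norm_num) k).hasDerivAt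
  have dμ : ∀ k, HasDerivAt μ (deriv μ k) k := fun k =>
    (hμ.differentiable (by norm_num) k).hasDerivAt
  have ddq : ∀ k, HasDerivAt (deriv q) (deriv (deriv q) k) k := fun k =>
    (hq1.differentiable (by norm_num) k).hasDerivAt
  have ddμ : ∀ k, HasDerivAt (deriv μ) (deriv (deriv μ) k) k := fun k =>
    (hμ1.differentiable (by norm_num) k).hasDerivAt
  set f₁ : ℝ → ℝ → ℝ := fun s k => (deriv q k - s * (q k * deriv μ k)) * Real.exp (-s * μ k)
    with hf₁
  set f₂ : ℝ → ℝ → ℝ := fun s k => (deriv (deriv q) k - 2 * s * (deriv q k * deriv μ k)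
    - s * (q k * deriv (deriv μ) k) + s ^ 2 * (q k * deriv μ k ^ 2)) * Real.exp (-s * μ k)
    with hf₂
  have hexp : ∀ s k, HasDerivAt (fun k => Real.exp (-s * μ k))
      (Real.exp (-s * μ k) * (-s * deriv μ k)) k := fun s k => ((dμ k).const_mul (-s)).exp
  have D1 : ∀ s k, HasDerivAt (fun k => q k * Real.exp (-s * μ k)) (f₁ s k) k := by
    intro s k
    refine ((dq k).mul (hexp s k)).congr_deriv ?_
    simp only [hf₁]
    ring
  have D2 : ∀ s k, HasDerivAt (f₁ s) (f₂ s k) k := by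
    intro s k
    refine (((ddq k).sub (((dq k).mul (ddμ k)).const_mul s)).mul (hexp s k)).congr_deriv ?_
    simp only [hf₂, Pi.mul_apply, Pi.sub_apply]
    ring
  have n₁ := (abs_nonneg _).trans (h₁ 0)
  have n₂ := (abs_nonneg _).trans (h₂ 0)
  have n₃ := (abs_nonneg _).trans (h₃ 0)
  have n₄ := (abs_nonneg _).trans (h₄ 0)
  have n₅ := (abs_nonneg _).trans (h₅ 0)
  have E : ∀ s k, 0 ≤ s → Real.exp (-s * μ k) ≤ Real.exp (-(d / 2) * s) * Real.exp (-(d / 2) * s) := by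
    intro s k hs
    rw [← Real.exp_add]
    apply Real.exp_le_exp.2
    nlinarith [hμd k]
  have hs1 : ∀ s : ℝ, 0 ≤ s → s * Real.exp (-(d / 2) * s) ≤ 2 / d := by
    intro s hs
    have h := Real.add_one_le_exp (d / 2 * s)
    rw [neg_mul, Real.exp_neg, ← div_eq_mul_inv, div_le_iff₀ (Real.exp_pos _)]
    have : s = 2 / d * (d / 2 * s) := by field_simp
    calc s = 2 / d * (d / 2 * s) := this
      _ ≤ _ := by gcongr; linarith
  have hs2 : ∀ s : ℝ, 0 ≤ s → s ^ 2 * Real.exp (-(d / 2) * s) ≤ (4 / d) ^ 2 := by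
    intro s hs
    have h := Real.add_one_le_exp (d / 4 * s)
    have h2 : s * Real.exp (-(d / 4) * s) ≤ 4 / d := by
      rw [neg_mul, Real.exp_neg, ← div_eq_mul_inv, div_le_iff₀ (Real.exp_pos _)]
      have : s = 4 / d * (d / 4 * s) := by field_simp
      calc s = 4 / d * (d / 4 * s) := this
        _ ≤ _ := by gcongr; linarith
    calc s ^ 2 * Real.exp (-(d / 2) * s) = (s * Real.exp (-(d / 4) * s)) ^ 2 := by
          rw [mul_pow, ← Real.exp_nat_mul]
          congr 2
          push_cast
          ring
      _ ≤ _ := by gcongr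
  have hs0 : ∀ s : ℝ, 0 ≤ s → Real.exp (-(d / 2) * s) ≤ 1 := by
    intro s hs
    rw [Real.exp_le_one_iff]
    nlinarith
  -- The three groups bound the function and its first and second derivatives; their sum serves all
  -- three at once.
  set K := B₁ + (B₂ + 2 / d * (B₁ * B₄)) + (B₃ + 2 * (2 / d) * (B₂ * B₄) + 2 / d * (B₁ * B₅)
    + (4 / d) ^ 2 * (B₁ * B₄ ^ 2)) with hK
  have bound0 : ∀ s k, 0 ≤ s → |q k * Real.exp (-s * μ k)| ≤ K * Real.exp (-(d / 2) * s) := by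
    intro s k hs
    rw [abs_mul, Real.abs_exp]
    calc |q k| * Real.exp (-s * μ k)
        ≤ B₁ * (Real.exp (-(d / 2) * s) * Real.exp (-(d / 2) * s)) := by
          gcongr
          · exact h₁ k
          · exact E s k hs
      _ ≤ B₁ * (1 * Real.exp (-(d / 2) * s)) := by
          gcongr
          exact hs0 s hs
      _ ≤ K * Real.exp (-(d / 2) * s) := by
          rw [one_mul]
          gcongr
          rw [hK, add_assoc]
          exact le_add_of_nonneg_right (by positivity)
  have bound1 : ∀ s k, 0 ≤ s → |f₁ s k| ≤ K * Real.exp (-(d / 2) * s) := by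
    intro s k hs
    simp only [hf₁]
    rw [abs_mul, Real.abs_exp]
    have ht : |deriv q k - s * (q k * deriv μ k)| ≤ B₂ + s * (B₁ * B₄) := by
      refine (abs_sub _ _).trans ?_
      rw [abs_mul, abs_mul, abs_of_nonneg hs]
      gcongr
      · exact h₂ k
      · exact h₁ k
      · exact h₄ k
    set e := Real.exp (-(d / 2) * s) with he
    have he0 : 0 < e := Real.exp_pos _
    have i1 := hs1 s hs
    have i0 := hs0 s hs
    calc _ ≤ (B₂ + s * (B₁ * B₄)) * (e * e) := by
          gcongr
          exact E s k hs
      _ = (B₂ * e + s * e * (B₁ * B₄)) * e := by ring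
      _ ≤ (B₂ * 1 + 2 / d * (B₁ * B₄)) * e := by gcongr
      _ ≤ K * e := by
          gcongr
          rw [hK, mul_one, add_comm B₁, add_assoc]
          exact le_add_of_nonneg_right (by positivity)
  have bound2 : ∀ s k, 0 ≤ s → |f₂ s k| ≤ K * Real.exp (-(d / 2) * s) := by
    intro s k hs
    simp only [hf₂]
    rw [abs_mul, Real.abs_exp]
    have ht : |deriv (deriv q) k - 2 * s * (deriv q k * deriv μ k)
        - s * (q k * deriv (deriv μ) k) + s ^ 2 * (q k * deriv μ k ^ 2)|
        ≤ B₃ + 2 * s * (B₂ * B₄) + s * (B₁ * B₅) + s ^ 2 * (B₁ * B₄ ^ 2) := by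
      refine (abs_add_le _ _).trans (add_le_add ((abs_sub _ _).trans
        (add_le_add ((abs_sub _ _).trans (add_le_add (h₃ k) ?_)) ?_)) ?_)
      · rw [abs_mul, abs_mul, abs_mul, abs_of_nonneg hs, abs_two]
        gcongr
        · exact h₂ k
        · exact h₄ k
      · rw [abs_mul, abs_mul, abs_of_nonneg hs]
        gcongr
        · exact h₁ k
        · exact h₅ k
      · rw [abs_mul, abs_mul, abs_pow, abs_pow, abs_of_nonneg hs]
        gcongr
        · exact h₁ k
        · exact h₄ k
    set e := Real.exp (-(d / 2) * s) with he
    have he0 : 0 < e := Real.exp_pos _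
    have i2 := hs2 s hs
    have i1 := hs1 s hs
    have i0 := hs0 s hs
    calc _ ≤ (B₃ + 2 * s * (B₂ * B₄) + s * (B₁ * B₅) + s ^ 2 * (B₁ * B₄ ^ 2)) * (e * e) := by
          gcongr
          exact E s k hs
      _ = (B₃ * e + 2 * (s * e) * (B₂ * B₄) + s * e * (B₁ * B₅)
          + s ^ 2 * e * (B₁ * B₄ ^ 2)) * e := by ring
      _ ≤ (B₃ * 1 + 2 * (2 / d) * (B₂ * B₄) + 2 / d * (B₁ * B₅)
          + (4 / d) ^ 2 * (B₁ * B₄ ^ 2)) * e := by gcongr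
      _ ≤ K * e := by
          gcongr
          rw [hK, mul_one]
          exact le_add_of_nonneg_left (by positivity)
  refine ⟨K, bound0, fun s k l hs => abs_sub_le_of_hasDerivAt (D1 s) (bound1 s · hs) k l, ?_⟩
  intro s k h hs
  -- A second difference is the increment of `k ↦ f(k+h) - f(k)`, so the mean value inequality is
  -- used twice.
  have hstep : ∀ k, HasDerivAt (fun k => q (k + h) * Real.exp (-s * μ (k + h))
      - q k * Real.exp (-s * μ k)) (f₁ s (k + h) - f₁ s k) k := fun k =>
    (HasDerivAt.comp_add_const k h (D1 s (k + h))).sub (D1 s k)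
  have hC : ∀ k, |f₁ s (k + h) - f₁ s k| ≤ K * Real.exp (-(d / 2) * s) * |h| := fun k => by
    simpa only [add_sub_cancel_left] using
      abs_sub_le_of_hasDerivAt (D2 s) (bound2 s · hs) (k + h) k
  have := abs_sub_le_of_hasDerivAt hstep hC (k + h) k
  simp only [add_sub_cancel_left] at this
  rw [mul_assoc, ← sq, sq_abs] at this
  refine le_trans (le_of_eq ?_) this
  congr 1
  rw [show k + 2 * h = k + h + h by ring]
  ring

/-- The coefficient of `e^{-t μ_σ(k)}` in `A2hat`. -/
def qFun (Φ : ℤ → ℝ) (γ σ k : ℝ) : ℝ := σ * muFun Φ γ σ k / (2 * uFun Φ γ k)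

theorem A2hat_eq (Φ : ℤ → ℝ) (γ t k : ℝ) :
    A2hat Φ γ t k = qFun Φ γ 1 k * Real.exp (-t * muFun Φ γ 1 k)
      + qFun Φ γ (-1) k * Real.exp (-t * muFun Φ γ (-1) k) := by
  rw [A2hat, qFun, qFun]
  ring

section
variable {Φ : ℤ → ℝ} {ω₀ γ : ℝ}

theorem uFun_arg_pos (hγ : NoiseAssumption Φ γ) (k : ℝ) :
    0 < (γ / 2) ^ 2 - phiHat Φ k := by
  linarith [hγ.dominates k]

theorem omega_sq (hΦ : CouplingAssumption Φ ω₀) (k : ℝ) : omega Φ k ^ 2 = phiHat Φ k := by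
  rw [omega, Real.sq_sqrt]
  exact (sq_nonneg _).trans (hΦ.pinning k)

theorem uFun_sq (hΦ : CouplingAssumption Φ ω₀) (hγ : NoiseAssumption Φ γ) (k : ℝ) :
    uFun Φ γ k ^ 2 = (γ / 2) ^ 2 - phiHat Φ k := by
  rw [uFun, omega_sq hΦ, Real.sq_sqrt (uFun_arg_pos hγ k).le]

theorem uFun_pos (hΦ : CouplingAssumption Φ ω₀) (hγ : NoiseAssumption Φ γ) (k : ℝ) :
    0 < uFun Φ γ k := by
  rw [uFun, omega_sq hΦ]
  exact Real.sqrt_pos.2 (uFun_arg_pos hγ k)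

theorem uFun_contDiff (hΦ : CouplingAssumption Φ ω₀) (hγ : NoiseAssumption Φ γ) :
    ContDiff ℝ 2 (uFun Φ γ) := by
  have : uFun Φ γ = fun k => Real.sqrt ((γ / 2) ^ 2 - phiHat Φ k) := by
    funext k
    rw [uFun, omega_sq hΦ]
  rw [this]
  exact (contDiff_const.sub hΦ.phiHat_contDiff).sqrt fun k => (uFun_arg_pos hγ k).ne'

theorem uFun_periodic (hΦ : CouplingAssumption Φ ω₀) (k : ℝ) :
    uFun Φ γ (k + 1) = uFun Φ γ k := by
  rw [uFun, uFun, omega, omega, hΦ.phiHat_periodic]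

theorem uFun_even (hΦ : CouplingAssumption Φ ω₀) (k : ℝ) : uFun Φ γ (-k) = uFun Φ γ k := by
  rw [uFun, uFun, omega, omega, hΦ.phiHat_even]

theorem muFun_contDiff (hΦ : CouplingAssumption Φ ω₀) (hγ : NoiseAssumption Φ γ) (σ : ℝ) :
    ContDiff ℝ 2 (muFun Φ γ σ) := by
  unfold muFun
  exact contDiff_const.add (contDiff_const.mul (uFun_contDiff hΦ hγ))

theorem qFun_contDiff (hΦ : CouplingAssumption Φ ω₀) (hγ : NoiseAssumption Φ γ) (σ : ℝ) :
    ContDiff ℝ 2 (qFun Φ γ σ) := by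
  unfold qFun
  exact (contDiff_const.mul (muFun_contDiff hΦ hγ σ)).div
    (contDiff_const.mul (uFun_contDiff hΦ hγ))
    fun k => (mul_pos two_pos (uFun_pos hΦ hγ k)).ne'

/-- The smaller root satisfies `μ_- = ω²/μ_+` with `μ_+ < γ`, hence `μ_- ≥ ω₀²/γ`. -/
theorem le_muFun (hΦ : CouplingAssumption Φ ω₀) (hγ : NoiseAssumption Φ γ) {σ : ℝ}
    (hσ : σ ∈ ({1, -1} : Finset ℝ)) (k : ℝ) : ω₀ ^ 2 / γ ≤ muFun Φ γ σ k := by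
  have hg := hγ.gamma_pos
  have hu := uFun_sq hΦ hγ k
  have hu0 := uFun_pos hΦ hγ k
  have hp := hΦ.pinning k
  have h0 : 0 < ω₀ ^ 2 := pow_pos hΦ.omega_pos 2
  have hlt : uFun Φ γ k < γ / 2 := by nlinarith
  rw [div_le_iff₀ hg, muFun]
  rw [Finset.mem_insert, Finset.mem_singleton] at hσ
  rcases hσ with rfl | rfl <;> nlinarith

theorem smoothDecay_A2hat (hΦ : CouplingAssumption Φ ω₀) (hγ : NoiseAssumption Φ γ) :
    ∃ K, SmoothDecay (A2hat Φ γ) (ω₀ ^ 2 / γ / 2) K := by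
  have hd : 0 < ω₀ ^ 2 / γ := div_pos (pow_pos hΦ.omega_pos 2) hγ.gamma_pos
  have key : ∀ σ ∈ ({1, -1} : Finset ℝ), ∃ K, SmoothDecay
      (fun s k => qFun Φ γ σ k * Real.exp (-s * muFun Φ γ σ k)) (ω₀ ^ 2 / γ / 2) K := by
    intro σ hσ
    refine SmoothDecay.of_exp hd (qFun_contDiff hΦ hγ σ) (muFun_contDiff hΦ hγ σ) ?_ ?_
      (le_muFun hΦ hγ hσ)
    · intro k
      rw [qFun, qFun, muFun, muFun, uFun_periodic hΦ]
    · intro k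
      rw [muFun, muFun, uFun_periodic hΦ]
  obtain ⟨K, hK⟩ := key 1 (by simp)
  obtain ⟨K', hK'⟩ := key (-1) (by simp)
  refine ⟨K + K', ?_⟩
  have := hK.add hK'
  convert this using 3
  exact A2hat_eq _ _ _ _

theorem A2hat_periodic (hΦ : CouplingAssumption Φ ω₀) (t k : ℝ) :
    A2hat Φ γ t (k + 1) = A2hat Φ γ t k := by
  rw [A2hat, A2hat, muFun, muFun, muFun, muFun, uFun_periodic hΦ]

theorem A2hat_even (hΦ : CouplingAssumption Φ ω₀) (t k : ℝ) :
    A2hat Φ γ t (-k) = A2hat Φ γ t k := by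
  rw [A2hat, A2hat, muFun, muFun, muFun, muFun, uFun_even hΦ]

theorem exists_qFun_bound (hΦ : CouplingAssumption Φ ω₀) (hγ : NoiseAssumption Φ γ) :
    ∃ Q : ℝ, 0 < Q ∧ ∀ σ ∈ ({1, -1} : Finset ℝ), ∀ k, |qFun Φ γ σ k| ≤ Q := by
  have key : ∀ σ : ℝ, ∃ B, ∀ k, |qFun Φ γ σ k| ≤ B := by
    intro σ
    refine exists_bound_of_periodic (fun k => ?_) (qFun_contDiff hΦ hγ σ).continuous
    rw [qFun, qFun, muFun, muFun, uFun_periodic hΦ]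
  obtain ⟨B, hB⟩ := key 1
  obtain ⟨B', hB'⟩ := key (-1)
  refine ⟨max 1 (max B B'), by positivity, ?_⟩
  intro σ hσ k
  rw [Finset.mem_insert, Finset.mem_singleton] at hσ
  rcases hσ with rfl | rfl
  · exact (hB k).trans (by simp)
  · exact (hB' k).trans (by simp)

end
end VelocityFlip
end

/-! ### The memory kernel as an exponential sum, and its Laplace transform near the imaginary axis.
-/

noncomputable section
namespace VelocityFlip
open Finset

/-- The index set of the exponential sum which represents the memory kernel. -/
def kerJ (L : ℕ) : Finset (ℤ × ℝ × ℝ) :=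
  lattice L ×ˢ (({1, -1} : Finset ℝ) ×ˢ ({1, -1} : Finset ℝ))

/-- The amplitudes of the exponential sum which represents the memory kernel. -/
def kerC (Φ : ℤ → ℝ) (γ : ℝ) (L : ℕ) (m : ℤ) (j : ℤ × ℝ × ℝ) : ℝ :=
  2 * γ / L * (qFun Φ γ j.2.1 ((j.1 : ℝ) / L) * qFun Φ γ j.2.2 (((j.1 + m : ℤ) : ℝ) / L))

/-- The decay rates of the exponential sum which represents the memory kernel. -/
def kerM (Φ : ℤ → ℝ) (γ : ℝ) (L : ℕ) (m : ℤ) (j : ℤ × ℝ × ℝ) : ℝ :=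
  muFun Φ γ j.2.1 ((j.1 : ℝ) / L) + muFun Φ γ j.2.2 (((j.1 + m : ℤ) : ℝ) / L)

/-- The Laplace transform of the memory kernel at the wave number `m / L`, as a rational
function. -/
def kerLap (Φ : ℤ → ℝ) (γ : ℝ) (L : ℕ) (m : ℤ) : ℂ → ℂ :=
  lap (kerJ L) (kerC Φ γ L m) (kerM Φ γ L m)

/-- Minus the derivative of `kerLap`. -/
def kerLapD (Φ : ℤ → ℝ) (γ : ℝ) (L : ℕ) (m : ℤ) : ℂ → ℂ :=
  lapD (kerJ L) (kerC Φ γ L m) (kerM Φ γ L m)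

theorem sum_kerJ {M : Type*} [AddCommMonoid M] (L : ℕ) (f : ℤ × ℝ × ℝ → M) :
    ∑ j ∈ kerJ L, f j = ∑ n ∈ lattice L,
      ((f (n, 1, 1) + f (n, 1, -1)) + (f (n, -1, 1) + f (n, -1, -1))) := by
  have h : (1 : ℝ) ≠ -1 := by norm_num
  rw [kerJ, Finset.sum_product]
  refine Finset.sum_congr rfl fun n _ => ?_
  rw [Finset.sum_product, Finset.sum_pair h, Finset.sum_pair h, Finset.sum_pair h]

section
variable {Φ : ℤ → ℝ} {ω₀ γ : ℝ} {L : ℕ}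

theorem expSum_ker (s : ℝ) (m : ℤ) :
    expSum (kerJ L) (kerC Φ γ L m) (kerM Φ γ L m) s
      = 2 * γ * ((1 / (L : ℝ)) * ∑ n ∈ lattice L,
        A2hat Φ γ s ((n : ℝ) / L) * A2hat Φ γ s (((n + m : ℤ) : ℝ) / L)) := by
  rw [expSum, sum_kerJ, Finset.mul_sum, Finset.mul_sum]
  refine Finset.sum_congr rfl fun n _ => ?_
  simp only [kerC, kerM, A2hat_eq, mul_add, Real.exp_add]
  ring

theorem cosSum_eq (hΦ : CouplingAssumption Φ ω₀) (hL : 1 ≤ L) (m : ℤ) (s : ℝ) :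
    cosSum Φ γ L ((m : ℝ) / L) s = expSum (kerJ L) (kerC Φ γ L m) (kerM Φ γ L m) s := by
  rw [expSum_ker, ← sum_sq_dualInt_cos (A2hat_periodic hΦ s) (A2hat_even hΦ s) hL, cosSum,
    Finset.mul_sum]
  refine Finset.sum_congr rfl fun y _ => ?_
  rw [memKernel]
  ring

theorem le_kerM (hΦ : CouplingAssumption Φ ω₀) (hγ : NoiseAssumption Φ γ) (m : ℤ) :
    ∀ j ∈ kerJ L, 2 * (ω₀ ^ 2 / γ) ≤ kerM Φ γ L m j := by
  intro j hj
  rw [kerJ, Finset.mem_product, Finset.mem_product] at hj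
  rw [kerM, two_mul]
  exact add_le_add (le_muFun hΦ hγ hj.2.1 _) (le_muFun hΦ hγ hj.2.2 _)

/-- The `4L` amplitudes are each `O(1/L)`; this is the source of the uniformity in `L`. -/
theorem sum_abs_kerC_le (hγ : NoiseAssumption Φ γ) (hL : 1 ≤ L) {Q : ℝ}
    (hQ : ∀ σ ∈ ({1, -1} : Finset ℝ), ∀ k, |qFun Φ γ σ k| ≤ Q) (m : ℤ) :
    ∑ j ∈ kerJ L, |kerC Φ γ L m j| ≤ 8 * γ * Q ^ 2 := by
  have hL0 : (0 : ℝ) < L := by exact_mod_cast hL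
  have hg := hγ.gamma_pos
  have hb : ∀ j ∈ kerJ L, |kerC Φ γ L m j| ≤ 2 * γ / L * (Q * Q) := by
    intro j hj
    rw [kerJ, Finset.mem_product, Finset.mem_product] at hj
    rw [kerC, abs_mul, abs_mul, abs_of_pos (by positivity : 0 < 2 * γ / (L : ℝ))]
    have h1 := hQ _ hj.2.1 ((j.1 : ℝ) / L)
    have h2 := hQ _ hj.2.2 (((j.1 + m : ℤ) : ℝ) / L)
    have h3 := (abs_nonneg _).trans h1
    gcongr
  refine (Finset.sum_le_sum hb).trans (le_of_eq ?_)
  have hc : (({1, -1} : Finset ℝ)).card = 2 := Finset.card_pair (by norm_num)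
  rw [Finset.sum_const, kerJ, Finset.card_product, Finset.card_product, hc, card_lattice,
    nsmul_eq_mul]
  push_cast
  field_simp
  ring

theorem pHat_eq (hΦ : CouplingAssumption Φ ω₀) (hγ : NoiseAssumption Φ γ) (hL : 1 ≤ L) (m : ℤ)
    {z : ℂ} (hz : -(2 * (ω₀ ^ 2 / γ)) < z.re) :
    pHat Φ γ L z ((m : ℝ) / L) = kerLap Φ γ L m z := by
  rw [kerLap, ← (integrableOn_expSum_mul_cexp (le_kerM hΦ hγ m) hz).2, pHat]
  congr 1
  funext s
  rw [expSum_ker, ← mul_one (2 * γ)]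
  have h := sum_sq_dualInt_wave (A2hat_periodic (γ := γ) hΦ s) (A2hat_even hΦ s) hL m
  rw [mul_assoc, one_mul, Complex.ofReal_mul, ← h, Finset.mul_sum, Finset.sum_mul]
  refine Finset.sum_congr rfl fun y _ => ?_
  rw [memKernel]
  push_cast
  ring

theorem add_muFun_ne_zero (hΦ : CouplingAssumption Φ ω₀) (hγ : NoiseAssumption Φ γ) {z : ℂ}
    (hz : -(2 * (ω₀ ^ 2 / γ)) < z.re) {σ τ : ℝ} (hσ : σ ∈ ({1, -1} : Finset ℝ))
    (hτ : τ ∈ ({1, -1} : Finset ℝ)) (k : ℝ) :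
    z + ((muFun Φ γ σ k + muFun Φ γ τ k : ℝ) : ℂ) ≠ 0 := by
  intro h
  have := congrArg Complex.re h
  rw [Complex.add_re, Complex.ofReal_re, Complex.zero_re] at this
  linarith [le_muFun hΦ hγ hσ k, le_muFun hΦ hγ hτ k]

/-- The zero mode of the Laplace transform is explicit. -/
theorem one_sub_kerLap_zero (hΦ : CouplingAssumption Φ ω₀) (hγ : NoiseAssumption Φ γ)
    (hL : 1 ≤ L) {z : ℂ} (hz : -(2 * (ω₀ ^ 2 / γ)) < z.re) :
    1 - kerLap Φ γ L 0 z = (1 / (L : ℂ)) * ∑ n ∈ lattice L,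
      z * (z ^ 2 + γ * z + 4 * (phiHat Φ ((n : ℝ) / L) : ℂ))
        / ((z ^ 2 + 2 * γ * z + 4 * (phiHat Φ ((n : ℝ) / L) : ℂ)) * (z + γ)) := by
  have hL0 : (L : ℂ) ≠ 0 := by exact_mod_cast (by positivity : (L : ℝ) ≠ 0)
  have hone : (1 : ℂ) = (1 / (L : ℂ)) * ∑ n ∈ lattice L, 1 := by
    rw [Finset.sum_const, card_lattice]
    simp [hL0]
  rw [kerLap, lap, sum_kerJ]
  conv_lhs => rw [hone]
  have hm : ∑ n ∈ lattice L, ((((kerC Φ γ L 0 (n, 1, 1) : ℝ) : ℂ) / (z + kerM Φ γ L 0 (n, 1, 1))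
      + ((kerC Φ γ L 0 (n, 1, -1) : ℝ) : ℂ) / (z + kerM Φ γ L 0 (n, 1, -1)))
      + (((kerC Φ γ L 0 (n, -1, 1) : ℝ) : ℂ) / (z + kerM Φ γ L 0 (n, -1, 1))
      + ((kerC Φ γ L 0 (n, -1, -1) : ℝ) : ℂ) / (z + kerM Φ γ L 0 (n, -1, -1))))
    = (1 / (L : ℂ)) * ∑ n ∈ lattice L, (1 - z * (z ^ 2 + γ * z + 4 * (phiHat Φ ((n : ℝ) / L) : ℂ))
        / ((z ^ 2 + 2 * γ * z + 4 * (phiHat Φ ((n : ℝ) / L) : ℂ)) * (z + γ))) := by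
    rw [Finset.mul_sum]
    refine Finset.sum_congr rfl fun n _ => ?_
    simp only [kerC, kerM, add_zero]
    set k : ℝ := (n : ℝ) / L with hk
    have n1 := add_muFun_ne_zero hΦ hγ hz (σ := 1) (τ := 1) (by simp) (by simp) k
    have n2 := add_muFun_ne_zero hΦ hγ hz (σ := -1) (τ := -1) (by simp) (by simp) k
    have n3 := add_muFun_ne_zero hΦ hγ hz (σ := 1) (τ := -1) (by simp) (by simp) k
    have hu : (uFun Φ γ k : ℂ) ≠ 0 := by exact_mod_cast (uFun_pos hΦ hγ k).ne'
    have hw : (phiHat Φ k : ℂ) = (γ / 2) ^ 2 - (uFun Φ γ k : ℂ) ^ 2 := by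
      have h := uFun_sq hΦ hγ k
      have h' : phiHat Φ k = (γ / 2) ^ 2 - uFun Φ γ k ^ 2 := by linarith
      rw [h']
      push_cast
      ring
    have m1 : ((muFun Φ γ 1 k : ℝ) : ℂ) = γ / 2 + uFun Φ γ k := by
      rw [muFun]; push_cast; ring
    have m2 : ((muFun Φ γ (-1) k : ℝ) : ℂ) = γ / 2 - uFun Φ γ k := by
      rw [muFun]; push_cast; ring
    simp only [qFun]
    push_cast at n1 n2 n3 ⊢
    rw [m1] at n1 n3 ⊢
    rw [m2] at n2 n3 ⊢
    set u : ℂ := (uFun Φ γ k : ℂ) with hu'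
    have n1' : z + γ + 2 * u ≠ 0 := by
      convert n1 using 1
      ring
    have n2' : z + γ - 2 * u ≠ 0 := by
      convert n2 using 1
      ring
    have n3' : z + γ ≠ 0 := by
      convert n3 using 1
      ring
    -- The poles of a single mode are `-2μ_+`, `-2μ_-` and `-(μ_+ + μ_-) = -γ`.
    have hD : z ^ 2 + 2 * γ * z + 4 * (phiHat Φ k : ℂ) = (z + γ + 2 * u) * (z + γ - 2 * u) := by
      rw [hw]; ring
    rw [hD, hw]
    have e1 : z + ((γ : ℂ) / 2 + u + (γ / 2 + u)) = z + γ + 2 * u := by ring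
    have e2 : z + ((γ : ℂ) / 2 + u + (γ / 2 - u)) = z + γ := by ring
    have e3 : z + ((γ : ℂ) / 2 - u + (γ / 2 + u)) = z + γ := by ring
    have e4 : z + ((γ : ℂ) / 2 - u + (γ / 2 - u)) = z + γ - 2 * u := by ring
    rw [e1, e2, e3, e4]
    field_simp
    ring
  rw [hm, ← mul_sub, ← Finset.sum_sub_distrib]
  congr 1
  refine Finset.sum_congr rfl fun n _ => ?_
  ring

/-- The explicit formula for `1 - p̂(z,0)` carries a factor `z`. Equivalently, the kernel has total
mass one. -/
theorem kerLap_zero_zero (hΦ : CouplingAssumption Φ ω₀) (hγ : NoiseAssumption Φ γ)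
    (hL : 1 ≤ L) : kerLap Φ γ L 0 0 = 1 := by
  have hd : 0 < ω₀ ^ 2 / γ := div_pos (pow_pos hΦ.omega_pos 2) hγ.gamma_pos
  have h := one_sub_kerLap_zero hΦ hγ hL (z := 0) (by simpa using hd)
  simp only [zero_mul, zero_div, Finset.sum_const_zero, mul_zero] at h
  linear_combination -h

/-- Every mode contributes the same amount `1/(Lγ)`, whatever its frequency, so the slope at the
origin is exact and independent of `L`. -/
theorem kerLapD_zero_zero (hΦ : CouplingAssumption Φ ω₀) (hγ : NoiseAssumption Φ γ)
    (hL : 1 ≤ L) : kerLapD Φ γ L 0 0 = 1 / γ := by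
  have hd : 0 < ω₀ ^ 2 / γ := div_pos (pow_pos hΦ.omega_pos 2) hγ.gamma_pos
  have hL0 : (L : ℂ) ≠ 0 := by exact_mod_cast (by positivity : (L : ℝ) ≠ 0)
  have hz : -(2 * (ω₀ ^ 2 / γ)) < (0 : ℂ).re := by simpa using hd
  have hg : (γ : ℂ) ≠ 0 := by exact_mod_cast hγ.gamma_pos.ne'
  rw [kerLapD, lapD, sum_kerJ]
  have hterm : ∀ n ∈ lattice L,
      ((((kerC Φ γ L 0 (n, 1, 1) : ℝ) : ℂ) / (0 + kerM Φ γ L 0 (n, 1, 1)) ^ 2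
      + ((kerC Φ γ L 0 (n, 1, -1) : ℝ) : ℂ) / (0 + kerM Φ γ L 0 (n, 1, -1)) ^ 2)
      + (((kerC Φ γ L 0 (n, -1, 1) : ℝ) : ℂ) / (0 + kerM Φ γ L 0 (n, -1, 1)) ^ 2
      + ((kerC Φ γ L 0 (n, -1, -1) : ℝ) : ℂ) / (0 + kerM Φ γ L 0 (n, -1, -1)) ^ 2))
      = 1 / L * (1 / γ) := by
    intro n _
    simp only [kerC, kerM, add_zero]
    set k : ℝ := (n : ℝ) / L with hk
    have n1 := add_muFun_ne_zero hΦ hγ hz (σ := 1) (τ := 1) (by simp) (by simp) k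
    have n2 := add_muFun_ne_zero hΦ hγ hz (σ := -1) (τ := -1) (by simp) (by simp) k
    have hu : (uFun Φ γ k : ℂ) ≠ 0 := by exact_mod_cast (uFun_pos hΦ hγ k).ne'
    have m1 : ((muFun Φ γ 1 k : ℝ) : ℂ) = γ / 2 + uFun Φ γ k := by
      rw [muFun]; push_cast; ring
    have m2 : ((muFun Φ γ (-1) k : ℝ) : ℂ) = γ / 2 - uFun Φ γ k := by
      rw [muFun]; push_cast; ring
    simp only [qFun]
    push_cast at n1 n2 ⊢
    rw [m1] at n1 ⊢
    rw [m2] at n2 ⊢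
    set u : ℂ := (uFun Φ γ k : ℂ) with hu'
    have n1' : (γ : ℂ) + 2 * u ≠ 0 := by
      convert n1 using 1
      ring
    have n2' : (γ : ℂ) - 2 * u ≠ 0 := by
      convert n2 using 1
      ring
    have e1 : 0 + ((γ : ℂ) / 2 + u + (γ / 2 + u)) = γ + 2 * u := by ring
    have e2 : 0 + ((γ : ℂ) / 2 + u + (γ / 2 - u)) = γ := by ring
    have e3 : 0 + ((γ : ℂ) / 2 - u + (γ / 2 + u)) = γ := by ring
    have e4 : 0 + ((γ : ℂ) / 2 - u + (γ / 2 - u)) = γ - 2 * u := by ring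
    have e5 : (γ : ℂ) / 2 + u = (γ + 2 * u) / 2 := by ring
    have e6 : (γ : ℂ) / 2 - u = (γ - 2 * u) / 2 := by ring
    rw [e1, e2, e3, e4, e5, e6]
    field_simp
    ring
  rw [Finset.sum_congr rfl hterm, Finset.sum_const, card_lattice, nsmul_eq_mul]
  field_simp

/-- One mode of `1 - p̂(iα,0)`. The bound no longer contains the frequency `w`, so averaging over
the modes preserves it. -/
theorem le_re_div_of_re {α w g : ℝ} (hg : 0 < g) (hw : 0 < w) :
    α ^ 2 / (4 * (g ^ 2 + α ^ 2)) ≤ ((Complex.I * α) * ((Complex.I * α) ^ 2 + g * (Complex.I * α)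
      + 4 * (w : ℂ)) / (((Complex.I * α) ^ 2 + 2 * g * (Complex.I * α) + 4 * (w : ℂ))
        * (Complex.I * α + g))).re := by
  have hN : (Complex.I * α) * ((Complex.I * α) ^ 2 + g * (Complex.I * α) + 4 * (w : ℂ))
      = ⟨-(g * α ^ 2), α * (4 * w - α ^ 2)⟩ := by
    rw [Complex.mk_eq_add_mul_I]
    push_cast
    linear_combination (Complex.I * α ^ 3 + g * α ^ 2) * Complex.I_sq
  have hD : ((Complex.I * α) ^ 2 + 2 * g * (Complex.I * α) + 4 * (w : ℂ)) * (Complex.I * α + g)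
      = ⟨g * (4 * w - α ^ 2) - 2 * g * α ^ 2, α * (4 * w - α ^ 2) + 2 * g ^ 2 * α⟩ := by
    rw [Complex.mk_eq_add_mul_I]
    push_cast
    linear_combination (Complex.I * α ^ 3 + 3 * g * α ^ 2) * Complex.I_sq
  rw [hN, hD, Complex.div_re, Complex.normSq_mk, ← add_div]
  set W := 4 * w - α ^ 2 with hW
  -- This is `4w > 0`, the only place where the pinning of the mode enters.
  have hW' : 0 < W + α ^ 2 := by rw [hW]; linarith
  have hfac : (g * W - 2 * g * α ^ 2) * (g * W - 2 * g * α ^ 2)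
      + (α * W + 2 * g ^ 2 * α) * (α * W + 2 * g ^ 2 * α)
      = (W ^ 2 + 4 * g ^ 2 * α ^ 2) * (g ^ 2 + α ^ 2) := by ring
  have hpos : 0 < W ^ 2 + 4 * g ^ 2 * α ^ 2 := by
    rcases eq_or_ne α 0 with rfl | h
    · have : 0 < W := by nlinarith
      positivity
    · positivity
  have hpos2 : 0 < g ^ 2 + α ^ 2 := by positivity
  rw [hfac, div_le_div_iff₀ (by positivity) (by positivity)]
  have hnum : -(g * α ^ 2) * (g * W - 2 * g * α ^ 2) + α * W * (α * W + 2 * g ^ 2 * α)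
      = α ^ 2 * (W ^ 2 + g ^ 2 * (W + α ^ 2) + g ^ 2 * α ^ 2) := by ring
  rw [hnum]
  have h1 : W ^ 2 + 4 * g ^ 2 * α ^ 2
      ≤ 4 * (W ^ 2 + g ^ 2 * (W + α ^ 2) + g ^ 2 * α ^ 2) := by
    nlinarith [mul_pos (pow_pos hg 2) hW', sq_nonneg W]
  calc α ^ 2 * ((W ^ 2 + 4 * g ^ 2 * α ^ 2) * (g ^ 2 + α ^ 2))
      = α ^ 2 * (g ^ 2 + α ^ 2) * (W ^ 2 + 4 * g ^ 2 * α ^ 2) := by ring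
    _ ≤ α ^ 2 * (g ^ 2 + α ^ 2) * (4 * (W ^ 2 + g ^ 2 * (W + α ^ 2) + g ^ 2 * α ^ 2)) := by
      gcongr
    _ = _ := by ring

theorem le_re_one_sub_kerLap_zero (hΦ : CouplingAssumption Φ ω₀) (hγ : NoiseAssumption Φ γ)
    (hL : 1 ≤ L) (α : ℝ) :
    α ^ 2 / (4 * (γ ^ 2 + α ^ 2)) ≤ 1 - (kerLap Φ γ L 0 (Complex.I * α)).re := by
  have hd : 0 < ω₀ ^ 2 / γ := div_pos (pow_pos hΦ.omega_pos 2) hγ.gamma_pos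
  have hL0 : (0 : ℝ) < L := by exact_mod_cast hL
  have h := congrArg Complex.re (one_sub_kerLap_zero hΦ hγ hL (z := Complex.I * α)
    (by simpa using hd))
  rw [Complex.sub_re, Complex.one_re] at h
  rw [h, show (1 / (L : ℂ)) = ((1 / (L : ℝ) : ℝ) : ℂ) by push_cast; rfl, Complex.re_ofReal_mul,
    Complex.re_sum]
  have hb : ∀ n ∈ lattice L, α ^ 2 / (4 * (γ ^ 2 + α ^ 2)) ≤ _ := fun n _ =>
    le_re_div_of_re (α := α) hγ.gamma_pos
      ((pow_pos hΦ.omega_pos 2).trans_le (hΦ.pinning ((n : ℝ) / L)))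
  have h2 := Finset.sum_le_sum hb
  rw [Finset.sum_const, card_lattice, nsmul_eq_mul] at h2
  calc _ = (1 / (L : ℝ)) * (L * (α ^ 2 / (4 * (γ ^ 2 + α ^ 2)))) := by field_simp
    _ ≤ _ := by gcongr

/-- On the positive axis every term of the explicit formula for `1 - p̂(x,0)` is positive. -/
theorem kerLap_zero_re_lt_one (hΦ : CouplingAssumption Φ ω₀) (hγ : NoiseAssumption Φ γ)
    (hL : 1 ≤ L) {x : ℝ} (hx : 0 < x) : (kerLap Φ γ L 0 (x : ℂ)).re < 1 := by
  have hd : 0 < ω₀ ^ 2 / γ := div_pos (pow_pos hΦ.omega_pos 2) hγ.gamma_pos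
  have hL0 : (0 : ℝ) < L := by exact_mod_cast hL
  have hg := hγ.gamma_pos
  have h := congrArg Complex.re (one_sub_kerLap_zero hΦ hγ hL (z := (x : ℂ))
    (by rw [Complex.ofReal_re]; linarith))
  rw [Complex.sub_re, Complex.one_re] at h
  have h2 : 0 < (1 / (L : ℝ)) * ∑ n ∈ lattice L,
      x * (x ^ 2 + γ * x + 4 * phiHat Φ ((n : ℝ) / L))
        / ((x ^ 2 + 2 * γ * x + 4 * phiHat Φ ((n : ℝ) / L)) * (x + γ)) := by
    apply mul_pos (by positivity)
    apply Finset.sum_pos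
    · intro n _
      have := (pow_pos hΦ.omega_pos 2).trans_le (hΦ.pinning ((n : ℝ) / L))
      positivity
    · exact ⟨0, mem_lattice.2 (by omega)⟩
  have h3 : ((1 / (L : ℝ)) * ∑ n ∈ lattice L,
      x * (x ^ 2 + γ * x + 4 * phiHat Φ ((n : ℝ) / L))
        / ((x ^ 2 + 2 * γ * x + 4 * phiHat Φ ((n : ℝ) / L)) * (x + γ)))
      = 1 - (kerLap Φ γ L 0 (x : ℂ)).re := by
    rw [h, ← Complex.ofReal_re ((1 / (L : ℝ)) * _)]
    congr 1
    push_cast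
    rfl
  linarith

theorem memKernel_nonneg (hγ : NoiseAssumption Φ γ) (s : ℝ) (y : ℤ) :
    0 ≤ memKernel Φ γ L s y := by
  have := hγ.gamma_pos
  rw [memKernel]
  positivity

theorem cosSum_zero (s : ℝ) : cosSum Φ γ L 0 s = ∑ y ∈ lattice L, memKernel Φ γ L s y := by
  simp [cosSum]

theorem abs_cosSum_le (hγ : NoiseAssumption Φ γ) (k s : ℝ) :
    |cosSum Φ γ L k s| ≤ cosSum Φ γ L 0 s := by
  rw [cosSum_zero, cosSum]
  refine (Finset.abs_sum_le_sum_abs _ _).trans (Finset.sum_le_sum fun y _ => ?_)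
  rw [abs_mul, abs_of_nonneg (memKernel_nonneg hγ s y)]
  exact mul_le_of_le_one_right (memKernel_nonneg hγ s y) (Real.abs_cos_le_one _)

theorem integrableOn_cosSum_cexp (hΦ : CouplingAssumption Φ ω₀) (hγ : NoiseAssumption Φ γ)
    (hL : 1 ≤ L) (m : ℤ) {z : ℂ} (hz : -(2 * (ω₀ ^ 2 / γ)) < z.re) :
    MeasureTheory.IntegrableOn (fun s : ℝ => (cosSum Φ γ L ((m : ℝ) / L) s : ℂ)
      * Complex.exp (-(s : ℂ) * z)) (Set.Ioi 0) ∧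
    ∫ s in Set.Ioi (0 : ℝ), (cosSum Φ γ L ((m : ℝ) / L) s : ℂ) * Complex.exp (-(s : ℂ) * z)
      = kerLap Φ γ L m z := by
  simp only [cosSum_eq hΦ hL]
  exact integrableOn_expSum_mul_cexp (le_kerM hΦ hγ m) hz

theorem integrableOn_exp_mul_cosSum (hΦ : CouplingAssumption Φ ω₀) (hγ : NoiseAssumption Φ γ)
    (hL : 1 ≤ L) (m : ℤ) {r : ℝ} (hr : r < 2 * (ω₀ ^ 2 / γ)) :
    MeasureTheory.IntegrableOn (fun s : ℝ => Real.exp (s * r) * cosSum Φ γ L ((m : ℝ) / L) s)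
      (Set.Ioi 0) ∧
    ((∫ s in Set.Ioi (0 : ℝ), Real.exp (s * r) * cosSum Φ γ L ((m : ℝ) / L) s : ℝ) : ℂ)
      = kerLap Φ γ L m (-(r : ℂ)) := by
  simp only [cosSum_eq hΦ hL]
  exact integrableOn_exp_mul_expSum (le_kerM hΦ hγ m) hr

theorem integrableOn_mul_exp_mul_cosSum (hΦ : CouplingAssumption Φ ω₀)
    (hγ : NoiseAssumption Φ γ) (hL : 1 ≤ L) (m : ℤ) {r : ℝ} (hr : r < 2 * (ω₀ ^ 2 / γ)) :
    MeasureTheory.IntegrableOn (fun s : ℝ => s * Real.exp (s * r)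
      * cosSum Φ γ L ((m : ℝ) / L) s) (Set.Ioi 0) ∧
    ((∫ s in Set.Ioi (0 : ℝ), s * Real.exp (s * r) * cosSum Φ γ L ((m : ℝ) / L) s : ℝ) : ℂ)
      = kerLapD Φ γ L m (-(r : ℂ)) := by
  simp only [cosSum_eq hΦ hL]
  exact integrableOn_mul_exp_mul_expSum (le_kerM hΦ hγ m) hr

/-- Nonnegativity of the kernel allows all phases, in time and in space, to be dropped. -/
theorem norm_kerLap_le (hΦ : CouplingAssumption Φ ω₀) (hγ : NoiseAssumption Φ γ) (hL : 1 ≤ L)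
    (m : ℤ) {z : ℂ} (hz : -(2 * (ω₀ ^ 2 / γ)) < z.re) :
    ‖kerLap Φ γ L m z‖ ≤ (kerLap Φ γ L 0 (z.re : ℂ)).re := by
  have hr : -z.re < 2 * (ω₀ ^ 2 / γ) := by linarith
  have h0 := integrableOn_exp_mul_cosSum hΦ hγ hL 0 hr
  have h1 : (kerLap Φ γ L 0 (z.re : ℂ)).re
      = ∫ s in Set.Ioi (0 : ℝ), Real.exp (s * -z.re) * cosSum Φ γ L (((0 : ℤ) : ℝ) / L) s := by
    have := congrArg Complex.re h0.2
    rw [Complex.ofReal_re] at this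
    rw [this]
    simp
  rw [h1, ← (integrableOn_cosSum_cexp hΦ hγ hL m hz).2]
  refine MeasureTheory.norm_integral_le_of_norm_le h0.1 (Filter.Eventually.of_forall fun s => ?_)
  rw [norm_mul, Complex.norm_exp, Complex.norm_real, Real.norm_eq_abs, mul_comm]
  have h2 : (-(s : ℂ) * z).re = s * -z.re := by simp
  rw [h2]
  gcongr
  simpa using abs_cosSum_le hγ ((m : ℝ) / L) s

/-- A general wave number is reduced to the explicit zero mode at the doubled frequency `2α`. -/
theorem le_re_one_sub_kerLap (hΦ : CouplingAssumption Φ ω₀) (hγ : NoiseAssumption Φ γ)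
    (hL : 1 ≤ L) (m : ℤ) (α : ℝ) :
    α ^ 2 / (4 * (γ ^ 2 + 4 * α ^ 2)) ≤ 1 - (kerLap Φ γ L m (Complex.I * α)).re := by
  have hd : 0 < ω₀ ^ 2 / γ := div_pos (pow_pos hΦ.omega_pos 2) hγ.gamma_pos
  have hre : ∀ (n : ℤ) (a : ℝ), MeasureTheory.IntegrableOn (fun s : ℝ =>
      cosSum Φ γ L ((n : ℝ) / L) s * Real.cos (s * a)) (Set.Ioi 0) ∧
      (kerLap Φ γ L n (Complex.I * a)).re
        = ∫ s in Set.Ioi (0 : ℝ), cosSum Φ γ L ((n : ℝ) / L) s * Real.cos (s * a) := by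
    intro n a
    have h := integrableOn_cosSum_cexp hΦ hγ hL n (z := Complex.I * a) (by simpa using hd)
    have he : ∀ s : ℝ, RCLike.re ((cosSum Φ γ L ((n : ℝ) / L) s : ℂ)
        * Complex.exp (-(s : ℂ) * (Complex.I * a)))
        = cosSum Φ γ L ((n : ℝ) / L) s * Real.cos (s * a) := by
      intro s
      rw [RCLike.re_to_complex, Complex.re_ofReal_mul,
        show -(s : ℂ) * (Complex.I * a) = ((-(s * a) : ℝ) : ℂ) * Complex.I by push_cast; ring,
        Complex.exp_ofReal_mul_I_re, Real.cos_neg]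
    have h1 := h.1.re
    simp only [he] at h1
    refine ⟨h1, ?_⟩
    rw [← h.2]
    have h2 := integral_re h.1
    simp only [he] at h2
    exact h2.symm
  have h0 := integrableOn_exp_mul_cosSum hΦ hγ hL 0 (r := 0) (by positivity)
  simp only [mul_zero, Real.exp_zero, one_mul, Complex.ofReal_zero, neg_zero] at h0
  rw [kerLap_zero_zero hΦ hγ hL] at h0
  have h0' : ∫ s in Set.Ioi (0 : ℝ), cosSum Φ γ L (((0 : ℤ) : ℝ) / L) s = 1 := by
    exact_mod_cast h0.2
  have hz := hre 0 (2 * α)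
  have hm := hre m α
  -- With `x = cos(sα)`, `|x| ≤ (1 + x²)/2 = 3/4 + cos(2sα)/4`, while the spatial sum is at most the
  -- total mass `S`, whose time integral is one.
  have hle : (kerLap Φ γ L m (Complex.I * α)).re
      ≤ 3 / 4 + 1 / 4 * (kerLap Φ γ L 0 (Complex.I * ((2 * α : ℝ) : ℂ))).re := by
    rw [hm.2, hz.2]
    have e : 3 / 4 + 1 / 4 * ∫ s in Set.Ioi (0 : ℝ), cosSum Φ γ L (((0 : ℤ) : ℝ) / L) s
        * Real.cos (s * (2 * α))
        = ∫ s in Set.Ioi (0 : ℝ), (3 / 4 * cosSum Φ γ L (((0 : ℤ) : ℝ) / L) s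
          + 1 / 4 * (cosSum Φ γ L (((0 : ℤ) : ℝ) / L) s * Real.cos (s * (2 * α)))) := by
      rw [MeasureTheory.integral_add (h0.1.const_mul _) (hz.1.const_mul _),
        MeasureTheory.integral_const_mul, MeasureTheory.integral_const_mul, h0', mul_one]
    rw [e]
    refine MeasureTheory.integral_mono hm.1 ((h0.1.const_mul _).add (hz.1.const_mul _)) fun s => ?_
    have ha := abs_cosSum_le (L := L) hγ ((m : ℝ) / L) s
    have hc : Real.cos (s * (2 * α)) = 2 * Real.cos (s * α) ^ 2 - 1 := by
      rw [← Real.cos_two_mul]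
      congr 1
      ring
    have hcos := Real.abs_cos_le_one (s * α)
    have hn := (abs_nonneg _).trans ha
    simp only [Int.cast_zero, zero_div]
    rw [hc]
    set S := cosSum Φ γ L 0 s
    set x := Real.cos (s * α)
    calc cosSum Φ γ L ((m : ℝ) / L) s * x ≤ |cosSum Φ γ L ((m : ℝ) / L) s * x| := le_abs_self _
      _ ≤ S * |x| := by
        rw [abs_mul]
        gcongr
      _ ≤ S * (3 / 4 + 1 / 4 * (2 * x ^ 2 - 1)) := by
        gcongr
        rw [← sq_abs x]
        nlinarith [sq_nonneg (|x| - 1)]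
      _ = _ := by ring
  have hq := le_re_one_sub_kerLap_zero hΦ hγ hL (2 * α)
  have hg := hγ.gamma_pos
  have e2 : (2 * α) ^ 2 / (4 * (γ ^ 2 + (2 * α) ^ 2)) = 4 * (α ^ 2 / (4 * (γ ^ 2 + 4 * α ^ 2))) := by
    rw [← mul_div_assoc]
    congr 1 <;> ring
  rw [e2] at hq
  linarith

end
end VelocityFlip
end

/-! ### Spatial moments of the kernel and two-sided bounds on `D̂`. -/

noncomputable section
namespace VelocityFlip
open Finset

theorem integral_exp_neg_mul_Ioi_zero {a : ℝ} (ha : 0 < a) :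
    MeasureTheory.IntegrableOn (fun s : ℝ => Real.exp (-a * s)) (Set.Ioi 0) ∧
    ∫ s in Set.Ioi (0 : ℝ), Real.exp (-a * s) = 1 / a := by
  have ha' : -a < 0 := by linarith
  refine ⟨integrableOn_exp_mul_Ioi ha' 0, ?_⟩
  rw [integral_exp_mul_Ioi ha', mul_zero, Real.exp_zero, neg_div_neg_eq]

theorem one_sub_cos_le (x : ℝ) : 1 - Real.cos x ≤ x ^ 2 / 2 := by
  linarith [Real.one_sub_sq_div_two_le_cos (x := x)]

/-- Beyond `|x| = π` the left side is nonpositive, so the quartic correction makes the quadratic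
lower bound global. It costs a fourth moment. -/
theorem le_one_sub_cos (x : ℝ) :
    2 / Real.pi ^ 2 * (x ^ 2 - x ^ 4 / Real.pi ^ 2) ≤ 1 - Real.cos x := by
  have hpi := Real.pi_pos
  by_cases h : |x| ≤ Real.pi
  · have h1 := Real.cos_le_one_sub_mul_cos_sq h
    have h2 : 2 / Real.pi ^ 2 * (x ^ 2 - x ^ 4 / Real.pi ^ 2) ≤ 2 / Real.pi ^ 2 * x ^ 2 := by
      gcongr
      linarith [(by positivity : 0 ≤ x ^ 4 / Real.pi ^ 2)]
    linarith
  · have h1 : Real.pi ^ 2 ≤ x ^ 2 := by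
      rw [← sq_abs x]
      have := (not_le.1 h).le
      gcongr
    have h2 : x ^ 2 - x ^ 4 / Real.pi ^ 2 ≤ 0 := by
      rw [sub_nonpos, le_div_iff₀ (by positivity)]
      nlinarith [sq_nonneg x]
    have h3 : 2 / Real.pi ^ 2 * (x ^ 2 - x ^ 4 / Real.pi ^ 2) ≤ 0 :=
      mul_nonpos_of_nonneg_of_nonpos (by positivity) h2
    linarith [Real.cos_le_one x]

/-- Comparison of the integral over a period with a Riemann sum. -/
theorem integral_period_le_sum {G : ℝ → ℝ} {B : ℝ} (hp : ∀ k, G (k + 1) = G k)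
    (hG : ∀ k l, |G k - G l| ≤ B * |k - l|) (hc : Continuous G) {L : ℕ} (hL : 1 ≤ L) (a : ℝ) :
    ∫ k in a..(a + 1), G k ≤ (1 / (L : ℝ)) * ∑ n ∈ lattice L, G ((n : ℝ) / L) + B / L := by
  have hL0 : (0 : ℝ) < L := by exact_mod_cast hL
  have hB : 0 ≤ B := by
    have := (abs_nonneg _).trans (hG 1 0)
    simpa using this
  rw [Function.Periodic.intervalIntegral_add_eq (f := G) (T := 1) hp a 0, zero_add,
    sum_lattice_eq_sum_range (g := fun n : ℤ => G ((n : ℝ) / L))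
      (fun n => periodic_div_add hp hL n)]
  have h1 := intervalIntegral.sum_integral_adjacent_intervals (f := G)
    (μ := MeasureTheory.volume) (a := fun i : ℕ => (i : ℝ) / L) (n := L)
    (fun i _ => hc.intervalIntegrable _ _)
  simp only [Nat.cast_zero, zero_div, div_self hL0.ne'] at h1
  rw [← h1]
  have h2 : ∀ i ∈ range L, ∫ k in ((i : ℝ) / L)..(((i + 1 : ℕ) : ℝ) / L), G k
      ≤ (1 / (L : ℝ)) * (G ((i : ℝ) / L) + B / L) := by
    intro i _
    have hlen : ((i + 1 : ℕ) : ℝ) / L - (i : ℝ) / L = 1 / L := by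
      push_cast
      ring
    have hle : (i : ℝ) / L ≤ ((i + 1 : ℕ) : ℝ) / L := by
      have : 0 < 1 / (L : ℝ) := by positivity
      linarith
    have h3 := intervalIntegral.integral_mono_on (μ := MeasureTheory.volume) hle
      (hc.intervalIntegrable _ _)
      (continuous_const (y := G ((i : ℝ) / L) + B / L) |>.intervalIntegrable _ _)
      (fun k hk => by
        have h4 := (le_abs_self _).trans (hG k ((i : ℝ) / L))
        have h5 : |k - (i : ℝ) / L| ≤ 1 / L := by
          rw [abs_of_nonneg (by linarith [hk.1])]
          linarith [hk.2]
        have h6 : B * |k - (i : ℝ) / L| ≤ B * (1 / L) := by gcongr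
        have h7 : B * (1 / (L : ℝ)) = B / L := by ring
        show G k ≤ G ((i : ℝ) / L) + B / L
        linarith)
    rwa [intervalIntegral.integral_const, hlen, smul_eq_mul] at h3
  refine (Finset.sum_le_sum h2).trans (le_of_eq ?_)
  rw [← Finset.mul_sum, Finset.sum_add_distrib, Finset.sum_const, Finset.card_range,
    nsmul_eq_mul]
  simp only [Int.cast_natCast]
  field_simp

section
variable {Φ : ℤ → ℝ} {ω₀ γ : ℝ} {L : ℕ}

theorem continuous_A2hat (k : ℝ) : Continuous fun t => A2hat Φ γ t k := by
  unfold A2hat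
  fun_prop

theorem continuous_memKernel (y : ℤ) : Continuous fun s => memKernel Φ γ L s y := by
  have h := fun k => continuous_A2hat (Φ := Φ) (γ := γ) k
  unfold memKernel dualInt
  fun_prop

theorem memKernel_le (hγ : NoiseAssumption Φ γ) {d K : ℝ}
    (hK : SmoothDecay (A2hat Φ γ) (d / 2) K) (hL : 1 ≤ L) {s : ℝ} (hs : 0 ≤ s) (y : ℤ) :
    memKernel Φ γ L s y ≤ 2 * γ * K ^ 2 * Real.exp (-d * s) := by
  have hL0 : (0 : ℝ) < L := by exact_mod_cast hL
  have hg := hγ.gamma_pos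
  have h1 : ‖dualInt L fun k => wave (-k) y * (A2hat Φ γ s k : ℂ)‖
      ≤ K * Real.exp (-(d / 2) * s) := by
    rw [dualInt, norm_mul, norm_div, norm_one, Complex.norm_natCast]
    have h2 : ‖∑ n ∈ lattice L, wave (-((n : ℝ) / L)) y * (A2hat Φ γ s ((n : ℝ) / L) : ℂ)‖
        ≤ ∑ n ∈ lattice L, K * Real.exp (-(d / 2) * s) := by
      refine norm_sum_le_of_le _ fun n _ => ?_
      rw [norm_mul, norm_wave, one_mul, Complex.norm_real]
      exact hK.bound s _ hs
    rw [Finset.sum_const, card_lattice, nsmul_eq_mul] at h2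
    calc _ ≤ 1 / (L : ℝ) * (L * (K * Real.exp (-(d / 2) * s))) := by gcongr
      _ = _ := by field_simp
  have h3 := (Complex.abs_re_le_norm _).trans h1
  have h4 := pow_le_pow_left₀ (abs_nonneg _) h3 2
  rw [sq_abs] at h4
  rw [memKernel]
  calc _ ≤ 2 * γ * (K * Real.exp (-(d / 2) * s)) ^ 2 := by gcongr
    _ = _ := by
      rw [mul_pow, ← Real.exp_nat_mul]
      rw [show ((2 : ℕ) : ℝ) * (-(d / 2) * s) = -d * s by push_cast; ring]
      ring

theorem sum_pow_four_memKernel_le (hΦ : CouplingAssumption Φ ω₀) (hγ : NoiseAssumption Φ γ)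
    {d K : ℝ} (hK : SmoothDecay (A2hat Φ γ) (d / 2) K) (hL : 1 ≤ L) {s : ℝ} (hs : 0 ≤ s) :
    ∑ y ∈ lattice L, (y : ℝ) ^ 4 * memKernel Φ γ L s y ≤ 2 * γ * K ^ 2 * Real.exp (-d * s) := by
  have hg := hγ.gamma_pos
  have h := sum_pow_four_mul_sq_le (A2hat_periodic (γ := γ) hΦ s) (A2hat_even hΦ s)
    (fun k h => hK.second s k h hs) hL
  calc _ = 2 * γ * ∑ y ∈ lattice L, (y : ℝ) ^ 4
        * (dualInt L fun k => wave (-k) y * (A2hat Φ γ s k : ℂ)).re ^ 2 := by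
        rw [Finset.mul_sum]
        refine Finset.sum_congr rfl fun y _ => ?_
        rw [memKernel]
        ring
    _ ≤ 2 * γ * (K * Real.exp (-(d / 2) * s)) ^ 2 := by gcongr
    _ = _ := by
      rw [mul_pow, ← Real.exp_nat_mul]
      rw [show ((2 : ℕ) : ℝ) * (-(d / 2) * s) = -d * s by push_cast; ring]
      ring

theorem sum_sq_memKernel_le (hΦ : CouplingAssumption Φ ω₀) (hγ : NoiseAssumption Φ γ)
    {d K : ℝ} (hK : SmoothDecay (A2hat Φ γ) (d / 2) K) (hL : 1 ≤ L) {s : ℝ} (hs : 0 ≤ s) :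
    ∑ y ∈ lattice L, (y : ℝ) ^ 2 * memKernel Φ γ L s y ≤ 2 * γ * K ^ 2 * Real.exp (-d * s) := by
  refine le_trans (Finset.sum_le_sum fun y _ => ?_) (sum_pow_four_memKernel_le hΦ hγ hK hL hs)
  have := memKernel_nonneg (L := L) hγ s y
  gcongr ?_ * _
  have h : y ^ 2 ≤ y ^ 4 := by
    rcases eq_or_ne y 0 with rfl | h
    · simp
    · have : 1 ≤ y ^ 2 := by have := sq_pos_of_ne_zero h; omega
      nlinarith
  exact_mod_cast h

theorem integrableOn_memKernel (hγ : NoiseAssumption Φ γ) {d K : ℝ} (hd : 0 < d)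
    (hK : SmoothDecay (A2hat Φ γ) (d / 2) K) (hL : 1 ≤ L) (y : ℤ) :
    MeasureTheory.IntegrableOn (fun s => memKernel Φ γ L s y) (Set.Ioi 0) := by
  refine MeasureTheory.Integrable.mono'
    ((integral_exp_neg_mul_Ioi_zero hd).1.const_mul (2 * γ * K ^ 2))
    (continuous_memKernel y).aestronglyMeasurable ?_
  filter_upwards [MeasureTheory.ae_restrict_mem measurableSet_Ioi] with s hs
  rw [Real.norm_eq_abs, abs_of_nonneg (memKernel_nonneg hγ s y)]
  exact memKernel_le hγ hK hL (le_of_lt hs) y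

theorem integral_sum_mul_memKernel (hγ : NoiseAssumption Φ γ) {d K : ℝ} (hd : 0 < d)
    (hK : SmoothDecay (A2hat Φ γ) (d / 2) K) (hL : 1 ≤ L) (w : ℤ → ℝ) :
    MeasureTheory.IntegrableOn (fun s => ∑ y ∈ lattice L, w y * memKernel Φ γ L s y)
      (Set.Ioi 0) ∧
    ∫ s in Set.Ioi (0 : ℝ), ∑ y ∈ lattice L, w y * memKernel Φ γ L s y
      = ∑ y ∈ lattice L, w y * ∫ s in Set.Ioi (0 : ℝ), memKernel Φ γ L s y := by
  have h : ∀ y ∈ lattice L, MeasureTheory.IntegrableOn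
      (fun s => w y * memKernel Φ γ L s y) (Set.Ioi 0) :=
    fun y _ => (integrableOn_memKernel hγ hd hK hL y).const_mul _
  refine ⟨MeasureTheory.integrable_finsetSum _ h, ?_⟩
  rw [MeasureTheory.integral_finsetSum _ h]
  exact Finset.sum_congr rfl fun y _ => MeasureTheory.integral_const_mul _ _

theorem Dhat_eq (hγ : NoiseAssumption Φ γ) {d K : ℝ} (hd : 0 < d)
    (hK : SmoothDecay (A2hat Φ γ) (d / 2) K) (hL : 1 ≤ L) (k : ℝ) :
    Dhat Φ γ L k = γ * ∫ s in Set.Ioi (0 : ℝ), (cosSum Φ γ L 0 s - cosSum Φ γ L k s) := by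
  rw [Dhat, ← (integral_sum_mul_memKernel hγ hd hK hL _).2]
  congr 2
  funext s
  rw [cosSum_zero, cosSum, ← Finset.sum_sub_distrib]
  refine Finset.sum_congr rfl fun y _ => ?_
  ring

/-- The link between the root problem and `D̂`: the defect `1 - p̂(0,k)` is exactly `D̂(k)/γ`. -/
theorem kerLap_at_zero (hΦ : CouplingAssumption Φ ω₀) (hγ : NoiseAssumption Φ γ) {K : ℝ}
    (hK : SmoothDecay (A2hat Φ γ) (ω₀ ^ 2 / γ / 2) K) (hL : 1 ≤ L) (m : ℤ) :
    kerLap Φ γ L m 0 = ((1 - Dhat Φ γ L ((m : ℝ) / L) / γ : ℝ) : ℂ) := by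
  have hd : 0 < ω₀ ^ 2 / γ := div_pos (pow_pos hΦ.omega_pos 2) hγ.gamma_pos
  have h0 := integrableOn_exp_mul_cosSum hΦ hγ hL 0 (r := 0) (by positivity)
  have hm := integrableOn_exp_mul_cosSum hΦ hγ hL m (r := 0) (by positivity)
  simp only [mul_zero, Real.exp_zero, one_mul, Complex.ofReal_zero, neg_zero, Int.cast_zero,
    zero_div] at h0 hm
  rw [kerLap_zero_zero hΦ hγ hL] at h0
  have h0' : ∫ s in Set.Ioi (0 : ℝ), cosSum Φ γ L 0 s = 1 := by exact_mod_cast h0.2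
  rw [← hm.2, Dhat_eq hγ hd hK hL, MeasureTheory.integral_sub h0.1 hm.1, h0']
  congr 1
  have := hγ.gamma_pos
  field_simp
  ring

theorem cosSum_zero_sub_le (hΦ : CouplingAssumption Φ ω₀) (hγ : NoiseAssumption Φ γ) {d K : ℝ}
    (hK : SmoothDecay (A2hat Φ γ) (d / 2) K) (hL : 1 ≤ L) (k : ℝ) {s : ℝ} (hs : 0 ≤ s) :
    cosSum Φ γ L 0 s - cosSum Φ γ L k s
      ≤ 2 * Real.pi ^ 2 * k ^ 2 * (2 * γ * K ^ 2 * Real.exp (-d * s)) := by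
  have h := sum_sq_memKernel_le hΦ hγ hK hL hs
  calc _ ≤ 2 * Real.pi ^ 2 * k ^ 2 * ∑ y ∈ lattice L, (y : ℝ) ^ 2 * memKernel Φ γ L s y := by
        rw [cosSum_zero, cosSum, ← Finset.sum_sub_distrib, Finset.mul_sum]
        refine Finset.sum_le_sum fun y _ => ?_
        have h1 := mul_le_mul_of_nonneg_left (one_sub_cos_le (2 * Real.pi * k * y))
          (memKernel_nonneg (L := L) hγ s y)
        calc _ = memKernel Φ γ L s y * (1 - Real.cos (2 * Real.pi * k * y)) := by ring
          _ ≤ _ := h1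
          _ = _ := by ring
    _ ≤ _ := by gcongr

theorem Dhat_le_secondMoment (hγ : NoiseAssumption Φ γ) {d K : ℝ} (hd : 0 < d)
    (hK : SmoothDecay (A2hat Φ γ) (d / 2) K) (hL : 1 ≤ L) (k : ℝ) :
    Dhat Φ γ L k ≤ γ * (2 * Real.pi ^ 2 * k ^ 2 *
      ∫ s in Set.Ioi (0 : ℝ), ∑ y ∈ lattice L, (y : ℝ) ^ 2 * memKernel Φ γ L s y) := by
  have hg := hγ.gamma_pos
  rw [Dhat, (integral_sum_mul_memKernel hγ hd hK hL _).2, Finset.mul_sum (lattice L) _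
    (2 * Real.pi ^ 2 * k ^ 2)]
  refine mul_le_mul_of_nonneg_left (Finset.sum_le_sum fun y _ => ?_) hg.le
  have h1 : 0 ≤ ∫ s in Set.Ioi (0 : ℝ), memKernel Φ γ L s y :=
    MeasureTheory.integral_nonneg fun s => memKernel_nonneg hγ s y
  rw [← mul_assoc]
  refine mul_le_mul_of_nonneg_right ?_ h1
  refine (one_sub_cos_le _).trans (le_of_eq ?_)
  ring

theorem integral_secondMoment_le (hΦ : CouplingAssumption Φ ω₀) (hγ : NoiseAssumption Φ γ)
    {d K : ℝ} (hd : 0 < d) (hK : SmoothDecay (A2hat Φ γ) (d / 2) K) (hL : 1 ≤ L) :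
    ∫ s in Set.Ioi (0 : ℝ), ∑ y ∈ lattice L, (y : ℝ) ^ 2 * memKernel Φ γ L s y
      ≤ 2 * γ * K ^ 2 / d := by
  have he := integral_exp_neg_mul_Ioi_zero hd
  calc _ ≤ ∫ s in Set.Ioi (0 : ℝ), 2 * γ * K ^ 2 * Real.exp (-d * s) := by
        refine MeasureTheory.setIntegral_mono_on (integral_sum_mul_memKernel hγ hd hK hL _).1
          (he.1.const_mul _) measurableSet_Ioi fun s hs => ?_
        exact sum_sq_memKernel_le hΦ hγ hK hL (le_of_lt hs)
    _ = _ := by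
        rw [MeasureTheory.integral_const_mul, he.2, mul_one_div]

theorem integral_fourthMoment_le (hΦ : CouplingAssumption Φ ω₀) (hγ : NoiseAssumption Φ γ)
    {d K : ℝ} (hd : 0 < d) (hK : SmoothDecay (A2hat Φ γ) (d / 2) K) (hL : 1 ≤ L) :
    ∫ s in Set.Ioi (0 : ℝ), ∑ y ∈ lattice L, (y : ℝ) ^ 4 * memKernel Φ γ L s y
      ≤ 2 * γ * K ^ 2 / d := by
  have he := integral_exp_neg_mul_Ioi_zero hd
  calc _ ≤ ∫ s in Set.Ioi (0 : ℝ), 2 * γ * K ^ 2 * Real.exp (-d * s) := by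
        refine MeasureTheory.setIntegral_mono_on (integral_sum_mul_memKernel hγ hd hK hL _).1
          (he.1.const_mul _) measurableSet_Ioi fun s hs => ?_
        exact sum_pow_four_memKernel_le hΦ hγ hK hL (le_of_lt hs)
    _ = _ := by
        rw [MeasureTheory.integral_const_mul, he.2, mul_one_div]

theorem Dhat_le (hΦ : CouplingAssumption Φ ω₀) (hγ : NoiseAssumption Φ γ) {d K : ℝ} (hd : 0 < d)
    (hK : SmoothDecay (A2hat Φ γ) (d / 2) K) (hL : 1 ≤ L) (k : ℝ) :
    Dhat Φ γ L k ≤ γ * (2 * Real.pi ^ 2 * k ^ 2 * (2 * γ * K ^ 2 / d)) := by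
  have hg := hγ.gamma_pos
  refine (Dhat_le_secondMoment hγ hd hK hL k).trans ?_
  have := integral_secondMoment_le hΦ hγ hd hK hL
  gcongr

theorem Dhat_nonneg (hγ : NoiseAssumption Φ γ) (k : ℝ) : 0 ≤ Dhat Φ γ L k := by
  have hg := hγ.gamma_pos
  refine mul_nonneg hg.le (Finset.sum_nonneg fun y _ => mul_nonneg ?_ ?_)
  · linarith [Real.cos_le_one (2 * Real.pi * k * y)]
  · exact MeasureTheory.integral_nonneg fun s => memKernel_nonneg hγ s y

theorem le_Dhat (hΦ : CouplingAssumption Φ ω₀) (hγ : NoiseAssumption Φ γ) {d K : ℝ} (hd : 0 < d)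
    (hK : SmoothDecay (A2hat Φ γ) (d / 2) K) (hL : 1 ≤ L) (k : ℝ) :
    γ * (8 * k ^ 2 * (∫ s in Set.Ioi (0 : ℝ), ∑ y ∈ lattice L, (y : ℝ) ^ 2 * memKernel Φ γ L s y)
      - 32 * k ^ 4 * (2 * γ * K ^ 2 / d)) ≤ Dhat Φ γ L k := by
  have hg := hγ.gamma_pos
  have h4 := integral_fourthMoment_le hΦ hγ hd hK hL
  have hpi : Real.pi ≠ 0 := Real.pi_ne_zero
  calc _ ≤ γ * (8 * k ^ 2 * (∫ s in Set.Ioi (0 : ℝ),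
        ∑ y ∈ lattice L, (y : ℝ) ^ 2 * memKernel Φ γ L s y)
        - 32 * k ^ 4 * ∫ s in Set.Ioi (0 : ℝ),
          ∑ y ∈ lattice L, (y : ℝ) ^ 4 * memKernel Φ γ L s y) := by gcongr
    _ ≤ _ := by
      rw [Dhat, (integral_sum_mul_memKernel hγ hd hK hL _).2,
        (integral_sum_mul_memKernel hγ hd hK hL _).2, Finset.mul_sum (lattice L) _ (8 * k ^ 2),
        Finset.mul_sum (lattice L) _ (32 * k ^ 4), ← Finset.sum_sub_distrib]
      refine mul_le_mul_of_nonneg_left (Finset.sum_le_sum fun y _ => ?_) hg.le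
      have h1 : 0 ≤ ∫ s in Set.Ioi (0 : ℝ), memKernel Φ γ L s y :=
        MeasureTheory.integral_nonneg fun s => memKernel_nonneg hγ s y
      rw [← mul_assoc, ← mul_assoc, ← sub_mul]
      refine mul_le_mul_of_nonneg_right ?_ h1
      refine le_trans (le_of_eq ?_) (le_one_sub_cos _)
      field_simp
      ring

/-- The slope at wave number `k` differs from the exact value `1/γ` of the zero mode by `O(k²)`,
through `1 - cos x ≤ x²/2` and the second moment. -/
theorem norm_kerLapD_sub_le (hΦ : CouplingAssumption Φ ω₀) (hγ : NoiseAssumption Φ γ) {K : ℝ}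
    (hK : SmoothDecay (A2hat Φ γ) (ω₀ ^ 2 / γ / 2) K) (hL : 1 ≤ L) (m : ℤ) :
    ‖kerLapD Φ γ L m 0 - 1 / γ‖
      ≤ 2 * Real.pi ^ 2 * ((m : ℝ) / L) ^ 2 * (2 * γ * K ^ 2 / (ω₀ ^ 2 / γ) ^ 2) := by
  have hd : 0 < ω₀ ^ 2 / γ := div_pos (pow_pos hΦ.omega_pos 2) hγ.gamma_pos
  set d := ω₀ ^ 2 / γ with hd'
  have h0 := integrableOn_mul_exp_mul_cosSum hΦ hγ hL 0 (r := 0) (by positivity)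
  have hm := integrableOn_mul_exp_mul_cosSum hΦ hγ hL m (r := 0) (by positivity)
  simp only [mul_zero, Real.exp_zero, mul_one, Complex.ofReal_zero, neg_zero, Int.cast_zero,
    zero_div] at h0 hm
  rw [← kerLapD_zero_zero hΦ hγ hL, ← h0.2, ← hm.2, ← Complex.ofReal_sub, Complex.norm_real,
    Real.norm_eq_abs, abs_sub_comm, ← MeasureTheory.integral_sub h0.1 hm.1]
  have he := integral_mul_exp_neg_mul_Ioi hd
  have hnn : ∀ s ∈ Set.Ioi (0 : ℝ),
      0 ≤ s * cosSum Φ γ L 0 s - s * cosSum Φ γ L ((m : ℝ) / L) s := by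
    intro s hs
    rw [← mul_sub]
    refine mul_nonneg (le_of_lt hs) ?_
    linarith [(le_abs_self _).trans (abs_cosSum_le (L := L) hγ ((m : ℝ) / L) s)]
  rw [abs_of_nonneg (MeasureTheory.setIntegral_nonneg measurableSet_Ioi hnn)]
  calc _ ≤ ∫ s in Set.Ioi (0 : ℝ), 2 * Real.pi ^ 2 * ((m : ℝ) / L) ^ 2 * (2 * γ * K ^ 2)
        * (s * Real.exp (-d * s)) := by
        refine MeasureTheory.setIntegral_mono_on (h0.1.sub hm.1) (he.1.const_mul _)
          measurableSet_Ioi fun s hs => ?_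
        have h1 := mul_le_mul_of_nonneg_left
          (cosSum_zero_sub_le hΦ hγ hK hL ((m : ℝ) / L) (le_of_lt hs)) (le_of_lt hs : 0 ≤ s)
        calc _ = s * (cosSum Φ γ L 0 s - cosSum Φ γ L ((m : ℝ) / L) s) := by ring
          _ ≤ _ := h1
          _ = _ := by ring
    _ = _ := by
        rw [MeasureTheory.integral_const_mul, he.2]
        ring

theorem cosSum_zero_sub_eq (hΦ : CouplingAssumption Φ ω₀) (hL : 1 ≤ L) (m : ℤ) (s : ℝ) :
    cosSum Φ γ L 0 s - cosSum Φ γ L ((m : ℝ) / L) s = γ * ((1 / (L : ℝ)) * ∑ n ∈ lattice L,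
      (A2hat Φ γ s ((n : ℝ) / L + (m : ℝ) / L) - A2hat Φ γ s ((n : ℝ) / L)) ^ 2) := by
  have h0 := cosSum_eq (γ := γ) hΦ hL 0 s
  rw [Int.cast_zero, zero_div] at h0
  rw [h0, cosSum_eq hΦ hL, expSum_ker, expSum_ker]
  simp only [add_zero]
  set A := A2hat Φ γ s
  have hs := sum_lattice_add (L := L) (g := fun n : ℤ => A ((n : ℝ) / L) * A ((n : ℝ) / L))
    (fun n => by simp only [A, periodic_div_add (A2hat_periodic (γ := γ) hΦ s) hL]) m
  have he : ∑ n ∈ lattice L, (A ((n : ℝ) / L + (m : ℝ) / L) - A ((n : ℝ) / L)) ^ 2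
      = ∑ n ∈ lattice L, A (((n + m : ℤ) : ℝ) / L) * A (((n + m : ℤ) : ℝ) / L)
        + ∑ n ∈ lattice L, A ((n : ℝ) / L) * A ((n : ℝ) / L)
        - 2 * ∑ n ∈ lattice L, A ((n : ℝ) / L) * A (((n + m : ℤ) : ℝ) / L) := by
    rw [Finset.mul_sum, ← Finset.sum_add_distrib, ← Finset.sum_sub_distrib]
    refine Finset.sum_congr rfl fun n _ => ?_
    rw [show (n : ℝ) / L + (m : ℝ) / L = ((n + m : ℤ) : ℝ) / L by push_cast; ring]
    ring
  rw [he, hs]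
  ring

/-- The loss of mass at wave number `k₀` is `γ` times a Riemann sum for the integrand of the
nondegeneracy assumption, with error `O(e^{-ds}/L)`. Large `L` therefore keeps half of the constant
`C`. -/
theorem exists_le_Dhat (hΦ : CouplingAssumption Φ ω₀) (hγ : NoiseAssumption Φ γ) {ε : ℝ}
    (hε : 0 < ε) : ∃ (c : ℝ) (L₀ : ℕ), 0 < c ∧ ∀ L : ℕ, L₀ ≤ L → 1 ≤ L → ∀ m : ℤ,
      ε ≤ |(m : ℝ) / L| → |(m : ℝ) / L| ≤ 1 / 2 → c ≤ Dhat Φ γ L ((m : ℝ) / L) := by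
  obtain ⟨C, hC, hnd⟩ := hγ.nondegenerate ε hε
  obtain ⟨K, hK⟩ := smoothDecay_A2hat hΦ hγ
  have hg := hγ.gamma_pos
  have hd : 0 < ω₀ ^ 2 / γ := div_pos (pow_pos hΦ.omega_pos 2) hγ.gamma_pos
  set d := ω₀ ^ 2 / γ with hd'
  -- The Riemann sum error integrates over time to `8K²/(dL)`, which must not exceed `C/2`.
  obtain ⟨L₀, hL₀⟩ := exists_nat_ge (16 * K ^ 2 / (d * C))
  refine ⟨γ ^ 2 * C / 2, L₀, by positivity, ?_⟩
  intro L hLL hL m hm1 hm2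
  have hL0 : (0 : ℝ) < L := by exact_mod_cast hL
  set k₀ : ℝ := (m : ℝ) / L with hk₀
  have h0 := integrableOn_exp_mul_cosSum hΦ hγ hL 0 (r := 0) (by positivity)
  have hm := integrableOn_exp_mul_cosSum hΦ hγ hL m (r := 0) (by positivity)
  simp only [mul_zero, Real.exp_zero, one_mul, Complex.ofReal_zero, neg_zero, Int.cast_zero,
    zero_div] at h0 hm
  have he := integral_exp_neg_mul_Ioi_zero hd
  have hsub : MeasureTheory.IntegrableOn (fun s => cosSum Φ γ L 0 s - cosSum Φ γ L k₀ s)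
      (Set.Ioi 0) := h0.1.sub hm.1
  have hinner : ∀ s ∈ Set.Ioi (0 : ℝ), ∫ k in (-(1 / 2) : ℝ)..(1 / 2),
      (A2hat Φ γ s (k + k₀ / 2) - A2hat Φ γ s (k - k₀ / 2)) ^ 2
      ≤ 1 / γ * (cosSum Φ γ L 0 s - cosSum Φ γ L k₀ s)
        + 8 * K ^ 2 / L * Real.exp (-d * s) := by
    intro s hs
    have hs0 : 0 ≤ s := le_of_lt hs
    set A := A2hat Φ γ s with hA
    set e := K * Real.exp (-(d / 2) * s) with he'
    have hee : e ^ 2 = K ^ 2 * Real.exp (-d * s) := by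
      rw [he', mul_pow, ← Real.exp_nat_mul]
      congr 2
      push_cast
      ring
    set G : ℝ → ℝ := fun k => (A (k + k₀) - A k) ^ 2 with hG
    have hp : ∀ k, G (k + 1) = G k := by
      intro k
      simp only [hG, hA]
      rw [A2hat_periodic hΦ, show k + 1 + k₀ = k + k₀ + 1 by ring, A2hat_periodic hΦ]
    have hlip : ∀ k l, |G k - G l| ≤ 8 * e ^ 2 * |k - l| := by
      intro k l
      have hfac : G k - G l = (A (k + k₀) - A (l + k₀) - (A k - A l))
          * (A (k + k₀) - A k + (A (l + k₀) - A l)) := by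
        simp only [hG]
        ring
      have b1 := hK.lipschitz s (k + k₀) (l + k₀) hs0
      have b2 := hK.lipschitz s k l hs0
      rw [add_sub_add_right_eq_sub] at b1
      have b3 := hK.bound s (k + k₀) hs0
      have b4 := hK.bound s k hs0
      have b5 := hK.bound s (l + k₀) hs0
      have b6 := hK.bound s l hs0
      have hen : 0 ≤ e := (abs_nonneg _).trans b4
      rw [hfac, abs_mul]
      have c1 : |A (k + k₀) - A (l + k₀) - (A k - A l)| ≤ 2 * (e * |k - l|) := by
        refine (abs_sub _ _).trans ?_
        linarith
      have c2 : |A (k + k₀) - A k + (A (l + k₀) - A l)| ≤ 4 * e := by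
        refine (abs_add_le _ _).trans ?_
        linarith [abs_sub (A (k + k₀)) (A k), abs_sub (A (l + k₀)) (A l)]
      calc _ ≤ (2 * (e * |k - l|)) * (4 * e) := by gcongr
        _ = _ := by ring
    have hcont : Continuous G := by
      have : Continuous A := by
        have h1 : LipschitzWith (Real.toNNReal e) A := by
          refine LipschitzWith.of_dist_le_mul fun k l => ?_
          rw [Real.dist_eq, Real.dist_eq, Real.coe_toNNReal _
            ((abs_nonneg _).trans (hK.bound s 0 hs0))]
          exact hK.lipschitz s k l hs0
        exact h1.continuous
      fun_prop
    have hR := integral_period_le_sum hp hlip hcont hL (-(1 / 2) - k₀ / 2)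
    have hshift : ∫ k in (-(1 / 2) : ℝ)..(1 / 2), (A (k + k₀ / 2) - A (k - k₀ / 2)) ^ 2
        = ∫ k in (-(1 / 2) - k₀ / 2)..(-(1 / 2) - k₀ / 2 + 1), G k := by
      rw [show -(1 / 2) - k₀ / 2 + 1 = 1 / 2 - k₀ / 2 by ring,
        ← intervalIntegral.integral_comp_sub_right G (k₀ / 2)]
      congr 1
      funext k
      simp only [hG]
      rw [show k - k₀ / 2 + k₀ = k + k₀ / 2 by ring]
    rw [hshift]
    refine hR.trans (le_of_eq ?_)
    rw [cosSum_zero_sub_eq hΦ hL, hee]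
    change 1 / (L : ℝ) * ∑ n ∈ lattice L, (A2hat Φ γ s ((n : ℝ) / L + (m : ℝ) / L)
      - A2hat Φ γ s ((n : ℝ) / L)) ^ 2 + 8 * (K ^ 2 * Real.exp (-d * s)) / L = _
    field_simp
  have hb : MeasureTheory.IntegrableOn (fun s => 1 / γ * (cosSum Φ γ L 0 s - cosSum Φ γ L k₀ s)
        + 8 * K ^ 2 / L * Real.exp (-d * s)) (Set.Ioi 0) :=
    (hsub.const_mul _).add (he.1.const_mul _)
  have hmain : C ≤ ∫ s in Set.Ioi (0 : ℝ), (1 / γ * (cosSum Φ γ L 0 s - cosSum Φ γ L k₀ s)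
        + 8 * K ^ 2 / L * Real.exp (-d * s)) := by
    refine (hnd k₀ hm1 hm2).trans (MeasureTheory.integral_mono_of_nonneg
      (Filter.Eventually.of_forall fun s => ?_) hb ?_)
    · exact intervalIntegral.integral_nonneg (by norm_num) fun k _ => sq_nonneg _
    · filter_upwards [MeasureTheory.ae_restrict_mem measurableSet_Ioi] with s hs
      exact hinner s hs
  rw [MeasureTheory.integral_add (hsub.const_mul _) (he.1.const_mul _),
    MeasureTheory.integral_const_mul, MeasureTheory.integral_const_mul, he.2] at hmain
  have hDh := Dhat_eq hγ hd hK hL k₀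
  have hsmall : 8 * K ^ 2 / L * (1 / d) ≤ C / 2 := by
    have h1 : 16 * K ^ 2 / (d * C) ≤ L := hL₀.trans (by exact_mod_cast hLL)
    rw [div_le_iff₀ (by positivity)] at h1
    rw [div_mul_div_comm, mul_one, div_le_iff₀ (by positivity)]
    linarith
  rw [hDh]
  have h2 : C / 2 ≤ 1 / γ * ∫ s in Set.Ioi (0 : ℝ), (cosSum Φ γ L 0 s - cosSum Φ γ L k₀ s) := by
    linarith
  calc γ ^ 2 * C / 2 = γ ^ 2 * (C / 2) := by ring
    _ ≤ γ ^ 2 * (1 / γ * ∫ s in Set.Ioi (0 : ℝ), (cosSum Φ γ L 0 s - cosSum Φ γ L k₀ s)) := by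
      gcongr
    _ = _ := by field_simp

/-- `D̂(k)` is at most `2π²γk²` times the second moment, so a positive lower bound on `D̂` at one
wave number of order one suffices. -/
theorem exists_le_secondMoment (hΦ : CouplingAssumption Φ ω₀) (hγ : NoiseAssumption Φ γ) :
    ∃ (κ : ℝ) (L₀ : ℕ), 0 < κ ∧ ∀ L : ℕ, L₀ ≤ L → 1 ≤ L →
      κ ≤ ∫ s in Set.Ioi (0 : ℝ), ∑ y ∈ lattice L, (y : ℝ) ^ 2 * memKernel Φ γ L s y := by
  obtain ⟨c, L₀, hc, h⟩ := exists_le_Dhat hΦ hγ (ε := 1 / 8) (by norm_num)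
  obtain ⟨K, hK⟩ := smoothDecay_A2hat hΦ hγ
  have hg := hγ.gamma_pos
  have hd : 0 < ω₀ ^ 2 / γ := div_pos (pow_pos hΦ.omega_pos 2) hγ.gamma_pos
  have hpi := Real.pi_pos
  refine ⟨c / (γ * (2 * Real.pi ^ 2)), max L₀ 8, by positivity, ?_⟩
  intro L hLL hL
  have hL0 : (0 : ℝ) < L := by exact_mod_cast hL
  have hL8 : 8 ≤ L := (le_max_right _ _).trans hLL
  -- A dual lattice point `m/L` between `1/8` and `1/4`, available since `L ≥ 8`.
  set m : ℤ := (L : ℤ) / 4 with hm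
  have hm1 : (L : ℤ) ≤ 8 * m := by omega
  have hm2 : 4 * m ≤ L := by omega
  have hm1' : (L : ℝ) ≤ 8 * m := by exact_mod_cast hm1
  have hm2' : 4 * (m : ℝ) ≤ L := by exact_mod_cast hm2
  have hk0 : 0 ≤ (m : ℝ) / L := div_nonneg (by linarith) hL0.le
  have hk1 : 1 / 8 ≤ (m : ℝ) / L := by
    rw [le_div_iff₀ hL0]; linarith
  have hk2 : (m : ℝ) / L ≤ 1 / 4 := by
    rw [div_le_iff₀ hL0]; linarith
  have h1 := h L ((le_max_left _ _).trans hLL) hL m (by rwa [abs_of_nonneg hk0])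
    (by rw [abs_of_nonneg hk0]; linarith)
  have h2 := h1.trans (Dhat_le_secondMoment hγ hd hK hL _)
  set Y := ∫ s in Set.Ioi (0 : ℝ), ∑ y ∈ lattice L, (y : ℝ) ^ 2 * memKernel Φ γ L s y with hY
  have hY0 : 0 ≤ Y := MeasureTheory.integral_nonneg fun s =>
    Finset.sum_nonneg fun y _ => mul_nonneg (sq_nonneg _) (memKernel_nonneg hγ s y)
  rw [div_le_iff₀ (by positivity)]
  refine h2.trans ?_
  calc γ * (2 * Real.pi ^ 2 * ((m : ℝ) / L) ^ 2 * Y)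
      ≤ γ * (2 * Real.pi ^ 2 * 1 ^ 2 * Y) := by
        gcongr
        linarith
    _ = _ := by ring

end
end VelocityFlip
end

/-! ### The renewal integrand: decay on vertical lines and residues. -/

noncomputable section
namespace VelocityFlip

theorem integral_inv_sq_add_sq_univ {d : ℝ} (hd : 0 < d) :
    MeasureTheory.Integrable (fun α : ℝ => (d ^ 2 + α ^ 2)⁻¹) ∧
    ∫ α : ℝ, (d ^ 2 + α ^ 2)⁻¹ = Real.pi / d := by
  have he : (fun α : ℝ => (d ^ 2 + α ^ 2)⁻¹)
      = fun α : ℝ => (d ^ 2)⁻¹ * (fun x : ℝ => (1 + x ^ 2)⁻¹) (α / d) := by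
    funext α
    simp only
    rw [← mul_inv]
    congr 1
    field_simp
  rw [he]
  refine ⟨(integrable_inv_one_add_sq.comp_div hd.ne').const_mul _, ?_⟩
  rw [MeasureTheory.integral_const_mul, MeasureTheory.Measure.integral_comp_div
      (fun x : ℝ => (1 + x ^ 2)⁻¹) d,
    integral_univ_inv_one_add_sq, abs_of_pos hd, smul_eq_mul]
  field_simp

/-- The integrand of the inverse Laplace transform of `∑_{n ≥ 2} P^n`. -/
def renewalFun (P : ℂ → ℂ) (t : ℝ) (z : ℂ) : ℂ :=
  Complex.exp (z * (t : ℂ)) * (P z ^ 2 / (1 - P z))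

section
variable {ι : Type*} {J : Finset ι} {c m : ι → ℝ} {d C : ℝ}

theorem norm_renewalFun_le (hd : 0 < d) (hm : ∀ j ∈ J, 2 * d ≤ m j) (hC : ∑ j ∈ J, |c j| ≤ C)
    {z : ℂ} (hz : -d ≤ z.re) {b : ℝ} (hb : 0 < b) (h : b ≤ ‖1 - lap J c m z‖) (t : ℝ) :
    ‖renewalFun (lap J c m) t z‖
      ≤ Real.exp (z.re * t) * (C ^ 2 / b) * (d ^ 2 + z.im ^ 2)⁻¹ := by
  have h1 := norm_lap_sq_le hd hm hC hz
  rw [renewalFun, norm_mul, norm_div, norm_pow, Complex.norm_exp, Complex.re_mul_ofReal, mul_assoc]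
  gcongr
  calc _ ≤ (C ^ 2 / (d ^ 2 + z.im ^ 2)) / b := by gcongr
    _ = _ := by field_simp

theorem renewalFun_line (hd : 0 < d) (hm : ∀ j ∈ J, 2 * d ≤ m j) (hC : ∑ j ∈ J, |c j| ≤ C)
    {x b t : ℝ} (hx : -d ≤ x) (hb : 0 < b)
    (h : ∀ α : ℝ, b ≤ ‖1 - lap J c m ((x : ℂ) + Complex.I * (α : ℂ))‖) :
    MeasureTheory.Integrable
      (fun α : ℝ => renewalFun (lap J c m) t ((x : ℂ) + Complex.I * (α : ℂ))) ∧
    ‖vertInt x (renewalFun (lap J c m) t)‖ ≤ C ^ 2 / (2 * b * d) * Real.exp (x * t) := by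
  have hline := integral_inv_sq_add_sq_univ hd
  have hbound : ∀ α : ℝ, ‖renewalFun (lap J c m) t ((x : ℂ) + Complex.I * (α : ℂ))‖
      ≤ Real.exp (x * t) * (C ^ 2 / b) * (d ^ 2 + α ^ 2)⁻¹ := by
    intro α
    have := norm_renewalFun_le hd hm hC (z := (x : ℂ) + Complex.I * (α : ℂ)) (by simpa using hx)
      hb (h α) t
    simpa using this
  have hP : Continuous fun α : ℝ => lap J c m ((x : ℂ) + Complex.I * (α : ℂ)) := by
    rw [continuous_iff_continuousAt]
    intro α
    have h1 : ContinuousAt (lap J c m) ((x : ℂ) + Complex.I * (α : ℂ)) :=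
      (hasDerivAt_lap hm (by simp; linarith)).continuousAt
    have h2 : ContinuousAt (fun α : ℝ => (x : ℂ) + Complex.I * (α : ℂ)) α := by fun_prop
    exact ContinuousAt.comp (f := fun α : ℝ => (x : ℂ) + Complex.I * (α : ℂ)) h1 h2
  have hcont : Continuous fun α : ℝ =>
      renewalFun (lap J c m) t ((x : ℂ) + Complex.I * (α : ℂ)) := by
    unfold renewalFun
    refine Continuous.mul (by fun_prop) ((hP.pow 2).div (continuous_const.sub hP) fun α => ?_)
    exact norm_pos_iff.1 (hb.trans_le (h α))
  have hint := hline.1.const_mul (Real.exp (x * t) * (C ^ 2 / b))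
  refine ⟨hint.mono' hcont.aestronglyMeasurable (Filter.Eventually.of_forall hbound), ?_⟩
  have hn := MeasureTheory.norm_integral_le_of_norm_le hint (Filter.Eventually.of_forall hbound)
  rw [MeasureTheory.integral_const_mul, hline.2] at hn
  have hpi := Real.pi_pos
  have h2 : ‖(1 : ℂ) / (2 * (Real.pi : ℂ))‖ = 1 / (2 * Real.pi) := by
    rw [show (1 : ℂ) / (2 * (Real.pi : ℂ)) = ((1 / (2 * Real.pi) : ℝ) : ℂ) by push_cast; rfl,
      Complex.norm_real, Real.norm_eq_abs, abs_of_pos (by positivity)]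
  rw [vertInt, norm_mul, h2]
  calc _ ≤ 1 / (2 * Real.pi) * (Real.exp (x * t) * (C ^ 2 / b) * (Real.pi / d)) := by gcongr
    _ = _ := by field_simp

/-- Shifting the contour of the renewal integrand, given its decomposition into a holomorphic
part and a simple pole. -/
theorem norm_vertInt_renewalFun_sub_le (hd : 0 < d) (hm : ∀ j ∈ J, 2 * d ≤ m j)
    (hC : ∑ j ∈ J, |c j| ≤ C) {δ η p b b' t : ℝ} (hδd : δ ≤ d) (hp : -δ < p) (hpη : p < η)
    (ht : 0 ≤ t) (hb : 0 < b) (hb' : 0 < b')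
    (h : ∀ α : ℝ, b ≤ ‖1 - lap J c m (((-δ : ℝ) : ℂ) + Complex.I * (α : ℂ))‖)
    (h' : ∀ α : ℝ, b' ≤ ‖1 - lap J c m ((η : ℂ) + Complex.I * (α : ℂ))‖) {g : ℂ → ℂ} {r : ℂ}
    (hg : ∀ z : ℂ, -δ ≤ z.re → z.re ≤ η → DifferentiableAt ℂ g z)
    (hfg : ∀ z : ℂ, -δ ≤ z.re → z.re ≤ η → z ≠ p →
      renewalFun (lap J c m) t z = g z + r / (z - p)) :
    ‖vertInt η (renewalFun (lap J c m) t) - r‖ ≤ C ^ 2 / (2 * b * d) * Real.exp (-δ * t) := by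
  have hC0 : 0 ≤ C := (Finset.sum_nonneg fun j _ => abs_nonneg (c j)).trans hC
  have l1 := renewalFun_line (t := t) hd hm hC (by linarith : -d ≤ -δ) hb h
  have l2 := renewalFun_line (t := t) hd hm hC (by linarith : -d ≤ η) hb' h'
  -- For `|Im z| ≥ 2C` one has `|P| ≤ 1/2`, so `1 - P` stays away from zero; for `|Im z| ≥ 1` the
  -- quadratic decay implies the linear decay required by the contour lemma.
  have hK : ∀ z : ℂ, -δ ≤ z.re → z.re ≤ η → max 1 (2 * C) ≤ |z.im| →
      ‖renewalFun (lap J c m) t z‖ ≤ Real.exp (η * t) * (C ^ 2 / (1 / 2)) / |z.im| := by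
    intro z hz1 hz2 hz3
    have him1 : 1 ≤ |z.im| := (le_max_left _ _).trans hz3
    have him2 : 2 * C ≤ |z.im| := (le_max_right _ _).trans hz3
    have hzd : -d ≤ z.re := by linarith
    have hsq : |z.im| * |z.im| = z.im ^ 2 := by rw [← sq, sq_abs]
    have hP := norm_lap_sq_le hd hm hC hzd
    have hP2 : ‖lap J c m z‖ ≤ 1 / 2 := by
      have h1 : C ^ 2 / (d ^ 2 + z.im ^ 2) ≤ (1 / 2) ^ 2 := by
        rw [div_le_iff₀ (by nlinarith)]
        nlinarith [sq_nonneg d]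
      exact abs_le_of_sq_le_sq' (hP.trans h1) (by norm_num) |>.2
    have hlow : 1 / 2 ≤ ‖1 - lap J c m z‖ := by
      have := norm_sub_norm_le (1 : ℂ) (lap J c m z)
      rw [norm_one] at this
      linarith
    refine (norm_renewalFun_le hd hm hC hzd (by norm_num) hlow t).trans ?_
    rw [div_eq_mul_inv (_ * _) |z.im|]
    gcongr
    nlinarith [sq_nonneg d]
  have hshift := vertInt_eq_add_of_simple_pole hp hpη hg hfg hK l1.1 l2.1
  rw [hshift, add_sub_cancel_right]
  exact l1.2

theorem norm_vertInt_renewalFun_le (hd : 0 < d) (hm : ∀ j ∈ J, 2 * d ≤ m j)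
    (hC : ∑ j ∈ J, |c j| ≤ C) {δ η b b' t : ℝ} (hδ : 0 < δ) (hδd : δ ≤ d)
    (hη : 0 < η) (ht : 0 ≤ t) (hb : 0 < b) (hb' : 0 < b')
    (h : ∀ α : ℝ, b ≤ ‖1 - lap J c m (((-δ : ℝ) : ℂ) + Complex.I * (α : ℂ))‖)
    (h' : ∀ α : ℝ, b' ≤ ‖1 - lap J c m ((η : ℂ) + Complex.I * (α : ℂ))‖)
    (hne : ∀ z : ℂ, -δ ≤ z.re → z.re ≤ η → lap J c m z ≠ 1) :
    ‖vertInt η (renewalFun (lap J c m) t)‖ ≤ C ^ 2 / (2 * b * d) * Real.exp (-δ * t) := by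
  -- A fictitious pole at `0` with residue zero.
  have := norm_vertInt_renewalFun_sub_le (p := 0) (r := 0) (g := renewalFun (lap J c m) t)
    hd hm hC hδd (by linarith) hη ht hb hb' h h' ?_ ?_
  · rwa [sub_zero] at this
  · intro z hz1 hz2
    have hP : DifferentiableAt ℂ (lap J c m) z :=
      (hasDerivAt_lap hm (by linarith)).differentiableAt
    unfold renewalFun
    refine DifferentiableAt.mul (by fun_prop) ((hP.pow 2).div (hP.const_sub 1) ?_)
    exact sub_ne_zero.2 (hne z hz1 hz2).symm
  · intro z _ _ _
    simp

theorem norm_vertInt_renewalFun_sub_residue_le (hd : 0 < d) (hm : ∀ j ∈ J, 2 * d ≤ m j)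
    (hC : ∑ j ∈ J, |c j| ≤ C) {δ η p b b' t : ℝ} (hδd : δ ≤ d) (hp : -δ < p) (hpη : p < η)
    (ht : 0 ≤ t) (hb : 0 < b) (hb' : 0 < b')
    (h : ∀ α : ℝ, b ≤ ‖1 - lap J c m (((-δ : ℝ) : ℂ) + Complex.I * (α : ℂ))‖)
    (h' : ∀ α : ℝ, b' ≤ ‖1 - lap J c m ((η : ℂ) + Complex.I * (α : ℂ))‖)
    (hpole : lap J c m p = 1) (hD : lapD J c m p ≠ 0)
    (hne : ∀ z : ℂ, -δ ≤ z.re → z.re ≤ η → z ≠ p → lap J c m z ≠ 1) :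
    ‖vertInt η (renewalFun (lap J c m) t) - Complex.exp (p * t) / lapD J c m p‖
      ≤ C ^ 2 / (2 * b * d) * Real.exp (-δ * t) := by
  set U : Set ℂ := {z | -(2 * d) < z.re} with hU
  have hUo : IsOpen U := isOpen_lt continuous_const Complex.continuous_re
  have hpU : (p : ℂ) ∈ U := by
    change -(2 * d) < (p : ℂ).re
    rw [Complex.ofReal_re]
    linarith
  have hdP : ∀ z ∈ U, HasDerivAt (lap J c m) (-lapD J c m z) z := fun z hz => hasDerivAt_lap hm hz
  have hW : DifferentiableOn ℂ (fun z => 1 - lap J c m z) U := fun z hz =>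
    ((hdP z hz).differentiableAt.const_sub 1).differentiableWithinAt
  -- The simple zero is divided out: `1 - P = (z - p) q` with `q` holomorphic and `q(p) = -P'(p) ≠
  -- 0`.
  set q : ℂ → ℂ := dslope (fun z => 1 - lap J c m z) (p : ℂ) with hq
  have hqU : DifferentiableOn ℂ q U :=
    (Complex.differentiableOn_dslope (hUo.mem_nhds hpU)).2 hW
  have hqp : q p = lapD J c m p := by
    rw [hq, dslope_same]
    have := ((hdP p hpU).const_sub 1).deriv
    rwa [neg_neg] at this
  have hqz : ∀ z : ℂ, z ≠ p → 1 - lap J c m z = (z - p) * q z := by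
    intro z hz
    rw [hq, dslope_of_ne _ hz, slope_def_field, hpole, sub_self, sub_zero]
    have : z - (p : ℂ) ≠ 0 := sub_ne_zero.2 hz
    field_simp
  set V : Set ℂ := U ∩ q ⁻¹' {0}ᶜ with hV
  have hVo : IsOpen V := hqU.continuousOn.isOpen_inter_preimage hUo isOpen_compl_singleton
  have hpV : (p : ℂ) ∈ V := ⟨hpU, by simpa [hqp] using hD⟩
  -- The integrand is `Ψ/(z - p)` away from `p`. Hence the residue is `Ψ(p)` and the holomorphic
  -- part is the difference quotient of `Ψ` at `p`.
  set Ψ : ℂ → ℂ := fun z => Complex.exp (z * (t : ℂ)) * lap J c m z ^ 2 / q z with hΨ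
  have hΨV : DifferentiableOn ℂ Ψ V := by
    refine DifferentiableOn.div ?_ (hqU.mono Set.inter_subset_left) fun z hz => hz.2
    intro z hz
    have hP := (hdP z hz.1).differentiableAt
    exact (DifferentiableAt.mul (by fun_prop) (hP.pow 2)).differentiableWithinAt
  have hgV := (Complex.differentiableOn_dslope (hVo.mem_nhds hpV)).2 hΨV
  have hΨp : Ψ p = Complex.exp (p * t) / lapD J c m p := by
    simp only [hΨ, hpole, hqp, one_pow, mul_one]
  refine norm_vertInt_renewalFun_sub_le (g := dslope Ψ (p : ℂ)) hd hm hC hδd hp hpη ht hb hb'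
    h h' ?_ ?_
  · intro z hz1 hz2
    have hzU : z ∈ U := by
      change -(2 * d) < z.re
      linarith
    have hzV : z ∈ V := by
      rcases eq_or_ne z p with rfl | hzp
      · exact hpV
      · refine ⟨hzU, ?_⟩
        intro h0
        rw [Set.mem_singleton_iff] at h0
        have := hqz z hzp
        rw [h0, mul_zero] at this
        exact hne z hz1 hz2 hzp (sub_eq_zero.1 this).symm
    exact (hgV z hzV).differentiableAt (hVo.mem_nhds hzV)
  · intro z hz1 hz2 hzp
    have hz0 : z - (p : ℂ) ≠ 0 := sub_ne_zero.2 hzp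
    have h1 : 1 - lap J c m z ≠ 0 := sub_ne_zero.2 (hne z hz1 hz2 hzp).symm
    have hq0 : q z ≠ 0 := by
      intro h0
      rw [hqz z hzp, h0, mul_zero] at h1
      exact h1 rfl
    rw [dslope_of_ne _ hzp, slope_def_field, ← hΨp, ← add_div, sub_add_cancel, renewalFun,
      hqz z hzp]
    simp only [hΨ]
    field_simp

end
end VelocityFlip
end

/-! ### The root of the dispersion equation and lower bounds on `1 - p̂`. -/

noncomputable section
namespace VelocityFlip

/-- A function with slope close to `1 / γ` attains the value `1` exactly once. -/
theorem exists_unique_root_of_taylor {H h : ℝ → ℝ} {γ β M θ e : ℝ} (hγ : 0 < γ) (hβ : 0 < β)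
    (hM : 0 ≤ M) (hMβ : 8 * γ * M * β ≤ 1)
    (hT : ∀ r ∈ Set.Icc 0 β, ∀ r' ∈ Set.Icc 0 β, |H r - H r' - h r' * (r - r')| ≤ M * (r - r') ^ 2)
    (hL : ∀ r ∈ Set.Icc 0 β, ∀ r' ∈ Set.Icc 0 β, |h r - h r'| ≤ 2 * M * |r - r'|)
    (hc : ContinuousOn H (Set.Icc 0 β)) (h0 : H 0 = 1 - θ) (hθ : 0 ≤ θ) (hθβ : 2 * γ * θ ≤ β)
    (he : |h 0 - 1 / γ| ≤ e) (heγ : 4 * γ * e ≤ 1) :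
    ∃ R ∈ Set.Icc 0 β, H R = 1 ∧ (∀ r ∈ Set.Icc 0 β, H r = 1 → r = R) ∧
      1 / (2 * γ) ≤ h R ∧ γ * θ / 2 ≤ R ∧ R ≤ 2 * γ * θ ∧
      |γ * θ - R| ≤ γ * (e * R + M * R ^ 2) := by
  have z0 : (0 : ℝ) ∈ Set.Icc 0 β := ⟨le_rfl, hβ.le⟩
  have zβ : β ∈ Set.Icc 0 β := ⟨hβ.le, le_rfl⟩
  have hγh0 : |γ * h 0 - 1| ≤ γ * e := by
    have : γ * h 0 - 1 = γ * (h 0 - 1 / γ) := by field_simp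
    rw [this, abs_mul, abs_of_pos hγ]
    gcongr
  have hMr : ∀ x, |x| ≤ β → 8 * (γ * (M * |x|)) ≤ 1 := by
    intro x hx
    have : M * |x| ≤ M * β := by gcongr
    nlinarith
  -- The slope times `γ` departs from `1` by at most `γe ≤ 1/4` at the origin and by a further `2γMβ
  -- ≤ 1/4` along the interval.
  have hh : ∀ r ∈ Set.Icc 0 β, 1 / 2 ≤ γ * h r := by
    intro r hr
    have h1 := hL r hr 0 z0
    rw [sub_zero] at h1
    have hrβ : |r| ≤ β := by rw [abs_of_nonneg hr.1]; exact hr.2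
    have h2 := hMr r hrβ
    have h3 := (abs_le.1 h1).1
    have h4 := (abs_le.1 hγh0).1
    have h5 : γ * (-(2 * M * |r|)) ≤ γ * (h r - h 0) := by gcongr
    nlinarith
  -- Slope at least `1/(2γ)`, minus a quadratic remainder worth at most `1/(8γ)`: strict growth,
  -- hence uniqueness.
  have hgrow : ∀ r ∈ Set.Icc 0 β, ∀ r' ∈ Set.Icc 0 β, r' ≤ r → (r - r') / 4 ≤ γ * (H r - H r') := by
    intro r hr r' hr' hle
    have h1 := (abs_le.1 (hT r hr r' hr')).1
    have hx : |r - r'| ≤ β := by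
      rw [abs_of_nonneg (by linarith)]
      linarith [hr.2, hr'.1]
    have h2 := hMr _ hx
    rw [abs_of_nonneg (by linarith)] at h2
    have h3 : 0 ≤ r - r' := by linarith
    have h4 : 1 / 2 * (r - r') ≤ γ * h r' * (r - r') :=
      mul_le_mul_of_nonneg_right (hh r' hr') h3
    have h5 : 8 * (γ * (M * (r - r'))) * (r - r') ≤ 1 * (r - r') :=
      mul_le_mul_of_nonneg_right h2 h3
    have h6 : γ * (-(M * (r - r') ^ 2)) ≤ γ * (H r - H r' - h r' * (r - r')) := by gcongr
    nlinarith
  have hlin : ∀ r ∈ Set.Icc 0 β, |γ * (H r - H 0) - r| ≤ γ * (e * r + M * r ^ 2) := by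
    intro r hr
    have h1 := hT r hr 0 z0
    rw [sub_zero] at h1
    have h2 : γ * (H r - H 0) - r = γ * (H r - H 0 - h 0 * r) + (γ * h 0 - 1) * r := by ring
    rw [h2]
    refine (abs_add_le _ _).trans ?_
    rw [abs_mul, abs_mul, abs_of_pos hγ, abs_of_nonneg hr.1]
    have h3 : |γ * h 0 - 1| * r ≤ γ * e * r := mul_le_mul_of_nonneg_right hγh0 hr.1
    have h4 : γ * |H r - H 0 - h 0 * r| ≤ γ * (M * r ^ 2) := by gcongr
    linarith
  have hlin' : ∀ r ∈ Set.Icc 0 β, γ * (e * r + M * r ^ 2) ≤ r / 2 := by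
    intro r hr
    have hrβ : |r| ≤ β := by rw [abs_of_nonneg hr.1]; exact hr.2
    have h2 := hMr r hrβ
    rw [abs_of_nonneg hr.1] at h2
    have h3 := mul_le_mul_of_nonneg_right h2 hr.1
    have h4 := mul_le_mul_of_nonneg_right heγ hr.1
    nlinarith [hr.1]
  -- `γ(H β - H 0) ≥ β/2 ≥ γθ`, so the deficit `θ` at the origin is recovered before `β` and the
  -- intermediate value theorem applies.
  have hβ1 : 1 ≤ H β := by
    have h1 := (abs_le.1 (hlin β zβ)).1
    have h2 := hlin' β zβ
    have h3 : 0 ≤ γ * (H β - 1) := by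
      have : γ * (H β - H 0) = γ * (H β - 1) + γ * θ := by rw [h0]; ring
      linarith
    have := nonneg_of_mul_nonneg_right h3 hγ
    linarith
  obtain ⟨R, hR, hR1⟩ := intermediate_value_Icc hβ.le hc
    (⟨by rw [h0]; linarith, hβ1⟩ : (1 : ℝ) ∈ Set.Icc (H 0) (H β))
  have hRθ : γ * (H R - H 0) = γ * θ := by rw [hR1, h0]; ring
  have hRl := hlin R hR
  rw [hRθ] at hRl
  have hRl' := abs_le.1 (hRl.trans (hlin' R hR))
  refine ⟨R, hR, hR1, ?_, ?_, ?_, ?_, hRl⟩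
  · intro r hr hr1
    rcases le_total r R with hle | hle
    · have := hgrow R hR r hr hle
      rw [hr1, hR1, sub_self, mul_zero] at this
      linarith
    · have := hgrow r hr R hR hle
      rw [hr1, hR1, sub_self, mul_zero] at this
      linarith
  · rw [div_le_iff₀ (by positivity)]
    linarith [hh R hR]
  · linarith [hR.1]
  · linarith

section
variable {Φ : ℤ → ℝ} {ω₀ γ : ℝ} {L : ℕ}

/-- The lower bound for the real part of `1 - p̂` on the imaginary axis. -/
def axisGap (γ α : ℝ) : ℝ := α ^ 2 / (4 * (γ ^ 2 + 4 * α ^ 2))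

theorem axisGap_pos {γ α : ℝ} (hα : 0 < α) : 0 < axisGap γ α := by
  unfold axisGap
  positivity

theorem axisGap_le {γ α y : ℝ} (hα : 0 < α) (hy : α ≤ |y|) : axisGap γ α ≤ axisGap γ y := by
  have hy2 : α ^ 2 ≤ y ^ 2 := by
    rw [← sq_abs y]
    gcongr
  have hα2 : 0 < α ^ 2 := by positivity
  unfold axisGap
  rw [div_le_div_iff₀ (by positivity) (by nlinarith [sq_nonneg γ])]
  nlinarith [mul_le_mul_of_nonneg_left hy2 (sq_nonneg γ)]

/-- The gap on the imaginary axis survives a shift to the left by `δ`, up to the Lipschitz constant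
times `δ`. -/
theorem axisGap_sub_le_norm (hΦ : CouplingAssumption Φ ω₀) (hγ : NoiseAssumption Φ γ)
    (hL : 1 ≤ L) (m : ℤ) {C δ α : ℝ} (hC : ∑ j ∈ kerJ L, |kerC Φ γ L m j| ≤ C)
    (hδd : δ ≤ ω₀ ^ 2 / γ) (hα : 0 < α) {z : ℂ} (hz : -δ ≤ z.re) (hz0 : z.re ≤ 0)
    (him : α ≤ |z.im|) :
    axisGap γ α - C / (ω₀ ^ 2 / γ) ^ 2 * δ ≤ ‖1 - kerLap Φ γ L m z‖ := by
  have hd : 0 < ω₀ ^ 2 / γ := div_pos (pow_pos hΦ.omega_pos 2) hγ.gamma_pos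
  have hC0 : 0 ≤ C := (Finset.sum_nonneg fun j _ => abs_nonneg _).trans hC
  have h1 := le_re_one_sub_kerLap hΦ hγ hL m z.im
  have h2 := norm_lap_sub_le hd (le_kerM hΦ hγ m) hC (z := z) (w := Complex.I * z.im)
    (by linarith) (by simpa using hd.le)
  have h3 : ‖z - Complex.I * z.im‖ ≤ δ := by
    have : z - Complex.I * z.im = (z.re : ℂ) := by
      apply Complex.ext <;> simp
    rw [this, Complex.norm_real, Real.norm_eq_abs, abs_of_nonpos hz0]
    linarith
  have h4 : C / (ω₀ ^ 2 / γ) ^ 2 * ‖z - Complex.I * z.im‖ ≤ C / (ω₀ ^ 2 / γ) ^ 2 * δ := by gcongr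
  have h5 := (axisGap_le (γ := γ) hα him).trans h1
  have h6 := Complex.re_le_norm (1 - kerLap Φ γ L m (Complex.I * z.im))
  rw [Complex.sub_re, Complex.one_re] at h6
  have h7 : ‖1 - kerLap Φ γ L m (Complex.I * z.im)‖
      ≤ ‖1 - kerLap Φ γ L m z‖ + ‖kerLap Φ γ L m z - kerLap Φ γ L m (Complex.I * z.im)‖ := by
    refine le_trans (le_of_eq ?_) (norm_add_le _ _)
    congr 1
    ring
  have h8 := h2.trans h4
  change ‖kerLap Φ γ L m z - kerLap Φ γ L m (Complex.I * z.im)‖ ≤ _ at h8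
  linarith

theorem Dhat_sub_le_norm (hΦ : CouplingAssumption Φ ω₀) (hγ : NoiseAssumption Φ γ) {K : ℝ}
    (hK : SmoothDecay (A2hat Φ γ) (ω₀ ^ 2 / γ / 2) K)
    (hL : 1 ≤ L) (m : ℤ) {C δ α : ℝ} (hC : ∑ j ∈ kerJ L, |kerC Φ γ L m j| ≤ C)
    (hδd : δ ≤ ω₀ ^ 2 / γ) {z : ℂ} (hz : -δ ≤ z.re) (hz0 : z.re ≤ 0)
    (him : |z.im| ≤ α) :
    Dhat Φ γ L ((m : ℝ) / L) / γ - C / (ω₀ ^ 2 / γ) ^ 2 * (δ + α) ≤ ‖1 - kerLap Φ γ L m z‖ := by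
  have hd : 0 < ω₀ ^ 2 / γ := div_pos (pow_pos hΦ.omega_pos 2) hγ.gamma_pos
  have hC0 : 0 ≤ C := (Finset.sum_nonneg fun j _ => abs_nonneg _).trans hC
  have h2 := norm_lap_sub_le hd (le_kerM hΦ hγ m) hC (z := z) (w := 0)
    (by linarith) (by simpa using hd.le)
  have h3 : ‖z - 0‖ ≤ δ + α := by
    rw [sub_zero]
    refine (Complex.norm_le_abs_re_add_abs_im z).trans ?_
    rw [abs_of_nonpos hz0]
    linarith
  have h4 : C / (ω₀ ^ 2 / γ) ^ 2 * ‖z - 0‖ ≤ C / (ω₀ ^ 2 / γ) ^ 2 * (δ + α) := by gcongr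
  have h6 : Dhat Φ γ L ((m : ℝ) / L) / γ ≤ ‖1 - kerLap Φ γ L m 0‖ := by
    have h6 := Complex.re_le_norm (1 - kerLap Φ γ L m 0)
    rw [Complex.sub_re, Complex.one_re, kerLap_at_zero hΦ hγ hK hL, Complex.ofReal_re] at h6
    rw [kerLap_at_zero hΦ hγ hK hL]
    linarith
  have h7 : ‖1 - kerLap Φ γ L m 0‖
      ≤ ‖1 - kerLap Φ γ L m z‖ + ‖kerLap Φ γ L m z - kerLap Φ γ L m 0‖ := by
    refine le_trans (le_of_eq ?_) (norm_add_le _ _)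
    congr 1
    ring
  have h8 := h2.trans h4
  change ‖kerLap Φ γ L m z - kerLap Φ γ L m 0‖ ≤ _ at h8
  linarith

theorem kerLap_ne_one_of_re_pos (hΦ : CouplingAssumption Φ ω₀) (hγ : NoiseAssumption Φ γ)
    (hL : 1 ≤ L) (m : ℤ) {z : ℂ} (hz : 0 < z.re) :
    0 < 1 - (kerLap Φ γ L 0 (z.re : ℂ)).re ∧
    1 - (kerLap Φ γ L 0 (z.re : ℂ)).re ≤ ‖1 - kerLap Φ γ L m z‖ ∧ kerLap Φ γ L m z ≠ 1 := by
  have hd : 0 < ω₀ ^ 2 / γ := div_pos (pow_pos hΦ.omega_pos 2) hγ.gamma_pos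
  have h1 := kerLap_zero_re_lt_one hΦ hγ hL hz
  have h2 := norm_kerLap_le hΦ hγ hL m (z := z) (by linarith)
  have h3 := norm_sub_norm_le (1 : ℂ) (kerLap Φ γ L m z)
  rw [norm_one] at h3
  refine ⟨by linarith, by linarith, fun h => ?_⟩
  rw [h, norm_one] at h2
  linarith

theorem vertInt_pHat_eq (hΦ : CouplingAssumption Φ ω₀) (hγ : NoiseAssumption Φ γ) (hL : 1 ≤ L)
    (m : ℤ) {η : ℝ} (hη : 0 < η) (t : ℝ) :
    vertInt η (fun z => Complex.exp (z * (t : ℂ))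
        * (pHat Φ γ L z ((m : ℝ) / L) ^ 2 / (1 - pHat Φ γ L z ((m : ℝ) / L))))
      = vertInt η (renewalFun (kerLap Φ γ L m) t) := by
  have hd : 0 < ω₀ ^ 2 / γ := div_pos (pow_pos hΦ.omega_pos 2) hγ.gamma_pos
  unfold vertInt
  congr 2
  funext α
  have hre : -(2 * (ω₀ ^ 2 / γ)) < ((η : ℂ) + Complex.I * (α : ℂ)).re := by
    simp
    linarith
  simp only [pHat_eq hΦ hγ hL m hre, renewalFun]

/-- Large wave numbers: the axis gap covers `|Im z| ≥ α` and the lower bound on `D̂` covers `|Im z|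
≤ α`. Hence `1 - p̂` has no zero in the strip and no residue is collected. -/
theorem norm_vertInt_le_of_Dhat (hΦ : CouplingAssumption Φ ω₀) (hγ : NoiseAssumption Φ γ) {K : ℝ}
    (hK : SmoothDecay (A2hat Φ γ) (ω₀ ^ 2 / γ / 2) K) (hL : 1 ≤ L) (m : ℤ) {C δ α b c' : ℝ}
    (hC : ∑ j ∈ kerJ L, |kerC Φ γ L m j| ≤ C) (hδ : 0 < δ) (hδd : δ ≤ ω₀ ^ 2 / γ) (hα : 0 < α)
    (hb : 0 < b) (hD : c' ≤ Dhat Φ γ L ((m : ℝ) / L))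
    (h1 : C / (ω₀ ^ 2 / γ) ^ 2 * δ ≤ axisGap γ α / 2)
    (h2 : C / (ω₀ ^ 2 / γ) ^ 2 * (δ + α) ≤ c' / (2 * γ))
    (hb1 : b ≤ axisGap γ α / 2) (hb2 : b ≤ c' / (2 * γ)) {η t : ℝ} (hη : 0 < η) (ht : 0 ≤ t) :
    ‖vertInt η (fun z => Complex.exp (z * (t : ℂ))
        * (pHat Φ γ L z ((m : ℝ) / L) ^ 2 / (1 - pHat Φ γ L z ((m : ℝ) / L))))‖
      ≤ C ^ 2 / (2 * b * (ω₀ ^ 2 / γ)) * Real.exp (-δ * t) := by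
  have hg := hγ.gamma_pos
  have hd : 0 < ω₀ ^ 2 / γ := div_pos (pow_pos hΦ.omega_pos 2) hγ.gamma_pos
  have hlow : ∀ z : ℂ, -δ ≤ z.re → z.re ≤ 0 → b ≤ ‖1 - kerLap Φ γ L m z‖ := by
    intro z hz hz0
    rcases le_total α |z.im| with h | h
    · have := axisGap_sub_le_norm hΦ hγ hL m hC hδd hα hz hz0 h
      linarith
    · have h3 := Dhat_sub_le_norm hΦ hγ hK hL m hC hδd hz hz0 h
      have h4 : c' / γ ≤ Dhat Φ γ L ((m : ℝ) / L) / γ := by gcongr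
      have h5 : c' / γ = c' / (2 * γ) + c' / (2 * γ) := by field_simp; ring
      linarith
  rw [vertInt_pHat_eq hΦ hγ hL m hη]
  have hpos := fun z (hz : 0 < z.re) => kerLap_ne_one_of_re_pos hΦ hγ hL m (z := z) hz
  refine norm_vertInt_renewalFun_le (b' := 1 - (kerLap Φ γ L 0 (η : ℂ)).re) hd (le_kerM hΦ hγ m)
    hC hδ hδd hη ht hb ?_ ?_ ?_ ?_
  · simpa using (hpos (η : ℂ) (by simpa using hη)).1
  · intro x
    exact hlow _ (by simp) (by simp; linarith)
  · intro x
    have h3 : ((η : ℂ) + Complex.I * (x : ℂ)).re = η := by simp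
    have h4 := (hpos ((η : ℂ) + Complex.I * (x : ℂ)) (by rwa [h3])).2.1
    rw [h3] at h4
    exact h4
  · intro z hz _
    rcases le_or_gt z.re 0 with h | h
    · have h3 := norm_pos_iff.1 (hb.trans_le (hlow z hz h))
      exact fun h4 => h3 (sub_eq_zero.2 h4.symm)
    · exact (hpos z h).2.2

/-- Small wave numbers: near the origin `1 - p̂` is linear about the root up to a small quadratic
error, so `-R` is its only zero there, and it is simple. -/
theorem norm_vertInt_sub_le_of_root (hΦ : CouplingAssumption Φ ω₀) (hγ : NoiseAssumption Φ γ)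
    (hL : 1 ≤ L) (m : ℤ) {C δ α b R h : ℝ}
    (hC : ∑ j ∈ kerJ L, |kerC Φ γ L m j| ≤ C) (hδ : 0 < δ) (hδd : δ ≤ ω₀ ^ 2 / γ) (hα : 0 < α)
    (hb : 0 < b) (hR0 : 0 ≤ R) (hRδ : R ≤ δ / 2) (hroot : kerLap Φ γ L m (-(R : ℂ)) = 1)
    (hDR : kerLapD Φ γ L m (-(R : ℂ)) = h) (hh : 1 / (2 * γ) ≤ h)
    (h1 : C / (ω₀ ^ 2 / γ) ^ 2 * δ ≤ axisGap γ α / 2)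
    (h2 : C / (ω₀ ^ 2 / γ) ^ 3 * (δ + α) ≤ 1 / (4 * γ))
    (hb1 : b ≤ axisGap γ α / 2) (hb2 : b ≤ δ / (8 * γ)) {η t : ℝ} (hη : 0 < η) (ht : 0 ≤ t) :
    ‖vertInt η (fun z => Complex.exp (z * (t : ℂ))
        * (pHat Φ γ L z ((m : ℝ) / L) ^ 2 / (1 - pHat Φ γ L z ((m : ℝ) / L))))
        - ((1 / h * Real.exp (-t * R) : ℝ) : ℂ)‖
      ≤ C ^ 2 / (2 * b * (ω₀ ^ 2 / γ)) * Real.exp (-δ * t) := by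
  have hg := hγ.gamma_pos
  have hd : 0 < ω₀ ^ 2 / γ := div_pos (pow_pos hΦ.omega_pos 2) hγ.gamma_pos
  have hC0 : 0 ≤ C := (Finset.sum_nonneg fun j _ => abs_nonneg _).trans hC
  have hh0 : 0 < h := lt_of_lt_of_le (by positivity) hh
  have hgap := axisGap_pos (γ := γ) hα
  -- The linear term is at least `|z + R|/(2γ)`; by `h2` the Taylor remainder takes away at most
  -- half of it.
  have hnear : ∀ z : ℂ, -δ ≤ z.re → z.re ≤ 0 → |z.im| ≤ α →
      ‖z - -(R : ℂ)‖ * (1 / (4 * γ)) ≤ ‖1 - kerLap Φ γ L m z‖ := by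
    intro z hz hz0 him
    have hT := norm_lap_taylor_le hd (le_kerM hΦ hγ m) hC (z := z) (w := -(R : ℂ))
      (by linarith) (by simp; linarith)
    change ‖kerLap Φ γ L m z - kerLap Φ γ L m (-(R : ℂ))
      + kerLapD Φ γ L m (-(R : ℂ)) * (z - -(R : ℂ))‖ ≤ _ at hT
    rw [hroot, hDR] at hT
    set ρ := ‖z - -(R : ℂ)‖ with hρ
    have hρ1 : ρ ≤ δ + α := by
      refine (Complex.norm_le_abs_re_add_abs_im _).trans (add_le_add ?_ ?_)
      · simp only [Complex.sub_re, Complex.neg_re, Complex.ofReal_re]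
        rw [abs_le]
        constructor <;> linarith
      · simpa using him
    have h3 : ‖(h : ℂ) * (z - -(R : ℂ))‖ ≤ ‖1 - kerLap Φ γ L m z‖
        + ‖kerLap Φ γ L m z - 1 + h * (z - -(R : ℂ))‖ := by
      refine le_trans (le_of_eq ?_) (norm_add_le _ _)
      congr 1
      ring
    rw [norm_mul, Complex.norm_real, Real.norm_eq_abs, abs_of_pos hh0, ← hρ] at h3
    have hρ0 : 0 ≤ ρ := norm_nonneg _
    have h4 : C / (ω₀ ^ 2 / γ) ^ 3 * ρ ≤ 1 / (4 * γ) :=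
      le_trans (by gcongr) h2
    have h5 : C / (ω₀ ^ 2 / γ) ^ 3 * ρ ^ 2 ≤ 1 / (4 * γ) * ρ := by
      calc _ = C / (ω₀ ^ 2 / γ) ^ 3 * ρ * ρ := by ring
        _ ≤ _ := by gcongr
    have h6 : 1 / (2 * γ) * ρ ≤ h * ρ := by gcongr
    have h7 : 1 / (2 * γ) * ρ = 1 / (4 * γ) * ρ + 1 / (4 * γ) * ρ := by field_simp; ring
    linarith
  have hfar : ∀ z : ℂ, -δ ≤ z.re → z.re ≤ 0 → α ≤ |z.im| →
      axisGap γ α / 2 ≤ ‖1 - kerLap Φ γ L m z‖ := by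
    intro z hz hz0 him
    have := axisGap_sub_le_norm hΦ hγ hL m hC hδd hα hz hz0 him
    linarith
  have hpos := fun z (hz : 0 < z.re) => kerLap_ne_one_of_re_pos hΦ hγ hL m (z := z) hz
  have hcast : ((-R : ℝ) : ℂ) = -(R : ℂ) := by push_cast; rfl
  have hres := norm_vertInt_renewalFun_sub_residue_le (p := -R) (δ := δ) (η := η) (b := b)
    (b' := 1 - (kerLap Φ γ L 0 (η : ℂ)).re) (t := t) hd (le_kerM hΦ hγ m) hC hδd
    (by linarith) (by linarith) ht hb ?_ ?_ ?_ ?_ ?_ ?_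
  · rw [vertInt_pHat_eq hΦ hγ hL m hη]
    change ‖vertInt η (renewalFun (kerLap Φ γ L m) t) - Complex.exp (((-R : ℝ) : ℂ) * t)
      / kerLapD Φ γ L m ((-R : ℝ) : ℂ)‖ ≤ _ at hres
    rw [hcast, hDR] at hres
    convert hres using 3
    rw [one_div_mul_eq_div]
    push_cast
    congr 2
    ring
  · simpa using (hpos (η : ℂ) (by simpa using hη)).1
  · intro x
    set z : ℂ := ((-δ : ℝ) : ℂ) + Complex.I * (x : ℂ) with hz
    have hre : z.re = -δ := by simp [hz]
    rcases le_total α |z.im| with h3 | h3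
    · exact hb1.trans (hfar z hre.ge (by linarith) h3)
    · have h4 := hnear z hre.ge (by linarith) h3
      -- Since `R ≤ δ/2`, the shifted line keeps distance `δ/2` from the pole, whence the threshold
      -- `δ/(8γ)` for `b`.
      have h5 : δ / 2 ≤ ‖z - -(R : ℂ)‖ := by
        have := (abs_le.1 (Complex.abs_re_le_norm (z - -(R : ℂ)))).1
        simp only [Complex.sub_re, Complex.neg_re, Complex.ofReal_re, hre] at this
        linarith
      calc b ≤ δ / (8 * γ) := hb2
        _ = δ / 2 * (1 / (4 * γ)) := by field_simp; ring
        _ ≤ ‖z - -(R : ℂ)‖ * (1 / (4 * γ)) := by gcongr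
        _ ≤ _ := h4
  · intro x
    have h3 : ((η : ℂ) + Complex.I * (x : ℂ)).re = η := by simp
    have h4 := (hpos ((η : ℂ) + Complex.I * (x : ℂ)) (by rwa [h3])).2.1
    rw [h3] at h4
    exact h4
  · rw [hcast]
    exact hroot
  · rw [hcast]
    change kerLapD Φ γ L m (-(R : ℂ)) ≠ 0
    rw [hDR]
    exact_mod_cast hh0.ne'
  · intro z hz _ hzp
    rcases le_or_gt z.re 0 with h3 | h3
    · have h4 : 0 < ‖1 - kerLap Φ γ L m z‖ := by
        rcases le_total α |z.im| with h5 | h5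
        · exact lt_of_lt_of_le (by linarith) (hfar z hz h3 h5)
        · refine lt_of_lt_of_le ?_ (hnear z hz h3 h5)
          rw [hcast] at hzp
          exact mul_pos (norm_pos_iff.2 (sub_ne_zero.2 hzp)) (by positivity)
      have h5 := norm_pos_iff.1 h4
      exact fun h6 => h5 (sub_eq_zero.2 h6.symm)
    · exact (hpos z h3).2.2

/-- The solution of the dispersion equation at small wave numbers. -/
theorem exists_dispersion_root (hΦ : CouplingAssumption Φ ω₀) (hγ : NoiseAssumption Φ γ) {K : ℝ}
    (hK : SmoothDecay (A2hat Φ γ) (ω₀ ^ 2 / γ / 2) K) (hL : 1 ≤ L) (m : ℤ) {C β e : ℝ}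
    (hC : ∑ j ∈ kerJ L, |kerC Φ γ L m j| ≤ C) (hβ : 0 < β) (hβd : β ≤ ω₀ ^ 2 / γ)
    (hMβ : 8 * γ * (C / (ω₀ ^ 2 / γ) ^ 3) * β ≤ 1)
    (hDβ : 2 * Dhat Φ γ L ((m : ℝ) / L) ≤ β)
    (he : 2 * Real.pi ^ 2 * ((m : ℝ) / L) ^ 2 * (2 * γ * K ^ 2 / (ω₀ ^ 2 / γ) ^ 2) ≤ e)
    (heγ : 4 * γ * e ≤ 1) :
    ∃ R ∈ Set.Icc 0 β, SolvesDispersion Φ γ L ((m : ℝ) / L) R ∧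
      (∀ r ∈ Set.Icc 0 β, SolvesDispersion Φ γ L ((m : ℝ) / L) r → r = R) ∧
      kerLap Φ γ L m (-(R : ℂ)) = 1 ∧
      1 / (2 * γ) ≤ ∫ s in Set.Ioi (0 : ℝ), s * Real.exp (s * R) * cosSum Φ γ L ((m : ℝ) / L) s ∧
      Dhat Φ γ L ((m : ℝ) / L) / 2 ≤ R ∧ R ≤ 2 * Dhat Φ γ L ((m : ℝ) / L) ∧
      |Dhat Φ γ L ((m : ℝ) / L) - R| ≤ γ * (e * R + C / (ω₀ ^ 2 / γ) ^ 3 * R ^ 2) := by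
  have hg := hγ.gamma_pos
  have hd : 0 < ω₀ ^ 2 / γ := div_pos (pow_pos hΦ.omega_pos 2) hγ.gamma_pos
  have hC0 : 0 ≤ C := (Finset.sum_nonneg fun j _ => abs_nonneg _).trans hC
  set d := ω₀ ^ 2 / γ with hd'
  set D := Dhat Φ γ L ((m : ℝ) / L) with hD
  set H : ℝ → ℝ := fun r => ∫ s in Set.Ioi (0 : ℝ), Real.exp (s * r) * cosSum Φ γ L ((m : ℝ) / L) s
    with hH
  set h : ℝ → ℝ := fun r =>
    ∫ s in Set.Ioi (0 : ℝ), s * Real.exp (s * r) * cosSum Φ γ L ((m : ℝ) / L) s with hh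
  have hHc : ∀ r ∈ Set.Icc 0 β, ((H r : ℝ) : ℂ) = kerLap Φ γ L m (-(r : ℂ)) := fun r hr =>
    (integrableOn_exp_mul_cosSum hΦ hγ hL m (by linarith [hr.2])).2
  have hhc : ∀ r ∈ Set.Icc 0 β, ((h r : ℝ) : ℂ) = kerLapD Φ γ L m (-(r : ℂ)) := fun r hr =>
    (integrableOn_mul_exp_mul_cosSum hΦ hγ hL m (by linarith [hr.2])).2
  have hre : ∀ r ∈ Set.Icc 0 β, -d ≤ (-(r : ℂ)).re := fun r hr => by
    simp only [Complex.neg_re, Complex.ofReal_re]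
    linarith [hr.2]
  have hlip : ∀ r ∈ Set.Icc 0 β, ∀ r' ∈ Set.Icc 0 β, |H r - H r'| ≤ C / d ^ 2 * |r - r'| := by
    intro r hr r' hr'
    have := norm_lap_sub_le hd (le_kerM hΦ hγ m) hC (hre r hr) (hre r' hr')
    change ‖kerLap Φ γ L m (-(r : ℂ)) - kerLap Φ γ L m (-(r' : ℂ))‖ ≤ _ at this
    rw [← hHc r hr, ← hHc r' hr', ← Complex.ofReal_sub, Complex.norm_real,
      show -(r : ℂ) - -(r' : ℂ) = ((r' - r : ℝ) : ℂ) by push_cast; ring, Complex.norm_real,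
      Real.norm_eq_abs, Real.norm_eq_abs, abs_sub_comm r' r] at this
    exact this
  have z0 : (0 : ℝ) ∈ Set.Icc 0 β := ⟨le_rfl, hβ.le⟩
  -- The deficit is `θ = D̂/γ`, so that `γθ = D̂` is the first approximation to the root.
  have key := exists_unique_root_of_taylor (H := H) (h := h) (θ := D / γ) (e := e)
    (M := C / d ^ 3) hg hβ (by positivity) hMβ ?_ ?_ ?_ ?_ ?_ ?_ ?_ heγ
  · obtain ⟨R, hR, hR1, huniq, hhR, b1, b2, b3⟩ := key
    have hγD : γ * (D / γ) = D := by field_simp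
    have hγD2 : 2 * γ * (D / γ) = 2 * D := by field_simp
    rw [hγD] at b1 b3
    rw [hγD2] at b2
    refine ⟨R, hR, hR1.symm, fun r hr hs => huniq r hr hs.symm, ?_, hhR, b1, b2, b3⟩
    rw [← hHc R hR, hR1, Complex.ofReal_one]
  · intro r hr r' hr'
    have := norm_lap_taylor_le hd (le_kerM hΦ hγ m) hC (hre r hr) (hre r' hr')
    change ‖kerLap Φ γ L m (-(r : ℂ)) - kerLap Φ γ L m (-(r' : ℂ))
      + kerLapD Φ γ L m (-(r' : ℂ)) * (-(r : ℂ) - -(r' : ℂ))‖ ≤ _ at this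
    rw [← hHc r hr, ← hHc r' hr', ← hhc r' hr',
      show -(r : ℂ) - -(r' : ℂ) = ((r' - r : ℝ) : ℂ) by push_cast; ring,
      ← Complex.ofReal_sub, ← Complex.ofReal_mul, ← Complex.ofReal_add, Complex.norm_real,
      Complex.norm_real, Real.norm_eq_abs, Real.norm_eq_abs, sq_abs] at this
    rw [show H r - H r' - h r' * (r - r') = H r - H r' + h r' * (r' - r) by ring]
    exact this.trans (le_of_eq (by ring))
  · intro r hr r' hr'
    have := norm_lapD_sub_le hd (le_kerM hΦ hγ m) hC (hre r hr) (hre r' hr')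
    change ‖kerLapD Φ γ L m (-(r : ℂ)) - kerLapD Φ γ L m (-(r' : ℂ))‖ ≤ _ at this
    rw [← hhc r hr, ← hhc r' hr', ← Complex.ofReal_sub, Complex.norm_real,
      show -(r : ℂ) - -(r' : ℂ) = ((r' - r : ℝ) : ℂ) by push_cast; ring, Complex.norm_real,
      Real.norm_eq_abs, Real.norm_eq_abs, abs_sub_comm r' r] at this
    exact this.trans (le_of_eq (by ring))
  · have h1 : LipschitzOnWith (Real.toNNReal (C / d ^ 2)) H (Set.Icc 0 β) := by
      refine LipschitzOnWith.of_dist_le_mul fun r hr r' hr' => ?_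
      rw [Real.dist_eq, Real.dist_eq, Real.coe_toNNReal _ (by positivity)]
      exact hlip r hr r' hr'
    exact h1.continuousOn
  · have h1 := hHc 0 z0
    rw [Complex.ofReal_zero, neg_zero, kerLap_at_zero hΦ hγ hK hL] at h1
    exact Complex.ofReal_injective h1
  · exact div_nonneg (Dhat_nonneg hγ _) hg.le
  · refine le_trans (le_of_eq ?_) hDβ
    field_simp
  · have h1 := norm_kerLapD_sub_le hΦ hγ hK hL m
    have h2 := hhc 0 z0
    rw [Complex.ofReal_zero, neg_zero] at h2
    rw [← h2, show (h 0 : ℂ) - 1 / (γ : ℂ) = ((h 0 - 1 / γ : ℝ) : ℂ) by push_cast; rfl,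
      Complex.norm_real, Real.norm_eq_abs] at h1
    exact h1.trans he

end
end VelocityFlip
end

/-! ### Choice of small constants. -/

noncomputable section
namespace VelocityFlip

theorem abs_div_le_half {L : ℕ} (hL : 1 ≤ L) {n : ℤ} (hn : n ∈ lattice L) :
    |(n : ℝ) / L| ≤ 1 / 2 := by
  have hL0 : (0 : ℝ) < L := by exact_mod_cast hL
  rw [mem_lattice] at hn
  have h1 : -(L : ℝ) ≤ 2 * n := by exact_mod_cast hn.1.le
  have h2 : 2 * (n : ℝ) ≤ L := by exact_mod_cast hn.2
  rw [abs_le]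
  constructor
  · rw [le_div_iff₀ hL0]; linarith
  · rw [div_le_iff₀ hL0]; linarith

theorem norm_dualInt_sub_le {L : ℕ} (hL : 1 ≤ L) {f g : ℝ → ℂ} {x : ℤ} {B : ℝ}
    (h : ∀ k ∈ dualLattice L, ‖f k - g k‖ ≤ B) :
    ‖dualInt L (fun k => wave k x * f k) - dualInt L (fun k => wave k x * g k)‖ ≤ B := by
  have hL0 : (0 : ℝ) < L := by exact_mod_cast hL
  rw [dualInt, dualInt, ← mul_sub, ← Finset.sum_sub_distrib, norm_mul, norm_div, norm_one,
    Complex.norm_natCast]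
  have h1 : ‖∑ n ∈ lattice L, (wave ((n : ℝ) / L) x * f ((n : ℝ) / L)
      - wave ((n : ℝ) / L) x * g ((n : ℝ) / L))‖ ≤ ∑ n ∈ lattice L, B := by
    refine norm_sum_le_of_le _ fun n hn => ?_
    rw [← mul_sub, norm_mul, norm_wave, one_mul]
    exact h _ ⟨n, hn, rfl⟩
  rw [Finset.sum_const, card_lattice, nsmul_eq_mul] at h1
  calc _ ≤ 1 / (L : ℝ) * (L * B) := by gcongr
    _ = B := by field_simp

/-- The order matters: `α` is fixed first from `v`, which fixes the gap on the axis, and only then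
is the shift `δ` made small against that gap. -/
theorem exists_contour_shift {γ d M M' v : ℝ} (hd : 0 < d) (hM : 0 < M) (hM' : 0 < M')
    (hv : 0 < v) : ∃ α δ : ℝ, 0 < α ∧ 0 < δ ∧ δ ≤ d ∧ M * δ ≤ axisGap γ α / 2 ∧
      M' * (δ + α) ≤ v := by
  have hα : 0 < v / (2 * M') := by positivity
  have hgap := axisGap_pos (γ := γ) hα
  refine ⟨v / (2 * M'), min d (min (v / (2 * M')) (axisGap γ (v / (2 * M')) / (2 * M))), hα,
    by positivity, min_le_left _ _, ?_, ?_⟩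
  · have h : min d (min (v / (2 * M')) (axisGap γ (v / (2 * M')) / (2 * M)))
        ≤ axisGap γ (v / (2 * M')) / (2 * M) := (min_le_right _ _).trans (min_le_right _ _)
    rw [le_div_iff₀ (by positivity)] at h
    linarith
  · have h : min d (min (v / (2 * M')) (axisGap γ (v / (2 * M')) / (2 * M)))
        ≤ v / (2 * M') := (min_le_right _ _).trans (min_le_left _ _)
    calc _ ≤ M' * (v / (2 * M') + v / (2 * M')) := by gcongr
      _ = v := by field_simp; ring

theorem exists_pos_le_le {x y : ℝ} (hx : 0 < x) (hy : 0 < y) : ∃ b, 0 < b ∧ b ≤ x ∧ b ≤ y :=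
  ⟨min x y, lt_min hx hy, min_le_left _ _, min_le_right _ _⟩

theorem exists_pos_mul_sq_le {X Y : ℝ} (hX : 0 ≤ X) (hY : 0 < Y) :
    ∃ ε : ℝ, 0 < ε ∧ ∀ x, 0 ≤ x → x ≤ ε → X * x ^ 2 ≤ Y := by
  have hε : 0 < min 1 (Y / (X + 1)) := by positivity
  refine ⟨min 1 (Y / (X + 1)), hε, fun x hx0 hx => ?_⟩
  have h1 : x ≤ 1 := hx.trans (min_le_left _ _)
  have h2 : x ≤ Y / (X + 1) := hx.trans (min_le_right _ _)
  rw [le_div_iff₀ (by positivity)] at h2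
  have h3 : X * x ^ 2 ≤ X * x := by
    gcongr
    nlinarith
  linarith

end VelocityFlip
end

/-! ### Assembly of the decomposition and of the estimates. -/

set_option maxHeartbeats 1000000 in
open VelocityFlip in
theorem proposition4p7 (Φ : ℤ → ℝ) (γ ω₀ : ℝ)
    (hΦ : VelocityFlip.CouplingAssumption Φ ω₀)
    (hγ : VelocityFlip.NoiseAssumption Φ γ) :
    ∃ (c₀ δ ε₀ β c₁ c₂ c₃ c₄ κ : ℝ) (L₀ : ℕ),
      0 < c₀ ∧ 0 < δ ∧ 0 < ε₀ ∧ 0 < β ∧ 1 ≤ L₀ ∧ β ≤ (ω₀ ^ 2 / γ) / 2 ∧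
      0 < c₁ ∧ 0 < c₂ ∧ 0 < c₃ ∧ 0 < c₄ ∧ 0 < κ ∧
      ∀ L : ℕ, L₀ ≤ L →
        ∃ R a : ℝ → ℝ,
          -- the definition of `R` and `a` on the dual lattice
          (∀ k ∈ VelocityFlip.dualLattice L, ε₀ < |k| → a k = 0 ∧ R k = β) ∧
          (∀ k ∈ VelocityFlip.dualLattice L, |k| ≤ ε₀ →
            R k ∈ Set.Icc 0 β ∧ VelocityFlip.SolvesDispersion Φ γ L k (R k) ∧
            (∀ r ∈ Set.Icc 0 β, VelocityFlip.SolvesDispersion Φ γ L k r → r = R k) ∧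
            1 / a k = ∫ s in Set.Ioi (0 : ℝ),
              s * Real.exp (s * R k) * VelocityFlip.cosSum Φ γ L k s) ∧
          -- the decomposition of the Green's function, for every admissible contour
          (∀ η : ℝ, 0 < η → ∀ x ∈ VelocityFlip.lattice L, ∀ t : ℝ, 0 ≤ t →
            ∃ Δ : ℂ,
              VelocityFlip.green Φ γ L η t x =
                VelocityFlip.dualInt L (fun k => VelocityFlip.wave k x *
                  ((a k * Real.exp (-t * R k) : ℝ) : ℂ)) + Δ ∧
              ‖Δ‖ ≤ c₀ * Real.exp (-δ * t)) ∧
          -- the estimates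
          (∀ k ∈ VelocityFlip.dualLattice L, |k| ≤ ε₀ →
            (0 < a k ∧ a k ≤ c₀) ∧
            (c₁ * k ^ 2 ≤ R k ∧ R k ≤ c₂ * k ^ 2) ∧
            |VelocityFlip.Dhat Φ γ L k - R k| ≤ c₄ * k ^ 4) ∧
          (κ ≤ ∫ s in Set.Ioi (0 : ℝ), ∑ y ∈ VelocityFlip.lattice L,
            (y : ℝ) ^ 2 * VelocityFlip.memKernel Φ γ L s y) ∧
          (∀ k ∈ VelocityFlip.dualLattice L,
            c₃ * (min |k| ε₀) ^ 2 ≤ VelocityFlip.Dhat Φ γ L k) := by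
  have hg := hγ.gamma_pos
  have hd : 0 < ω₀ ^ 2 / γ := div_pos (pow_pos hΦ.omega_pos 2) hg
  obtain ⟨K, hK⟩ := smoothDecay_A2hat hΦ hγ
  obtain ⟨Q, hQ0, hQ⟩ := exists_qFun_bound hΦ hγ
  obtain ⟨κ, L₁, hκ, hκL⟩ := exists_le_secondMoment hΦ hγ
  set d := ω₀ ^ 2 / γ with hdd
  have hpi := Real.pi_pos
  obtain ⟨C, hC0, hC⟩ : ∃ C : ℝ, 0 < C ∧ ∀ L : ℕ, 1 ≤ L → ∀ m : ℤ,
      ∑ j ∈ kerJ L, |kerC Φ γ L m j| ≤ C :=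
    ⟨8 * γ * Q ^ 2, by positivity, fun L hL m => sum_abs_kerC_le hγ hL hQ m⟩
  -- the constants of the local analysis near the root
  obtain ⟨β, hβ0, hβd, hβM'⟩ := exists_pos_le_le (half_pos hd)
    (by positivity : 0 < 1 / (8 * γ * (C / d ^ 3)))
  have hβM : 8 * γ * (C / d ^ 3) * β ≤ 1 := by
    rw [le_div_iff₀ (by positivity)] at hβM'
    linarith
  obtain ⟨α₀, δ₁, hα₀0, hδ₁0, hδ₁d, hδ₁gap, hδ₁r⟩ := exists_contour_shift (γ := γ) hd
    (by positivity : 0 < C / d ^ 2) (by positivity : 0 < C / d ^ 3)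
    (by positivity : 0 < 1 / (4 * γ))
  obtain ⟨b₁, hb₁0, hb₁, hb₁'⟩ := exists_pos_le_le (half_pos (axisGap_pos (γ := γ) hα₀0))
    (by positivity : 0 < δ₁ / (8 * γ))
  -- the threshold in the wave number
  obtain ⟨N, hN0, hN⟩ : ∃ N : ℝ, 0 ≤ N ∧ N = 2 * Real.pi ^ 2 * (2 * γ * K ^ 2 / d ^ 2) :=
    ⟨_, by positivity, rfl⟩
  obtain ⟨U, hU0, hU⟩ : ∃ U : ℝ, 0 ≤ U ∧ U = γ * (2 * Real.pi ^ 2 * (2 * γ * K ^ 2 / d)) :=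
    ⟨_, by positivity, rfl⟩
  obtain ⟨M, hM0, hM⟩ : ∃ M : ℝ, 0 ≤ M ∧ M = 2 * γ * K ^ 2 / d := ⟨_, by positivity, rfl⟩
  obtain ⟨c₂, hc₂0, hc₂⟩ : ∃ c₂ : ℝ, 0 < c₂ ∧ c₂ = 2 * U + 1 := ⟨_, by positivity, rfl⟩
  -- The four conditions keep the slope near `1/γ`, place the root in `[0, β]`, make the quartic
  -- term in the lower bound on `D̂` harmless, and keep `R ≤ δ₁/2`, well inside the shifted contour.
  obtain ⟨ε₀, hε₀, hεN, hεU, hεM, hεc⟩ : ∃ ε : ℝ, 0 < ε ∧ 4 * γ * N * ε ^ 2 ≤ 1 ∧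
      2 * U * ε ^ 2 ≤ β ∧ 8 * M * ε ^ 2 ≤ κ ∧ c₂ * ε ^ 2 ≤ δ₁ / 2 := by
    obtain ⟨e₁, p₁, h₁⟩ := exists_pos_mul_sq_le (by positivity : 0 ≤ 4 * γ * N) one_pos
    obtain ⟨e₂, p₂, h₂⟩ := exists_pos_mul_sq_le (by positivity : 0 ≤ 2 * U) hβ0
    obtain ⟨e₃, p₃, h₃⟩ := exists_pos_mul_sq_le (by positivity : 0 ≤ 8 * M) hκ
    obtain ⟨e₄, p₄, h₄⟩ := exists_pos_mul_sq_le hc₂0.le (half_pos hδ₁0)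
    have hpos : 0 < min (min e₁ e₂) (min e₃ e₄) := by positivity
    exact ⟨_, hpos, h₁ _ hpos.le ((min_le_left _ _).trans (min_le_left _ _)),
      h₂ _ hpos.le ((min_le_left _ _).trans (min_le_right _ _)),
      h₃ _ hpos.le ((min_le_right _ _).trans (min_le_left _ _)),
      h₄ _ hpos.le ((min_le_right _ _).trans (min_le_right _ _))⟩
  -- the constants away from the root
  obtain ⟨c', L₂, hc', hcL⟩ := exists_le_Dhat hΦ hγ hε₀
  obtain ⟨α₁, δ₂, hα₁0, hδ₂0, hδ₂d, hδ₂gap, hδ₂r⟩ := exists_contour_shift (γ := γ) hd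
    (by positivity : 0 < C / d ^ 2) (by positivity : 0 < C / d ^ 2)
    (by positivity : 0 < c' / (2 * γ))
  obtain ⟨b₂, hb₂0, hb₂, hb₂'⟩ := exists_pos_le_le (half_pos (axisGap_pos (γ := γ) hα₁0))
    (by positivity : 0 < c' / (2 * γ))
  obtain ⟨B₁, hB₁0, hB₁⟩ : ∃ B : ℝ, 0 < B ∧ B = C ^ 2 / (2 * b₁ * d) := ⟨_, by positivity, rfl⟩
  obtain ⟨B₂, hB₂0, hB₂⟩ : ∃ B : ℝ, 0 < B ∧ B = C ^ 2 / (2 * b₂ * d) := ⟨_, by positivity, rfl⟩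
  obtain ⟨δ, hδ0, hδδ₁, hδδ₂⟩ := exists_pos_le_le hδ₁0 hδ₂0
  -- In `c₀`, `2γ` bounds `a` because the slope is at least `1/(2γ)`, `2γK²` bounds the term
  -- `p_{t,x}`, and `B₁`, `B₂` bound the shifted integrals at small and large wave numbers. The
  -- value of `c₁` comes from `R ≥ D̂/2 ≥ 2γκk²`.
  refine ⟨2 * γ + 2 * γ * K ^ 2 + B₁ + B₂, δ, ε₀, β, 2 * γ * κ, c₂,
    min (4 * γ * κ) (c' / ε₀ ^ 2), γ * (N * c₂ + C / d ^ 3 * c₂ ^ 2), κ, max 1 (max L₁ L₂),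
    by positivity, hδ0, hε₀, hβ0, le_max_left _ _, hβd, by positivity, hc₂0,
    by positivity, by positivity, hκ, ?_⟩
  intro L hLL
  have hL : 1 ≤ L := (le_max_left _ _).trans hLL
  have hL₁ : L₁ ≤ L := ((le_max_left _ _).trans (le_max_right _ _)).trans hLL
  have hL₂ : L₂ ≤ L := ((le_max_right _ _).trans (le_max_right _ _)).trans hLL
  have hκ' := hκL L hL₁ hL
  have hDup : ∀ k : ℝ, Dhat Φ γ L k ≤ U * k ^ 2 := by
    intro k
    refine (Dhat_le hΦ hγ hd hK hL k).trans (le_of_eq ?_)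
    rw [hU]
    ring
  have hsq : ∀ k : ℝ, |k| ≤ ε₀ → k ^ 2 ≤ ε₀ ^ 2 := by
    intro k hk
    rw [← sq_abs k]
    gcongr
  have hDlow : ∀ k : ℝ, |k| ≤ ε₀ → 4 * γ * κ * k ^ 2 ≤ Dhat Φ γ L k := by
    intro k hk
    refine le_trans ?_ (le_Dhat hΦ hγ hd hK hL k)
    have h1 : 8 * M * k ^ 2 ≤ κ := le_trans (by gcongr 8 * M * ?_; exact hsq k hk) hεM
    calc 4 * γ * κ * k ^ 2 = γ * (8 * k ^ 2 * κ - 4 * k ^ 2 * κ) := by ring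
      _ ≤ γ * (8 * k ^ 2 * κ - 4 * k ^ 2 * (8 * M * k ^ 2)) :=
        mul_le_mul_of_nonneg_left (sub_le_sub_left (mul_le_mul_of_nonneg_left h1
          (by positivity)) _) hg.le
      _ = γ * (8 * k ^ 2 * κ - 32 * k ^ 4 * M) := by ring
      _ ≤ _ := by
        rw [← hM]
        gcongr
  -- Posed for every real `k`, with lattice membership as a hypothesis, so that choice yields total
  -- functions `R` and `a`.
  have hroot : ∀ k : ℝ, ∃ r a : ℝ,
      (ε₀ < |k| → a = 0 ∧ r = β) ∧ (k ∈ dualLattice L → |k| ≤ ε₀ →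
        r ∈ Set.Icc 0 β ∧ SolvesDispersion Φ γ L k r ∧
        (∀ r' ∈ Set.Icc 0 β, SolvesDispersion Φ γ L k r' → r' = r) ∧
        1 / a = (∫ s in Set.Ioi (0 : ℝ), s * Real.exp (s * r) * cosSum Φ γ L k s) ∧
        0 < a ∧ a ≤ 2 * γ ∧ 2 * γ * κ * k ^ 2 ≤ r ∧ r ≤ c₂ * k ^ 2 ∧
        |Dhat Φ γ L k - r| ≤ γ * (N * c₂ + C / d ^ 3 * c₂ ^ 2) * k ^ 4 ∧
        ∀ η t : ℝ, 0 < η → 0 ≤ t → ‖vertInt η (fun z => Complex.exp (z * (t : ℂ))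
          * (pHat Φ γ L z k ^ 2 / (1 - pHat Φ γ L z k)))
          - ((a * Real.exp (-t * r) : ℝ) : ℂ)‖ ≤ B₁ * Real.exp (-δ₁ * t)) := by
    intro k
    by_cases hk : k ∈ dualLattice L ∧ |k| ≤ ε₀
    · obtain ⟨⟨m, hm, rfl⟩, hkε⟩ := hk
      set k : ℝ := (m : ℝ) / L with hk
      have hk2 := hsq k hkε
      have hDβ : 2 * Dhat Φ γ L k ≤ β := by
        have h1 : U * k ^ 2 ≤ U * ε₀ ^ 2 := by gcongr
        linarith [hDup k]
      have hNk : 4 * γ * (N * k ^ 2) ≤ 1 := by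
        rw [← mul_assoc]
        exact le_trans (by gcongr) hεN
      obtain ⟨R, hR, hs, hu, hR1, hlow, d1, d2, d3⟩ := exists_dispersion_root hΦ hγ hK hL m
        (hC L hL m) hβ0 (by linarith) hβM hDβ (e := N * k ^ 2)
        (le_of_eq (by rw [hN]; ring)) hNk
      set h := ∫ s in Set.Ioi (0 : ℝ), s * Real.exp (s * R) * cosSum Φ γ L k s with hh
      have hh0 : 0 < h := lt_of_lt_of_le (by positivity) hlow
      have hRc : R ≤ c₂ * k ^ 2 := by
        have h1 := hDup k
        have h2 := sq_nonneg k
        rw [hc₂]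
        linarith only [h1, h2, d2]
      have hRδ : R ≤ δ₁ / 2 := hRc.trans (le_trans (by gcongr) hεc)
      refine ⟨R, 1 / h, fun h' => absurd hkε (not_le.2 h'), fun _ _ =>
        ⟨hR, hs, hu, one_div_one_div h, by positivity, ?_, ?_, hRc, ?_, ?_⟩⟩
      · rw [div_le_iff₀ hh0]
        rw [div_le_iff₀ (by positivity)] at hlow
        linarith
      · linarith [hDlow k hkε]
      · refine d3.trans ?_
        have hR0 := hR.1
        calc γ * (N * k ^ 2 * R + C / d ^ 3 * R ^ 2)
            ≤ γ * (N * k ^ 2 * (c₂ * k ^ 2) + C / d ^ 3 * (c₂ * k ^ 2) ^ 2) := by gcongr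
          _ = _ := by ring
      · intro η t hη ht
        have hDR : kerLapD Φ γ L m (-(R : ℂ)) = h :=
          ((integrableOn_mul_exp_mul_cosSum hΦ hγ hL m (by linarith [hR.2])).2).symm
        rw [hB₁]
        exact norm_vertInt_sub_le_of_root hΦ hγ hL m (hC L hL m) hδ₁0 hδ₁d hα₀0 hb₁0 hR.1 hRδ hR1
          hDR hlow hδ₁gap hδ₁r hb₁ hb₁' hη ht
    · exact ⟨β, 0, fun _ => ⟨rfl, rfl⟩, fun h1 h2 => absurd ⟨h1, h2⟩ hk⟩
  choose R a hfar hnear using hroot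
  refine ⟨R, a, fun k _ => hfar k, fun k hk hkε => ?_, ?_, fun k hk hkε => ?_, hκ', ?_⟩
  · obtain ⟨h1, h2, h3, h4, -⟩ := hnear k hk hkε
    exact ⟨h1, h2, h3, h4⟩
  · intro η hη x _ t ht
    refine ⟨green Φ γ L η t x - dualInt L (fun k => wave k x *
      ((a k * Real.exp (-t * R k) : ℝ) : ℂ)), by ring, ?_⟩
    have hexp : ∀ δ' : ℝ, δ ≤ δ' → Real.exp (-δ' * t) ≤ Real.exp (-δ * t) := by
      intro δ' hδ'
      apply Real.exp_le_exp.2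
      nlinarith
    have hp : ‖(memKernel Φ γ L t x : ℂ)‖ ≤ 2 * γ * K ^ 2 * Real.exp (-δ * t) := by
      rw [Complex.norm_real, Real.norm_eq_abs, abs_of_nonneg (memKernel_nonneg hγ t x)]
      refine (memKernel_le hγ hK hL ht x).trans ?_
      have := hexp d (hδδ₁.trans hδ₁d)
      gcongr
    have hmain := norm_dualInt_sub_le hL (x := x) (B := (B₁ + B₂) * Real.exp (-δ * t))
      (f := fun k => vertInt η (fun z => Complex.exp (z * (t : ℂ))
          * (pHat Φ γ L z k ^ 2 / (1 - pHat Φ γ L z k))))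
      (g := fun k => ((a k * Real.exp (-t * R k) : ℝ) : ℂ)) (by
        intro k hk
        rcases le_or_gt |k| ε₀ with hkε | hkε
        · obtain ⟨-, -, -, -, -, -, -, -, -, h⟩ := hnear k hk hkε
          refine (h η t hη ht).trans ?_
          have h1 := hexp δ₁ hδδ₁
          gcongr
          linarith
        -- Here `a = 0`: the entire contour integral belongs to the error term.
        · rw [(hfar k hkε).1, zero_mul, Complex.ofReal_zero, sub_zero]
          obtain ⟨m, hm, rfl⟩ := hk
          refine (norm_vertInt_le_of_Dhat hΦ hγ hK hL m (hC L hL m) hδ₂0 hδ₂d hα₁0 hb₂0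
            (hcL L hL₂ hL m hkε.le (abs_div_le_half hL hm)) hδ₂gap hδ₂r hb₂
            hb₂' hη ht).trans ?_
          rw [← hB₂]
          have h1 := hexp δ₂ hδδ₂
          gcongr
          linarith)
    rw [green, add_sub_assoc]
    refine (norm_add_le _ _).trans ((add_le_add hp hmain).trans ?_)
    rw [← add_mul]
    exact mul_le_mul_of_nonneg_right (by linarith) (Real.exp_pos _).le
  · obtain ⟨-, -, -, -, h5, h6, h7, h8, h9, -⟩ := hnear k hk hkε
    refine ⟨⟨h5, h6.trans ?_⟩, ⟨h7, h8⟩, h9⟩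
    have : 0 ≤ 2 * γ * K ^ 2 := by positivity
    linarith
  · intro k hk
    rcases le_or_gt |k| ε₀ with hkε | hkε
    · rw [min_eq_left hkε, sq_abs]
      refine le_trans ?_ (hDlow k hkε)
      gcongr
      exact min_le_left _ _
    · rw [min_eq_right hkε.le]
      obtain ⟨m, hm, rfl⟩ := hk
      refine le_trans ?_ (hcL L hL₂ hL m hkε.le (abs_div_le_half hL hm))
      calc min (4 * γ * κ) (c' / ε₀ ^ 2) * ε₀ ^ 2 ≤ c' / ε₀ ^ 2 * ε₀ ^ 2 := by
            gcongr
            exact min_le_right _ _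
        _ = c' := by field_simp
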